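/- Let $\mathcal T$ be a tree on $p\ge 2$ vertices $\mathcal V=\{1,\dots,p\}$ with maximum degree $d$, and assume $p\ge 82d$. Let $\rho=\tanh\lambda\in(0,1)$ and let $X^{(1)},X^{(2)},\dots$ be i.i.d. samples of the homogeneous zero-field Ising model on $\mathcal T$, $P(x)\propto\exp\big(\lambda\sum_{\{i,j\}\in\mathcal E(\mathcal T)}x_ix_j\big)$, $x\in\{\pm1\}^p$, so that every edge has correlation $\rho$. Write $\hat\rho_{ij}(m)=\frac1m\sum_{\ell=1}^m X_i^{(\ell)}X_j^{(\ell)}$. *Passive algorithm.* $\hat{\mathcal T}_{\rm SCL}(m)$ is a tree on $\mathcal V$ maximizing $\sum_{e}\hat\rho_e(m)$ over its edges $e$ (ties are broken by an arbitrary fixed rule). Put $\hat\rho(m)=\frac1{p-1}\sum_{e\in\mathcal E(\hat{\mathcal T}_{\rm SCL}(m))}\hat\rho_e(m)$. *Active algorithm (Active-LATHE) with budget $n$.* Let $\hat\alpha(r)$ be $1,\,0.995,\,0.985,\,0.95,\,0.9,\,0.85,\,0.8$ for $r$ in $(-\infty,0.02)$, $[0.02,0.07)$, $[0.07,0.16)$,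 $[0.16,0.34)$, $[0.34,0.53)$, $[0.53,0.76)$, $[0.76,\infty)$ respectively. Set $\hat\alpha_1=0.8$, $\hat\alpha_{i+1}=\hat\alpha\big(\hat\rho(\lfloor\hat\alpha_i n\rfloor)\big)$, let $i\ge1$ be the first index with $\hat\alpha_{i+1}\le\hat\alpha_i$, and put $\hat\alpha=\hat\alpha_i$, $m=\lfloor\hat\alpha n\rfloor$. A path $i-j-k$ ($i\ne k$) of $\hat{\mathcal T}_{\rm SCL}(m)$ is *confident* if $\hat\rho_{ik}(m)\le\frac{11+9\hat\rho(m)}{20}\hat\rho_{ij}(m)$ and $\hat\rho_{ik}(m)\le\frac{11+9\hat\rho(m)}{20}\hat\rho_{jk}(m)$. Let $U$ be the graph formed by the two edges of every path $i-j-k$ of $\hat{\mathcal T}_{\rm SCL}(m)$ that is not confident, and let $\tilde p$ be the number of vertices that lie on its edges. Acquire $\lfloor(1-\hat\alpha)np/\tilde p\rfloor$ further samples of these $\tilde p$ vertices (none if $\tilde p=0$). On the vertex set of each connected component of $U$, find a tree maximizing the sum of the empirical correlations computed from all samples acquired (the first $m$ and the further ones), and replace the edges of that component in $\hat{\mathcal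 T}_{\rm SCL}(m)$ by this tree; the result is $\hat{\mathcal T}_{\rm active}(n)$. Let $K_{\rm passive}(\mathcal T,\rho)=\liminf_{n\to\infty}-\frac1n\log\Pr\big(\hat{\mathcal T}_{\rm SCL}(n)\ne\mathcal T\big)$ and $K_{\rm active}(\mathcal T,\rho)=\liminf_{n\to\infty}-\frac1n\log\Pr\big(\hat{\mathcal T}_{\rm active}(n)\neq\mathcal T\big)$. Then $$K_{\rm passive}(\mathcal T,\rho)=-\log\Big(1-\tfrac{1-\rho}{2}\big(1-\sqrt{1-\rho^2}\big)\Big)\quad\text{and}\quad K_{\rm active}(\mathcal T,\rho)\ \ge\ c_\rho\,K_{\rm passive}(\mathcal T,\rho),$$ where $c_\rho=1,\,1.01,\,1.03,\,1.08,\,1.19,\,1.29,\,1.4$ for $\rho$ in $(0,0.03)$, $[0.03,0.1)$, $[0.1,0.2)$, $[0.2,0.4)$, $[0.4,0.6)$, $[0.6,0.8)$, $[0.8,1)$ respectively. -/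

import Mathlib

open MeasureTheory ProbabilityTheory Filter

noncomputable section

namespace ActiveLathe

variable {V : Type*}

/-- The product `x i * x j` of the spins at the two ends of a pair `{i, j}`, as a real number. -/
def spinProd (x : V → ℤˣ) : Sym2 V → ℝ :=
  Sym2.lift ⟨fun i j => (((x i * x j : ℤˣ) : ℤ) : ℝ), fun i j => by simp only [mul_comm]⟩

/-- The total weight of the edges of a graph. -/
def graphWeight [Fintype V] (w : Sym2 V → ℝ) (H : SimpleGraph V) : ℝ :=
  open Classical in ∑ e ∈ H.edgeFinset, w e

/-! ### The homogeneous Ising model with zero external field -/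

/-- The unnormalised weight `exp (λ ∑_{ {i,j} ∈ E } x_i x_j)`. -/
def isingWeight [Fintype V] (T : SimpleGraph V) (lam : ℝ) (x : V → ℤˣ) : ℝ :=
  Real.exp (lam * graphWeight (spinProd x) T)

/-- The partition function. -/
def isingZ [Fintype V] [DecidableEq V] (T : SimpleGraph V) (lam : ℝ) : ℝ :=
  ∑ x : V → ℤˣ, isingWeight T lam x

theorem isingZ_pos [Fintype V] [DecidableEq V] (T : SimpleGraph V) (lam : ℝ) :
    0 < isingZ T lam :=
  Finset.sum_pos (fun _ _ => Real.exp_pos _) Finset.univ_nonempty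

/-- The Ising distribution on `{+1, -1}^V`. -/
def isingPMF [Fintype V] [DecidableEq V] (T : SimpleGraph V) (lam : ℝ) : PMF (V → ℤˣ) :=
  PMF.ofFintype (fun x => ENNReal.ofReal (isingWeight T lam x / isingZ T lam)) (by
    have h0 : ∀ x ∈ Finset.univ, 0 ≤ isingWeight T lam x / isingZ T lam :=
      fun x _ => div_nonneg (Real.exp_pos _).le (isingZ_pos T lam).le
    rw [← ENNReal.ofReal_sum_of_nonneg h0, ← Finset.sum_div]
    change ENNReal.ofReal (isingZ T lam / isingZ T lam) = 1
    rw [div_self (isingZ_pos T lam).ne', ENNReal.ofReal_one])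

/-! ### Maximum-weight trees -/

/-- `H` is a tree whose vertex set is `S`. -/
def IsTreeOn (S : Set V) (H : SimpleGraph V) : Prop :=
  (∀ ⦃i j : V⦄, H.Adj i j → i ∈ S ∧ j ∈ S) ∧ (H.induce S).IsTree

/-- `H` is a maximum-weight tree with vertex set `S`. -/
def IsMaxTreeOn [Fintype V] (S : Set V) (w : Sym2 V → ℝ) (H : SimpleGraph V) : Prop :=
  IsTreeOn S H ∧ ∀ H' : SimpleGraph V, IsTreeOn S H' → graphWeight w H' ≤ graphWeight w H

/-- A rule that selects one maximum-weight tree on every nonempty vertex set: it implements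
`argmax` over trees together with an arbitrary way of breaking ties. -/
structure MaxTreeRule (V : Type*) [Fintype V] where
  tree : Set V → (Sym2 V → ℝ) → SimpleGraph V
  isMax : ∀ (S : Set V) (w : Sym2 V → ℝ), S.Nonempty → IsMaxTreeOn S w (tree S w)

/-- Such rules exist. -/
instance [Fintype V] : Nonempty (MaxTreeRule V) := by
  classical
  have h : ∀ (S : Set V) (w : Sym2 V → ℝ), ∃ H : SimpleGraph V,
      S.Nonempty → IsMaxTreeOn S w H := by
    intro S w
    by_cases hS : S.Nonempty
    · have : Nonempty S := hS.to_subtype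
      obtain ⟨H₀, -, hH₀⟩ :=
        (SimpleGraph.connected_top (V := S)).exists_isTree_le
      have hne : {H : SimpleGraph V | IsTreeOn S H}.Nonempty := by
        refine ⟨H₀.map (Function.Embedding.subtype (· ∈ S)), ?_, ?_⟩
        · rintro i j ⟨-, a, b, -, rfl, rfl⟩
          exact ⟨a.2, b.2⟩
        · have e := SimpleGraph.comap_map_eq (Function.Embedding.subtype (· ∈ S)) H₀
          rw [← e] at hH₀
          exact hH₀
      obtain ⟨H, hH, hmax⟩ :=
        Set.exists_max_image _ (graphWeight w) (Set.toFinite _) hne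
      exact ⟨H, fun _ => ⟨hH, hmax⟩⟩
    · exact ⟨⊥, fun h => absurd h hS⟩
  choose f hf using h
  exact ⟨⟨f, hf⟩⟩

/-! ### Empirical correlations and the simplified Chow–Liu estimate

A sequence `x : ℕ → V → ℤˣ` is the stream of vector samples. -/

/-- Empirical correlation of a pair, computed from the first `m` samples. -/
def empCorr (x : ℕ → V → ℤˣ) (m : ℕ) (e : Sym2 V) : ℝ :=
  (∑ l ∈ Finset.range m, spinProd (x l) e) / m

/-- The simplified Chow–Liu tree learned from the first `m` vector samples. -/
def sclTree [Fintype V] (R : MaxTreeRule V) (x : ℕ → V → ℤˣ) (m : ℕ) : SimpleGraph V :=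
  R.tree Set.univ (empCorr x m)

/-- The estimate of the edge correlation: the average of the empirical correlations over the
`p - 1` edges of the simplified Chow–Liu tree. -/
def rhoHat [Fintype V] (R : MaxTreeRule V) (x : ℕ → V → ℤˣ) (m : ℕ) : ℝ :=
  graphWeight (empCorr x m) (sclTree R x m) / ((Fintype.card V : ℝ) - 1)

/-! ### Global learning phase -/

/-- The fraction of samples prescribed for an estimated correlation `r`. The first and the last
interval are prolonged to `r ≤ 0` and `r ≥ 1`. -/
def alphaTable (r : ℝ) : ℝ :=
  if r < 0.02 then 1
  else if r < 0.07 then 0.995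
  else if r < 0.16 then 0.985
  else if r < 0.34 then 0.95
  else if r < 0.53 then 0.9
  else if r < 0.76 then 0.85
  else 0.8

/-- The fractions `α̂_0 = 0`, `α̂_1 = 0.8`, `α̂_{i+1} = α̂(ρ̂(⌊α̂_i n⌋))` of the successive
iterations. -/
def alphaSeq [Fintype V] (R : MaxTreeRule V) (x : ℕ → V → ℤˣ) (n : ℕ) : ℕ → ℝ
  | 0 => 0
  | 1 => 0.8
  | i + 2 => alphaTable (rhoHat R x ⌊alphaSeq R x n (i + 1) * n⌋₊)

/-- The `while` loop of the global phase terminates. -/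
theorem exists_stop [Fintype V] (R : MaxTreeRule V) (x : ℕ → V → ℤˣ) (n : ℕ) :
    ∃ i, 1 ≤ i ∧ alphaSeq R x n (i + 1) ≤ alphaSeq R x n i := by
  by_contra! h
  have hm : StrictMono fun i : ℕ => alphaSeq R x n (i + 2) :=
    strictMono_nat_of_lt_succ fun i => h (i + 2) (by omega)
  have hfin : (Set.range fun i : ℕ => alphaSeq R x n (i + 2)).Finite := by
    refine Set.Finite.subset
      (Set.toFinite ({1, 0.995, 0.985, 0.95, 0.9, 0.85, 0.8} : Set ℝ)) ?_
    rintro _ ⟨i, rfl⟩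
    simp only [alphaSeq, alphaTable]
    split_ifs <;> simp
  exact Set.infinite_range_of_injective hm.injective hfin

/-- The fraction `α̂` of vector samples used by the last iteration of the global phase. -/
def alphaHat [Fintype V] (R : MaxTreeRule V) (x : ℕ → V → ℤˣ) (n : ℕ) : ℝ :=
  open Classical in alphaSeq R x n (Nat.find (exists_stop R x n))

/-- The number of vector samples acquired in the global phase. -/
def globalCount [Fintype V] (R : MaxTreeRule V) (x : ℕ → V → ℤˣ) (n : ℕ) : ℕ :=
  ⌊alphaHat R x n * n⌋₊

/-! ### Local refinement phase -/

/-- The `(i, j, k)`-confident event, based on `m` vector samples. -/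
def Confident [Fintype V] (R : MaxTreeRule V) (x : ℕ → V → ℤˣ) (m : ℕ) (i j k : V) : Prop :=
  empCorr x m s(i, k) ≤ empCorr x m s(i, j) * ((11 + 9 * rhoHat R x m) / 20) ∧
  empCorr x m s(i, k) ≤ empCorr x m s(j, k) * ((11 + 9 * rhoHat R x m) / 20)

/-- `i - j - k` is a path of the simplified Chow–Liu tree for which the confident event fails. -/
def UnconfidentTriple [Fintype V] (R : MaxTreeRule V) (x : ℕ → V → ℤˣ) (m : ℕ)
    (i j k : V) : Prop :=
  i ≠ k ∧ (sclTree R x m).Adj i j ∧ (sclTree R x m).Adj j k ∧ ¬ Confident R x m i j k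

/-- The graph of unconfident edges: both edges of every unconfident triple. -/
def unconfidentGraph [Fintype V] (R : MaxTreeRule V) (x : ℕ → V → ℤˣ) (m : ℕ) :
    SimpleGraph V :=
  SimpleGraph.fromRel fun a b =>
    ∃ c, UnconfidentTriple R x m a b c ∨ UnconfidentTriple R x m c a b

/-- The number of unconfident nodes, i.e. of end points of unconfident edges. -/
def unconfidentCount [Fintype V] (R : MaxTreeRule V) (x : ℕ → V → ℤˣ) (m : ℕ) : ℕ :=
  (unconfidentGraph R x m).support.ncard

/-- The number of additional sub-vector samples, each of which is a sample of the unconfident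
nodes only. -/
def localCount [Fintype V] (R : MaxTreeRule V) (x : ℕ → V → ℤˣ) (n : ℕ) : ℕ :=
  ⌊(1 - alphaHat R x n) * n * Fintype.card V /
    (unconfidentCount R x (globalCount R x n) : ℝ)⌋₊

/-- The output of the active algorithm with a budget of `n` vector samples. The global phase
reads the first `globalCount` elements of the stream; the sub-vector samples of the local phase are
the restrictions of the next `localCount` elements to the unconfident nodes. On every connected
component of the graph of unconfident edges (only the coordinates in the component are read) the
tree is relearned from all these samples, and it replaces the unconfident edges there. -/
def activeTree [Fintype V] (R : MaxTreeRule V) (x : ℕ → V → ℤˣ) (n : ℕ) : SimpleGraph V :=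
  let m := globalCount R x n
  let U := unconfidentGraph R x m
  (sclTree R x m \ U) ⊔
    ⨆ C : U.ConnectedComponent, R.tree C.supp (empCorr x (m + localCount R x n))

/-! ### Exponents and constants -/

/-- The exponent `liminf_n -(1/n) log Pr(A n)` of a sequence of events, in `[-∞, ∞]`, with
`log 0 = -∞`. -/
def exponent {Ω : Type*} [MeasurableSpace Ω] (μ : Measure Ω) (A : ℕ → Set Ω) : EReal :=
  liminf (fun n : ℕ => -ENNReal.log (μ (A n)) / (n : EReal)) atTop

/-- The error exponent of the passive algorithm, run on the stream `X` of random samples. -/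
def passiveExponent {Ω : Type*} [MeasurableSpace Ω] [Fintype V] (μ : Measure Ω)
    (X : ℕ → Ω → V → ℤˣ) (R : MaxTreeRule V) (T : SimpleGraph V) : EReal :=
  exponent μ fun n => {ω | sclTree R (fun l => X l ω) n ≠ T}

/-- The error exponent of the active algorithm, run on the stream `X` of random samples. -/
def activeExponent {Ω : Type*} [MeasurableSpace Ω] [Fintype V] (μ : Measure Ω)
    (X : ℕ → Ω → V → ℤˣ) (R : MaxTreeRule V) (T : SimpleGraph V) : EReal :=
  exponent μ fun n => {ω | activeTree R (fun l => X l ω) n ≠ T}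

/-- The closed form of the passive exponent. -/
def kPassive (ρ : ℝ) : ℝ :=
  -Real.log (1 - (1 - ρ) / 2 * (1 - Real.sqrt (1 - ρ ^ 2)))

/-- The gain `c_ρ`, for `0 < ρ < 1`. -/
def gain (ρ : ℝ) : ℝ :=
  if ρ < 0.03 then 1
  else if ρ < 0.1 then 1.01
  else if ρ < 0.2 then 1.03
  else if ρ < 0.4 then 1.08
  else if ρ < 0.6 then 1.19
  else if ρ < 0.8 then 1.29
  else 1.4

end ActiveLathe

end

/-! Flipping all spins on one side of an edge of a tree changes the Ising weight only through that
edge. Hence the spin products over the edges are independent signs of mean ρ (`isingE_spinProd_mul`,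
`isingE_average`), and each error event comes down to a moment generating function in a few such
signs.

Passive exponent. By the exchange property of maximum-weight trees, an error requires a non-edge uv
to become at least as heavy as an edge e of T that separates u from v (`sclTree_eq_of_separated`).
The product over uv is s_e z with z independent of s_e and of mean at most ρ, and the tilt λ/2
bounds the moment generating function by 1 - y, where y = (1-ρ)(1-√(1-ρ²))/2 is `crossRate`. A union
bound gives one inequality. For the other, a path i-j-k of T is tilted slightly beyond the optimum,
so that the crossover of ik with jk has positive drift (`le_measure_sum_pos`), and the excess tends
to 0.

Active exponent, deterministic part. A crossover of ik with jk on a path i-j-k of T is called an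
arc, with pivot ij: its increment s_jk(s_ij - 1) vanishes unless the pivot is flipped. Weights are
`Regular` if pairs at distance at least 3 are not overweight, edges are positive, no arc is strong
enough to look confident, and all arcs have the same pivot, up to reversal of a path. Then every
wrong edge of the first tree joins two ends of a path of length two, is unconfident, and lies in a
component of U that also contains the midpoint. So the components are connected in T, and relearning
them repairs the tree as soon as the enlarged sample separates the non-edges (`repair_eq`,
`activeTree_eq`).

Active exponent, probabilistic part. Outside an event of exponent 7/5 K, the estimate of ρ is within
ρ(1-ρ)/6, so the fraction α is suitable. Failure of regularity has exponent at least
α·`globalGain`·K, since each of its causes involves either more independent signs than a single arc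
or a stronger deviation (`boundedBy_not_regular`). There remain crossovers at distance two in the
enlarged sample. If at most p/3 nodes are unconfident, that sample has about (3-2α)n elements or
more, which suffices (`boundedBy_few`). Otherwise p ≥ 82d forces eight edge-disjoint paths of T,
disjoint also from the path of the crossover, along which a confidence test fails; their joint cost
adds 2/5 K to the K of the crossover (`boundedBy_many`). The random fraction and the random number
of unconfident nodes take finitely many values, so all this is a finite union of events with
deterministic sample sizes (`le_activeExponent`). -/

namespace ActiveLathe

/-! ### Edges that separate two vertices -/

section Cuts

variable {V : Type*} {G H T : SimpleGraph V}

/-- Removing the edge `e` separates `u` from `v`. -/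
def Cuts (G : SimpleGraph V) (e : Sym2 V) (u v : V) : Prop :=
  ¬ (G.deleteEdges {e}).Reachable u v

theorem Cuts.symm {e : Sym2 V} {u v : V} (h : Cuts G e u v) : Cuts G e v u :=
  fun h' => h h'.symm

theorem Cuts.ne {e : Sym2 V} {u v : V} (h : Cuts G e u v) : u ≠ v := by
  rintro rfl
  exact h (SimpleGraph.Reachable.refl u)

theorem reachable_deleteEdges_of_adj {e : Sym2 V} {u v : V} (h : G.Adj u v) (he : s(u, v) ≠ e) :
    (G.deleteEdges {e}).Reachable u v :=
  SimpleGraph.Adj.reachable (by simp [h, he])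

theorem Cuts.eq_of_adj {e : Sym2 V} {u v : V} (h : Cuts G e u v) (ha : G.Adj u v) :
    s(u, v) = e := by
  by_contra hne
  exact h (reachable_deleteEdges_of_adj ha hne)

theorem cuts_of_adj (hG : G.IsAcyclic) {a b : V} (h : G.Adj a b) : Cuts G s(a, b) a b :=
  SimpleGraph.isBridge_iff.1 (SimpleGraph.isAcyclic_iff_forall_adj_isBridge.1 hG h)

theorem reachable_deleteEdges_of_notMem {e : Sym2 V} {u v : V} (p : G.Walk u v)
    (h : e ∉ p.edges) : (G.deleteEdges {e}).Reachable u v :=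
  ⟨p.toDeleteEdges {e} (by rintro e' he' rfl; exact h he')⟩

theorem cuts_of_mem_edges (hG : G.IsAcyclic) {e : Sym2 V} {u v : V} (p : G.Walk u v)
    (hp : p.edges.Nodup) (he : e ∈ p.edges) : Cuts G e u v := by
  induction p with
  | nil => simp at he
  | @cons u v w h q ih =>
    rw [SimpleGraph.Walk.edges_cons, List.nodup_cons] at hp
    rw [SimpleGraph.Walk.edges_cons, List.mem_cons] at he
    rcases he with rfl | he
    · intro hr
      exact cuts_of_adj hG h (hr.trans (reachable_deleteEdges_of_notMem q hp.1).symm)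
    · intro hr
      have hne : s(u, v) ≠ e := by
        rintro rfl
        exact hp.1 he
      exact ih hp.2 he ((reachable_deleteEdges_of_adj h hne).symm.trans hr)

theorem Cuts.mem_edges {e : Sym2 V} {u v : V} (h : Cuts G e u v) (p : G.Walk u v) :
    e ∈ p.edges := by
  by_contra hn
  exact h (reachable_deleteEdges_of_notMem p hn)

/-- A walk that starts on one side of a cut and ends on the other has a step across it. The walk may
live in another graph: this compares `T` with the learned tree in both directions. -/
theorem Cuts.exists_mem_walk {e : Sym2 V} {u v : V} (h : Cuts G e u v) (p : H.Walk u v) :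
    ∃ a b, H.Adj a b ∧ s(a, b) ∈ p.edges ∧ Cuts G e a b := by
  obtain ⟨d, hd, h1, h2⟩ := p.exists_boundary_dart {x | (G.deleteEdges {e}).Reachable u x}
    (SimpleGraph.Reachable.refl u) h
  refine ⟨d.fst, d.snd, d.adj, ?_, fun hr => h2 (h1.trans hr)⟩
  exact List.mem_map_of_mem (f := SimpleGraph.Dart.edge) hd

theorem reachable_deleteEdges_or {a b u v : V} (huv : G.Reachable u v)
    (hu : (G.deleteEdges {s(a, b)}).Reachable a u ∨ (G.deleteEdges {s(a, b)}).Reachable b u) :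
    (G.deleteEdges {s(a, b)}).Reachable a v ∨ (G.deleteEdges {s(a, b)}).Reachable b v := by
  obtain ⟨p⟩ := huv
  induction p with
  | nil => exact hu
  | @cons u v w h q ih =>
    apply ih
    by_cases he : s(u, v) = s(a, b)
    · rcases Sym2.eq_iff.1 he with ⟨-, rfl⟩ | ⟨-, rfl⟩
      · exact Or.inr (SimpleGraph.Reachable.refl _)
      · exact Or.inl (SimpleGraph.Reachable.refl _)
    · have := reachable_deleteEdges_of_adj h he
      exact hu.imp (fun h => h.trans this) (fun h => h.trans this)

/-- In a tree, an edge `ab` cuts `u` from `v` iff exactly one of them is on the side of `a`. -/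
theorem cuts_iff_of_isTree (hG : G.IsTree) {a b : V} (hab : G.Adj a b) (u v : V) :
    Cuts G s(a, b) u v ↔ ¬ ((G.deleteEdges {s(a, b)}).Reachable a u ↔
      (G.deleteEdges {s(a, b)}).Reachable a v) := by
  have hc := cuts_of_adj hG.isAcyclic hab
  have key : ∀ x, (G.deleteEdges {s(a, b)}).Reachable a x ∨
      (G.deleteEdges {s(a, b)}).Reachable b x := fun x =>
    reachable_deleteEdges_or (hG.connected.preconnected a x)
      (Or.inl (SimpleGraph.Reachable.refl _))
  constructor
  · intro h hiff
    by_cases hu : (G.deleteEdges {s(a, b)}).Reachable a u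
    · exact h (hu.symm.trans (hiff.1 hu))
    · have hv : ¬ (G.deleteEdges {s(a, b)}).Reachable a v := fun h' => hu (hiff.2 h')
      exact h (((key u).resolve_left hu).symm.trans ((key v).resolve_left hv))
  · intro h hr
    exact h ⟨fun h' => h'.trans hr, fun h' => h'.trans hr.symm⟩

/-- A missing edge would be a bridge of `T` that `H` bypasses. -/
theorem eq_of_le_of_connected (hT : T.IsAcyclic) (hF : H.Connected) (hle : H ≤ T) : H = T := by
  refine le_antisymm hle fun a b hab => ?_
  by_contra hn
  refine cuts_of_adj hT hab ((hF.preconnected a b).mono fun u v huv => ?_)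
  rw [SimpleGraph.deleteEdges_adj]
  refine ⟨hle huv, fun he => hn ?_⟩
  rcases Sym2.eq_iff.1 he with ⟨rfl, rfl⟩ | ⟨rfl, rfl⟩
  · exact huv
  · exact huv.symm

end Cuts

/-! ### Exchange properties of maximum-weight trees -/

section Exchange

variable {V : Type*} {S : Set V} {H T : SimpleGraph V}

theorem reachable_induce {u v : V} (hu : u ∈ S) (hv : v ∈ S)
    (hS : ∀ ⦃i j : V⦄, H.Adj i j → i ∈ S ∧ j ∈ S) (h : H.Reachable u v) :
    (H.induce S).Reachable ⟨u, hu⟩ ⟨v, hv⟩ := by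
  obtain ⟨p⟩ := h
  induction p with
  | nil => exact SimpleGraph.Reachable.refl _
  | @cons u v w h q ih =>
    have hvS := (hS h).2
    exact (SimpleGraph.Adj.reachable (G := H.induce S) (u := ⟨u, hu⟩) (v := ⟨v, hvS⟩) h).trans
      (ih hvS hv)

theorem reachable_of_induce {u v : S} (h : (H.induce S).Reachable u v) :
    H.Reachable u v :=
  h.map (SimpleGraph.Embedding.induce S).toHom

theorem IsTreeOn.reachable (hH : IsTreeOn S H) {u v : V} (hu : u ∈ S) (hv : v ∈ S) :
    H.Reachable u v :=
  reachable_of_induce (hH.2.connected.preconnected ⟨u, hu⟩ ⟨v, hv⟩)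

theorem IsTreeOn.isAcyclic (hH : IsTreeOn S H) : H.IsAcyclic := by
  intro v c hc
  have hsupp : ∀ x ∈ c.support, x ∈ S := by
    intro x hx
    obtain ⟨y, hxy⟩ : ∃ y, H.Adj x y := by
      by_contra! hno
      have hcn : ¬ c.Nil := hc.not_nil
      have hx' := SimpleGraph.Walk.mem_support_iff_exists_mem_edges.1 hx
      rcases hx' with rfl | ⟨e, he, hxe⟩
      · exact hno _ (c.adj_snd hcn)
      · obtain ⟨z, rfl⟩ := hxe
        exact hno z (c.adj_of_mem_edges he)
    exact (hH.1 hxy).1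
  refine hH.2.isAcyclic (c.induce S hsupp) ?_
  rw [← SimpleGraph.Walk.isCycle_map_iff_of_injective
    (f := (SimpleGraph.Embedding.induce (G := H) S).toHom)
    (SimpleGraph.Embedding.induce (G := H) S).injective,
    SimpleGraph.Walk.map_induce]
  exact hc

theorem isTreeOn_univ_iff : IsTreeOn Set.univ H ↔ H.IsTree := by
  have e : H.induce Set.univ ≃g H := SimpleGraph.induceUnivIso H
  simp only [IsTreeOn, Set.mem_univ, and_self, implies_true, true_and]
  exact e.isTree_iff

/-- Exchanging an edge of a tree for a pair that it cuts gives a tree. -/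
theorem IsTreeOn.exchange (hH : IsTreeOn S H) {c d a b : V} (hcd : H.Adj c d) (ha : a ∈ S)
    (hb : b ∈ S) (hcut : Cuts H s(c, d) a b) :
    IsTreeOn S (H.deleteEdges {s(c, d)} ⊔ SimpleGraph.edge a b) := by
  set H' := H.deleteEdges {s(c, d)} ⊔ SimpleGraph.edge a b with hH'
  have hS : ∀ ⦃i j : V⦄, H'.Adj i j → i ∈ S ∧ j ∈ S := by
    intro i j hij
    rw [hH', SimpleGraph.sup_adj, SimpleGraph.edge_adj] at hij
    rcases hij with hij | ⟨⟨rfl, rfl⟩ | ⟨rfl, rfl⟩, -⟩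
    · exact hH.1 ((SimpleGraph.deleteEdges_le _) hij)
    · exact ⟨ha, hb⟩
    · exact ⟨hb, ha⟩
  have hle : H.deleteEdges {s(c, d)} ≤ H' := le_sup_left
  have hab : H'.Reachable a b := by
    apply SimpleGraph.Adj.reachable
    rw [hH', SimpleGraph.sup_adj, SimpleGraph.edge_adj]
    exact Or.inr ⟨Or.inl ⟨rfl, rfl⟩, hcut.ne⟩
  have key : ∀ x ∈ S, (H.deleteEdges {s(c, d)}).Reachable c x ∨
      (H.deleteEdges {s(c, d)}).Reachable d x := fun x hx =>
    reachable_deleteEdges_or (hH.reachable (hH.1 hcd).1 hx)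
      (Or.inl (SimpleGraph.Reachable.refl _))
  -- The ends of the new edge lie on different sides of the cut, so it reconnects `c` with `d`.
  have hcd' : H'.Reachable c d := by
    rcases key a ha with h1 | h1 <;> rcases key b hb with h2 | h2
    · exact absurd (h1.symm.trans h2) hcut
    · exact (h1.mono hle).trans (hab.trans (h2.mono hle).symm)
    · exact (h2.mono hle).trans (hab.symm.trans (h1.mono hle).symm)
    · exact absurd (h1.symm.trans h2) hcut
  have hc : ∀ x ∈ S, H'.Reachable c x := by
    intro x hx
    rcases key x hx with h | h
    · exact h.mono hle
    · exact hcd'.trans (h.mono hle)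
  refine ⟨hS, ?_, ?_⟩
  · have : Nonempty S := ⟨⟨a, ha⟩⟩
    refine ⟨fun u v => ?_⟩
    exact reachable_induce u.2 v.2 hS ((hc u u.2).symm.trans (hc v v.2))
  · exact (SimpleGraph.IsAcyclic.sup_edge_of_not_reachable hcut
      (hH.isAcyclic.anti (SimpleGraph.deleteEdges_le _))).induce S

theorem graphWeight_eq_sum [Fintype V] (w : Sym2 V → ℝ) (H : SimpleGraph V)
    [Fintype H.edgeSet] : graphWeight w H = ∑ e ∈ H.edgeFinset, w e := by
  unfold graphWeight
  congr!

theorem graphWeight_exchange [Fintype V] (w : Sym2 V → ℝ) {c d a b : V} (hcd : H.Adj c d)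
    (hcut : Cuts H s(c, d) a b) :
    graphWeight w (H.deleteEdges {s(c, d)} ⊔ SimpleGraph.edge a b) =
      graphWeight w H - w s(c, d) + w s(a, b) := by
  classical
  have hset : (H.deleteEdges {s(c, d)} ⊔ SimpleGraph.edge a b).edgeFinset =
      insert s(a, b) (H.edgeFinset.erase s(c, d)) := by
    ext e
    induction e with
    | _ x y =>
      simp only [SimpleGraph.mem_edgeFinset, SimpleGraph.mem_edgeSet, SimpleGraph.sup_adj,
        SimpleGraph.deleteEdges_adj, SimpleGraph.edge_adj, Finset.mem_insert, Finset.mem_erase,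
        Set.mem_singleton_iff, Sym2.eq_iff, ne_eq]
      have := hcut.ne
      constructor
      · rintro (⟨h1, h2⟩ | ⟨h, -⟩)
        · exact Or.inr ⟨h2, h1⟩
        · tauto
      · rintro ((⟨rfl, rfl⟩ | ⟨rfl, rfl⟩) | ⟨h1, h2⟩) <;> tauto
  have hnot : s(a, b) ∉ H.edgeFinset.erase s(c, d) := by
    intro hm
    rw [Finset.mem_erase, SimpleGraph.mem_edgeFinset, SimpleGraph.mem_edgeSet] at hm
    exact hm.1 (hcut.eq_of_adj hm.2)
  have hmem : s(c, d) ∈ H.edgeFinset := by simpa using hcd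
  rw [graphWeight_eq_sum, graphWeight_eq_sum, hset, Finset.sum_insert hnot,
    ← Finset.add_sum_erase H.edgeFinset w hmem]
  ring

/-- The exchanged tree is not heavier. The inequality holds for every tie-breaking rule, so error
events are phrased with `≤` and ties need no further care. -/
theorem IsMaxTreeOn.le_of_cuts [Fintype V] {w : Sym2 V → ℝ} (hH : IsMaxTreeOn S w H)
    {c d a b : V} (hcd : H.Adj c d) (ha : a ∈ S) (hb : b ∈ S) (hcut : Cuts H s(c, d) a b) :
    w s(a, b) ≤ w s(c, d) := by
  have h := hH.2 _ (hH.1.exchange hcd ha hb hcut)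
  rw [graphWeight_exchange w hcd hcut] at h
  linarith

/-- Every non-edge of `T` is lighter than each edge of `T` that cuts it. -/
def Separated (T : SimpleGraph V) (w : Sym2 V → ℝ) (u v : V) : Prop :=
  ∀ ⦃a b : V⦄, T.Adj a b → Cuts T s(a, b) u v → w s(u, v) < w s(a, b)

/-- A maximum-weight tree on a `T`-connected set only uses edges of `T`, if the non-edges of `T`
in that set are separated. -/
theorem IsMaxTreeOn.le_of_separated [Fintype V] (hT : T.IsAcyclic) {w : Sym2 V → ℝ}
    (hH : IsMaxTreeOn S w H) (hS : (T.induce S).Preconnected)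
    (hsep : ∀ u ∈ S, ∀ v ∈ S, u ≠ v → ¬ T.Adj u v → Separated T w u v) : H ≤ T := by
  intro u v huv
  by_contra hn
  obtain ⟨hu, hv⟩ := hH.1.1 huv
  obtain ⟨q, hq⟩ := (hS ⟨u, hu⟩ ⟨v, hv⟩).exists_isPath
  have hcut := cuts_of_adj hH.1.isAcyclic huv
  -- The `T`-path from `u` to `v` crosses the cut that `uv` makes in `H`. The crossing edge cuts
  -- `uv` in `T`, so it is strictly heavier than `uv`, against the maximality of `H`.
  obtain ⟨d, hd, h1, h2⟩ := q.exists_boundary_dart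
    {x | (H.deleteEdges {s(u, v)}).Reachable u x} (SimpleGraph.Reachable.refl u) hcut
  have hcut' : Cuts H s(u, v) d.fst d.snd := fun hr => h2 (h1.trans hr)
  have hle := hH.le_of_cuts huv d.fst.2 d.snd.2 hcut'
  have hmem : s((d.fst : V), (d.snd : V)) ∈
      (q.map (SimpleGraph.Embedding.induce S).toHom).edges := by
    rw [SimpleGraph.Walk.edges_map]
    exact List.mem_map.2 ⟨d.edge, List.mem_map_of_mem (f := SimpleGraph.Dart.edge) hd, rfl⟩
  have hpath : (q.map (SimpleGraph.Embedding.induce S).toHom).IsPath :=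
    hq.map (SimpleGraph.Embedding.induce (G := T) S).injective
  have hT' := cuts_of_mem_edges hT _ hpath.isTrail.edges_nodup hmem
  exact absurd (hsep u hu v hv huv.ne hn d.adj hT') (not_lt.2 hle)

/-- Relearning the components of `U` repairs `H`, if the edges of `H` outside `U` are correct and
the components of `U` are `T`-connected. -/
theorem repair_eq [Fintype V] (hT : T.IsAcyclic) {U : SimpleGraph V} (hH : H.Connected)
    (hHU : ∀ ⦃a b⦄, H.Adj a b → ¬ U.Adj a b → T.Adj a b)
    (hU : ∀ ⦃a b⦄, U.Adj a b → T.Adj a b ∨ ∃ j, T.Adj a j ∧ T.Adj j b ∧ U.Reachable a j)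
    (R : MaxTreeRule V) {w : Sym2 V → ℝ}
    (hsep : ∀ u v, U.Reachable u v → u ≠ v → ¬ T.Adj u v → Separated T w u v) :
    (H \ U) ⊔ ⨆ C : U.ConnectedComponent, R.tree C.supp w = T := by
  have hmax : ∀ C : U.ConnectedComponent, IsMaxTreeOn C.supp w (R.tree C.supp w) :=
    fun C => R.isMax _ _ C.nonempty_supp
  have hreach : ∀ (C : U.ConnectedComponent) (u v : V), u ∈ C.supp → v ∈ C.supp →
      U.Reachable u v := by
    intro C u v hu hv
    rw [SimpleGraph.ConnectedComponent.mem_supp_iff] at hu hv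
    exact SimpleGraph.ConnectedComponent.eq.1 (hu.trans hv.symm)
  have hpre : ∀ C : U.ConnectedComponent, (T.induce C.supp).Preconnected := by
    rintro C ⟨u, hu⟩ ⟨v, hv⟩
    obtain ⟨p⟩ := hreach C u v hu hv
    induction p with
    | nil => exact SimpleGraph.Reachable.refl _
    | @cons u v' w h q ih =>
      have hmem : ∀ x, U.Reachable u x → x ∈ C.supp := by
        intro x hx
        rw [SimpleGraph.ConnectedComponent.mem_supp_iff] at hu ⊢
        rw [← hu]
        exact SimpleGraph.ConnectedComponent.eq.2 hx.symm
      have hv' := hmem v' h.reachable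
      refine SimpleGraph.Reachable.trans ?_ (ih hv' hv)
      rcases hU h with h1 | ⟨j, h1, h2, h3⟩
      · exact SimpleGraph.Adj.reachable (G := T.induce C.supp) (u := ⟨u, hu⟩) (v := ⟨v', hv'⟩) h1
      · exact (SimpleGraph.Adj.reachable (G := T.induce C.supp) (u := ⟨u, hu⟩)
          (v := ⟨j, hmem j h3⟩) h1).trans
          (SimpleGraph.Adj.reachable (G := T.induce C.supp) (u := ⟨j, hmem j h3⟩)
          (v := ⟨v', hv'⟩) h2)
  have hle : ∀ C : U.ConnectedComponent, R.tree C.supp w ≤ T := fun C =>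
    (hmax C).le_of_separated hT (hpre C)
      fun u hu v hv => hsep u v (hreach C u v hu hv)
  -- Connectedness is inherited from `H`: a removed edge is bypassed inside the relearned tree of
  -- its component.
  apply eq_of_le_of_connected hT
  · have := hH.nonempty
    refine ⟨fun u v => ?_⟩
    obtain ⟨p⟩ := hH.preconnected u v
    induction p with
    | nil => exact SimpleGraph.Reachable.refl _
    | @cons a b w' h q ih =>
      refine SimpleGraph.Reachable.trans ?_ ih
      by_cases hab : U.Adj a b
      · let C := U.connectedComponentMk a
        have ha : a ∈ C.supp := rfl
        have hb : b ∈ C.supp := SimpleGraph.ConnectedComponent.eq.2 hab.reachable.symm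
        exact ((hmax C).1.reachable ha hb).mono
          ((le_iSup (fun C : U.ConnectedComponent => R.tree C.supp w) C).trans le_sup_right)
      · exact SimpleGraph.Adj.reachable (Or.inl ⟨h, hab⟩)
  · refine sup_le (fun a b hab => hHU hab.1 hab.2) (iSup_le hle)

theorem isTree_sclTree [Fintype V] [Nonempty V] (R : MaxTreeRule V) (x : ℕ → V → ℤˣ) (m : ℕ) :
    (sclTree R x m).IsTree :=
  isTreeOn_univ_iff.1 (R.isMax _ _ Set.univ_nonempty).1

theorem sclTree_le_of_cuts [Fintype V] [Nonempty V] (R : MaxTreeRule V) (x : ℕ → V → ℤˣ) (m : ℕ)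
    {c d a b : V} (hcd : (sclTree R x m).Adj c d) (hcut : Cuts (sclTree R x m) s(c, d) a b) :
    empCorr x m s(a, b) ≤ empCorr x m s(c, d) :=
  (R.isMax _ _ Set.univ_nonempty).le_of_cuts hcd (Set.mem_univ _) (Set.mem_univ _) hcut

theorem sclTree_eq_of_separated [Fintype V] (hT : T.IsTree) (R : MaxTreeRule V)
    (x : ℕ → V → ℤˣ) (m : ℕ)
    (hsep : ∀ u v, u ≠ v → ¬ T.Adj u v → Separated T (empCorr x m) u v) : sclTree R x m = T := by
  have := hT.connected.nonempty
  refine eq_of_le_of_connected hT.isAcyclic (isTree_sclTree R x m).connected ?_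
  refine (R.isMax _ _ Set.univ_nonempty).le_of_separated hT.isAcyclic ?_
    (fun u _ v _ => hsep u v)
  exact fun u v => reachable_induce u.2 v.2 (fun _ _ _ => ⟨Set.mem_univ _, Set.mem_univ _⟩)
    (hT.connected.preconnected u v)

end Exchange

end ActiveLathe

namespace ActiveLathe

/-! ### Expectations under the Ising model on a tree -/

section Spin

variable {V : Type*}

theorem spinProd_mk (x : V → ℤˣ) (i j : V) :
    spinProd x s(i, j) = (((x i : ℤˣ) : ℤ) : ℝ) * (((x j : ℤˣ) : ℤ) : ℝ) := by
  simp [spinProd]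

theorem coe_spin_mul_self (s : ℤˣ) : ((s : ℤ) : ℝ) * ((s : ℤ) : ℝ) = 1 := by
  rcases Int.units_eq_one_or s with rfl | rfl <;> simp

theorem spinProd_mul_spinProd (x : V → ℤˣ) (i j k : V) :
    spinProd x s(i, j) * spinProd x s(j, k) = spinProd x s(i, k) := by
  simp only [spinProd_mk]
  linear_combination ((x i : ℤ) : ℝ) * ((x k : ℤ) : ℝ) * coe_spin_mul_self (x j)

theorem spinProd_eq_one_or (x : V → ℤˣ) (e : Sym2 V) : spinProd x e = 1 ∨ spinProd x e = -1 := by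
  induction e with
  | _ i j =>
    rw [spinProd_mk]
    rcases Int.units_eq_one_or (x i) with h | h <;> rcases Int.units_eq_one_or (x j) with h' | h' <;>
      simp [h, h']

theorem spinProd_mul_self (x : V → ℤˣ) (e : Sym2 V) : spinProd x e * spinProd x e = 1 := by
  rcases spinProd_eq_one_or x e with h | h <;> simp [h]

theorem card_edgeFinset_of_isTree [Fintype V] {T : SimpleGraph V} (hT : T.IsTree) [Fintype T.edgeSet] :
    T.edgeFinset.card = Fintype.card V - 1 := by
  have := hT.card_edgeFinset
  omega

end Spin

/-! ### Independence of the edge spin products on a tree -/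

section IsingE

variable {V : Type*} [Fintype V] [DecidableEq V] {T : SimpleGraph V} {lam : ℝ}

/-- Expectation under the Ising model. -/
noncomputable def isingE (T : SimpleGraph V) (lam : ℝ) (g : (V → ℤˣ) → ℝ) : ℝ :=
  ∑ x, isingWeight T lam x / isingZ T lam * g x

theorem isingE_const (c : ℝ) : isingE T lam (fun _ => c) = c := by
  unfold isingE
  rw [← Finset.sum_mul, ← Finset.sum_div]
  change isingZ T lam / isingZ T lam * c = c
  rw [div_self (isingZ_pos T lam).ne', one_mul]

theorem isingE_add (g h : (V → ℤˣ) → ℝ) :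
    isingE T lam (fun x => g x + h x) = isingE T lam g + isingE T lam h := by
  simp only [isingE, mul_add, Finset.sum_add_distrib]

theorem isingE_const_mul (c : ℝ) (g : (V → ℤˣ) → ℝ) :
    isingE T lam (fun x => c * g x) = c * isingE T lam g := by
  simp only [isingE, Finset.mul_sum]
  exact Finset.sum_congr rfl fun x _ => by ring

theorem isingE_mono {g h : (V → ℤˣ) → ℝ} (hgh : ∀ x, g x ≤ h x) :
    isingE T lam g ≤ isingE T lam h :=
  Finset.sum_le_sum fun x _ => mul_le_mul_of_nonneg_left (hgh x)
    (div_nonneg (Real.exp_pos _).le (isingZ_pos T lam).le)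

theorem isingE_nonneg {g : (V → ℤˣ) → ℝ} (hg : ∀ x, 0 ≤ g x) : 0 ≤ isingE T lam g := by
  simpa [isingE_const] using isingE_mono (T := T) (lam := lam) (g := fun _ => 0) hg

theorem isingE_pos {g : (V → ℤˣ) → ℝ} (hg : ∀ x, 0 < g x) : 0 < isingE T lam g :=
  Finset.sum_pos (fun x _ => mul_pos (div_pos (Real.exp_pos _) (isingZ_pos T lam)) (hg x))
    Finset.univ_nonempty

/-- Flip all spins on one side of the edge `e`. -/
noncomputable def flip (T : SimpleGraph V) (e : Sym2 V) (x : V → ℤˣ) : V → ℤˣ :=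
  open Classical in
  fun v => if (T.deleteEdges {e}).Reachable e.out.1 v then - x v else x v

theorem flip_flip (T : SimpleGraph V) (e : Sym2 V) (x : V → ℤˣ) : flip T e (flip T e x) = x := by
  ext v
  unfold flip
  split_ifs <;> simp

theorem spinProd_flip_of_cuts (hT : T.IsTree) {e : Sym2 V} (he : e ∈ T.edgeSet) {u v : V}
    (h : Cuts T e u v) (x : V → ℤˣ) : spinProd (flip T e x) s(u, v) = - spinProd x s(u, v) := by
  have hout : s(e.out.1, e.out.2) = e := Quot.out_eq e
  have hadj : T.Adj e.out.1 e.out.2 := by rwa [← SimpleGraph.mem_edgeSet, hout]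
  have h' := (cuts_iff_of_isTree hT hadj u v).1 (by rwa [hout])
  rw [hout] at h'
  rw [spinProd_mk, spinProd_mk]
  unfold flip
  by_cases h1 : (T.deleteEdges {e}).Reachable e.out.1 u <;>
    by_cases h2 : (T.deleteEdges {e}).Reachable e.out.1 v <;> simp_all

theorem spinProd_flip_of_not_cuts (hT : T.IsTree) {e : Sym2 V} (he : e ∈ T.edgeSet) {u v : V}
    (h : ¬ Cuts T e u v) (x : V → ℤˣ) : spinProd (flip T e x) s(u, v) = spinProd x s(u, v) := by
  have hout : s(e.out.1, e.out.2) = e := Quot.out_eq e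
  have hadj : T.Adj e.out.1 e.out.2 := by rwa [← SimpleGraph.mem_edgeSet, hout]
  have h' := not_not.1 ((cuts_iff_of_isTree hT hadj u v).not.1 (by rwa [hout]))
  rw [hout] at h'
  rw [spinProd_mk, spinProd_mk]
  unfold flip
  by_cases h1 : (T.deleteEdges {e}).Reachable e.out.1 u <;>
    by_cases h2 : (T.deleteEdges {e}).Reachable e.out.1 v <;> simp_all

theorem spinProd_flip_self (hT : T.IsTree) {e : Sym2 V} (he : e ∈ T.edgeSet) (x : V → ℤˣ) :
    spinProd (flip T e x) e = - spinProd x e := by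
  induction e with
  | _ a b => exact spinProd_flip_of_cuts hT he (cuts_of_adj hT.isAcyclic he) x

theorem spinProd_flip_of_ne (hT : T.IsTree) {e e' : Sym2 V} (he : e ∈ T.edgeSet)
    (he' : e' ∈ T.edgeSet) (hne : e' ≠ e) (x : V → ℤˣ) :
    spinProd (flip T e x) e' = spinProd x e' := by
  induction e' with
  | _ a b => exact spinProd_flip_of_not_cuts hT he (fun h => hne (h.eq_of_adj he')) x

/-- Only `e` joins the two sides, so it is the only term of the energy that changes sign. -/
theorem isingWeight_flip (hT : T.IsTree) {e : Sym2 V} (he : e ∈ T.edgeSet) (x : V → ℤˣ) :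
    isingWeight T lam (flip T e x) = isingWeight T lam x * Real.exp (-(2 * lam * spinProd x e)) := by
  classical
  have hmem : e ∈ T.edgeFinset := by simpa using he
  unfold isingWeight
  rw [← Real.exp_add, graphWeight_eq_sum, graphWeight_eq_sum, ← Finset.add_sum_erase _ _ hmem,
    ← Finset.add_sum_erase _ _ hmem, spinProd_flip_self hT he]
  have : ∀ e' ∈ T.edgeFinset.erase e, spinProd (flip T e x) e' = spinProd x e' := fun e' h' => by
    rw [Finset.mem_erase, SimpleGraph.mem_edgeFinset] at h'
    exact spinProd_flip_of_ne hT he h'.2 h'.1 x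
  rw [Finset.sum_congr rfl this]
  congr 1
  ring

/-- The spin product over an edge is independent of everything that is invariant under the flip of
one side of this edge. -/
theorem isingE_spinProd_mul (hT : T.IsTree) {e : Sym2 V} (he : e ∈ T.edgeSet)
    {h : (V → ℤˣ) → ℝ} (hinv : ∀ x, h (flip T e x) = h x) :
    isingE T lam (fun x => spinProd x e * h x) = Real.tanh lam * isingE T lam h := by
  set F : (V → ℤˣ) → ℝ := fun x => isingWeight T lam x * h x * (spinProd x e - Real.tanh lam)
    with hF
  have hflip : ∑ x, F (flip T e x) = ∑ x, F x :=
    Equiv.sum_comp (Function.Involutive.toPerm (flip T e) (flip_flip T e)) F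
  -- The two weights have the ratio exp(2λ s_e), which the values s_e - tanh λ and -s_e - tanh λ
  -- balance exactly.
  have hzero : ∀ x, F x + F (flip T e x) = 0 := by
    intro x
    simp only [hF, isingWeight_flip hT he, hinv, spinProd_flip_self hT he, Real.tanh_eq_sinh_div_cosh,
      Real.sinh_eq, Real.cosh_eq]
    have hpos := Real.exp_pos lam
    have hpos' := Real.exp_pos (-lam)
    have e1 : Real.exp (-(2 * lam)) = Real.exp (-lam) * Real.exp (-lam) := by
      rw [← Real.exp_add]; ring_nf
    have e2 : Real.exp (2 * lam) = Real.exp lam * Real.exp lam := by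
      rw [← Real.exp_add]; ring_nf
    have e3 : Real.exp lam * Real.exp (-lam) = 1 := by
      rw [← Real.exp_add]; simp
    rcases spinProd_eq_one_or x e with h1 | h1
    · rw [h1, mul_one, e1]
      field_simp
      linear_combination (-2 * isingWeight T lam x * h x * Real.exp (-lam)) * e3
    · rw [h1, show -(2 * lam * -1) = 2 * lam by ring, e2]
      field_simp
      linear_combination (2 * isingWeight T lam x * h x * Real.exp lam) * e3
  have hsum : ∑ x, F x = 0 := by
    have : ∑ x, (F x + F (flip T e x)) = 0 := Finset.sum_eq_zero fun x _ => hzero x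
    rw [Finset.sum_add_distrib, hflip] at this
    linarith
  have hd : isingE T lam (fun x => spinProd x e * h x) - Real.tanh lam * isingE T lam h =
      (∑ x, F x) / isingZ T lam := by
    simp only [isingE, hF, Finset.mul_sum, Finset.sum_div, ← Finset.sum_sub_distrib]
    exact Finset.sum_congr rfl fun x _ => by ring
  rw [hsum, zero_div] at hd
  linarith

/-- Averaging over the spin product of one edge. -/
theorem isingE_average (hT : T.IsTree) {e : Sym2 V} (he : e ∈ T.edgeSet)
    (F : ℝ → (V → ℤˣ) → ℝ) (h1 : ∀ x, F 1 (flip T e x) = F 1 x)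
    (h2 : ∀ x, F (-1) (flip T e x) = F (-1) x) :
    isingE T lam (fun x => F (spinProd x e) x) = isingE T lam (fun x =>
      (1 + Real.tanh lam) / 2 * F 1 x + (1 - Real.tanh lam) / 2 * F (-1) x) := by
  -- Every function of a sign is affine in it.
  have hF : (fun x => F (spinProd x e) x) = fun x => (1 / 2 * (F 1 x + F (-1) x)) +
      spinProd x e * (1 / 2 * (F 1 x - F (-1) x)) := by
    funext x
    rcases spinProd_eq_one_or x e with h | h <;> rw [h] <;> ring
  have hF' : (fun x => (1 + Real.tanh lam) / 2 * F 1 x + (1 - Real.tanh lam) / 2 * F (-1) x) =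
      fun x => (1 / 2 * (F 1 x + F (-1) x)) + Real.tanh lam * (1 / 2 * (F 1 x - F (-1) x)) := by
    funext x
    ring
  rw [hF, hF', isingE_add, isingE_add, isingE_spinProd_mul hT he (fun x => by rw [h1, h2]),
    isingE_const_mul (Real.tanh lam)]

theorem isingE_edge (hT : T.IsTree) {e : Sym2 V} (he : e ∈ T.edgeSet) (F : ℝ → ℝ) :
    isingE T lam (fun x => F (spinProd x e)) =
      (1 + Real.tanh lam) / 2 * F 1 + (1 - Real.tanh lam) / 2 * F (-1) := by
  rw [isingE_average hT he (fun s _ => F s) (fun _ => rfl) (fun _ => rfl), isingE_const]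

theorem isingE_edge_edge (hT : T.IsTree) {e e' : Sym2 V} (he : e ∈ T.edgeSet)
    (he' : e' ∈ T.edgeSet) (hne : e ≠ e') (F : ℝ → ℝ → ℝ) :
    isingE T lam (fun x => F (spinProd x e) (spinProd x e')) =
      (1 + Real.tanh lam) / 2 * ((1 + Real.tanh lam) / 2 * F 1 1 +
        (1 - Real.tanh lam) / 2 * F (-1) 1) +
      (1 - Real.tanh lam) / 2 * ((1 + Real.tanh lam) / 2 * F 1 (-1) +
        (1 - Real.tanh lam) / 2 * F (-1) (-1)) := by
  rw [isingE_average hT he' (fun s x => F (spinProd x e) s)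
    (fun x => by rw [spinProd_flip_of_ne hT he' he hne])
    (fun x => by rw [spinProd_flip_of_ne hT he' he hne]),
    isingE_edge hT he (fun s => (1 + Real.tanh lam) / 2 * F s 1 +
      (1 - Real.tanh lam) / 2 * F s (-1))]
  ring

theorem isingE_three_edges (hT : T.IsTree) {e₁ e₂ e₃ : Sym2 V} (h₁ : e₁ ∈ T.edgeSet)
    (h₂ : e₂ ∈ T.edgeSet) (h₃ : e₃ ∈ T.edgeSet) (h₁₃ : e₁ ≠ e₃) (h₂₃ : e₂ ≠ e₃)
    (F : ℝ → ℝ → ℝ → ℝ) :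
    isingE T lam (fun x => F (spinProd x e₁) (spinProd x e₂) (spinProd x e₃)) =
      (1 + Real.tanh lam) / 2 *
        isingE T lam (fun x => F (spinProd x e₁) (spinProd x e₂) 1) +
      (1 - Real.tanh lam) / 2 *
        isingE T lam (fun x => F (spinProd x e₁) (spinProd x e₂) (-1)) := by
  have hinv : ∀ s x, F (spinProd (flip T e₃ x) e₁) (spinProd (flip T e₃ x) e₂) s =
      F (spinProd x e₁) (spinProd x e₂) s := fun s x => by
    rw [spinProd_flip_of_ne hT h₃ h₁ h₁₃, spinProd_flip_of_ne hT h₃ h₂ h₂₃]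
  rw [isingE_average hT h₃ (fun s x => F (spinProd x e₁) (spinProd x e₂) s) (hinv 1) (hinv (-1)),
    isingE_add, isingE_const_mul, isingE_const_mul]

/-- Functions of disjoint pairs of edges are independent. -/
theorem isingE_mul_pair_eq (hT : T.IsTree) {e e' : Sym2 V} (he : e ∈ T.edgeSet)
    (he' : e' ∈ T.edgeSet) (hne : e ≠ e') {Q : (V → ℤˣ) → ℝ}
    (hQ : ∀ x, Q (flip T e x) = Q x) (hQ' : ∀ x, Q (flip T e' x) = Q x)
    {η : (V → ℤˣ) → ℝ} (hη : ∀ x, η (flip T e x) = η x) (hη' : ∀ x, η (flip T e' x) = η x)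
    (F : ℝ → ℝ → ℝ → ℝ) :
    isingE T lam (fun x => Q x * F (spinProd x e) (spinProd x e') (η x)) =
      isingE T lam (fun x => Q x *
        ((1 + Real.tanh lam) / 2 * ((1 + Real.tanh lam) / 2 * F 1 1 (η x) +
        (1 - Real.tanh lam) / 2 * F (-1) 1 (η x)) +
        (1 - Real.tanh lam) / 2 * ((1 + Real.tanh lam) / 2 * F 1 (-1) (η x) +
        (1 - Real.tanh lam) / 2 * F (-1) (-1) (η x)))) := by
  have hinv : ∀ s x, Q (flip T e' x) * F (spinProd (flip T e' x) e) s (η (flip T e' x)) =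
      Q x * F (spinProd x e) s (η x) := fun s x => by
    rw [spinProd_flip_of_ne hT he' he hne, hQ', hη']
  rw [isingE_average hT he' (fun s x => Q x * F (spinProd x e) s (η x)) (hinv 1) (hinv (-1)),
    isingE_average hT he (fun s x => (1 + Real.tanh lam) / 2 * (Q x * F s 1 (η x)) +
      (1 - Real.tanh lam) / 2 * (Q x * F s (-1) (η x)))
      (fun x => by rw [hQ, hη]) (fun x => by rw [hQ, hη])]
  congr 1
  funext x
  ring

/-- Two edges are integrated out while the sign `η` stays fixed. It may be correlated with `Q`,
hence the bound has to be uniform over both of its values. -/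
theorem isingE_mul_pair_le (hT : T.IsTree) {e e' : Sym2 V} (he : e ∈ T.edgeSet)
    (he' : e' ∈ T.edgeSet) (hne : e ≠ e') {Q : (V → ℤˣ) → ℝ} (hQ0 : ∀ x, 0 ≤ Q x)
    (hQ : ∀ x, Q (flip T e x) = Q x) (hQ' : ∀ x, Q (flip T e' x) = Q x)
    {η : (V → ℤˣ) → ℝ} (hη : ∀ x, η (flip T e x) = η x) (hη' : ∀ x, η (flip T e' x) = η x)
    (hη1 : ∀ x, η x = 1 ∨ η x = -1) (F : ℝ → ℝ → ℝ → ℝ) {M : ℝ}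
    (hM : ∀ s, s = 1 ∨ s = -1 →
      (1 + Real.tanh lam) / 2 * ((1 + Real.tanh lam) / 2 * F 1 1 s +
        (1 - Real.tanh lam) / 2 * F (-1) 1 s) +
        (1 - Real.tanh lam) / 2 * ((1 + Real.tanh lam) / 2 * F 1 (-1) s +
        (1 - Real.tanh lam) / 2 * F (-1) (-1) s) ≤ M) :
    isingE T lam (fun x => Q x * F (spinProd x e) (spinProd x e') (η x)) ≤
      M * isingE T lam Q := by
  rw [isingE_mul_pair_eq hT he he' hne hQ hQ' hη hη', ← isingE_const_mul]
  refine isingE_mono fun x => ?_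
  rw [mul_comm M]
  exact mul_le_mul_of_nonneg_left (hM _ (hη1 x)) (hQ0 x)

/-- The moment generating function of the total weight of a tree. -/
theorem isingE_exp_sum (hT : T.IsTree) (t : ℝ) (A : Finset (Sym2 V)) (hA : ∀ e ∈ A, e ∈ T.edgeSet) :
    isingE T lam (fun x => Real.exp (t * ∑ e ∈ A, spinProd x e)) =
      (Real.cosh t + Real.tanh lam * Real.sinh t) ^ A.card := by
  induction A using Finset.induction_on with
  | empty => simp [isingE_const]
  | insert e A heA ih =>
    have he := hA e (Finset.mem_insert_self e A)
    have hA' : ∀ e' ∈ A, e' ∈ T.edgeSet := fun e' h' => hA e' (Finset.mem_insert_of_mem h')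
    have hinv : ∀ x, ∑ e' ∈ A, spinProd (flip T e x) e' = ∑ e' ∈ A, spinProd x e' := fun x =>
      Finset.sum_congr rfl fun e' h' =>
        spinProd_flip_of_ne hT he (hA' e' h') (by rintro rfl; exact heA h') x
    have h1 := isingE_average (lam := lam) hT he (fun s x => Real.exp (t * s) * Real.exp
      (t * ∑ e' ∈ A, spinProd x e')) (fun x => by rw [hinv]) (fun x => by rw [hinv])
    have h2 : (fun x => Real.exp (t * ∑ e' ∈ insert e A, spinProd x e')) = fun x : V → ℤˣ =>
        Real.exp (t * spinProd x e) * Real.exp (t * ∑ e' ∈ A, spinProd x e') := by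
      funext x
      rw [Finset.sum_insert heA, mul_add, Real.exp_add]
    rw [h2, h1, Finset.card_insert_of_notMem heA, pow_succ, ← ih hA',
      mul_comm (isingE _ _ _), ← isingE_const_mul]
    congr 1
    funext x
    rw [Real.cosh_eq, Real.sinh_eq, mul_one, mul_neg_one]
    ring

theorem isingE_exp_graphWeight (hT : T.IsTree) (t : ℝ) :
    isingE T lam (fun x => Real.exp (t * graphWeight (spinProd x) T)) =
      (Real.cosh t + Real.tanh lam * Real.sinh t) ^ (Fintype.card V - 1) := by
  classical
  rw [← card_edgeFinset_of_isTree hT, ← isingE_exp_sum hT t T.edgeFinset (by simp)]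
  simp only [graphWeight_eq_sum]

/-- This is the moment generating function at zero coupling. In consequence all trees on the same
vertices have the same partition function. -/
theorem isingZ_eq (hT : T.IsTree) (t : ℝ) :
    isingZ T t = isingZ T 0 * Real.cosh t ^ (Fintype.card V - 1) := by
  have h := isingE_exp_graphWeight (lam := 0) hT t
  have h0 := isingZ_pos T 0
  rw [Real.tanh_zero, zero_mul, add_zero] at h
  rw [← h, isingE, Finset.mul_sum, isingZ]
  refine Finset.sum_congr rfl fun x _ => ?_
  rw [isingWeight, isingWeight, zero_mul, Real.exp_zero]
  field_simp

theorem isingZ_zero (T : SimpleGraph V) : isingZ T 0 = Fintype.card (V → ℤˣ) := by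
  simp [isingZ, isingWeight]

/-- Among all trees `T'`, the weight of the tree of the model itself has the largest moment
generating function. -/
theorem isingE_exp_graphWeight_le (hT : T.IsTree) {T' : SimpleGraph V} (hT' : T'.IsTree)
    (hlam : 0 < lam) {t : ℝ} (ht : 0 ≤ t) :
    isingE T lam (fun x => Real.exp (t * graphWeight (spinProd x) T')) ≤
      (Real.cosh t + Real.tanh lam * Real.sinh t) ^ (Fintype.card V - 1) := by
  have hsum : 0 < lam + t := by linarith
  have hc := Real.cosh_pos lam
  -- Convexity of `exp` splits the mixed weight into the weights of two Ising models of coupling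
  -- `lam + t`, whose partition functions coincide.
  have key : ∀ x : V → ℤˣ, isingWeight T lam x * Real.exp (t * graphWeight (spinProd x) T') ≤
      lam / (lam + t) * isingWeight T (lam + t) x + t / (lam + t) * isingWeight T' (lam + t) x := by
    intro x
    have hconv := convexOn_exp.2 (Set.mem_univ ((lam + t) * graphWeight (spinProd x) T))
      (Set.mem_univ ((lam + t) * graphWeight (spinProd x) T'))
      (div_nonneg hlam.le hsum.le) (div_nonneg ht hsum.le) (by field_simp)
    simp only [smul_eq_mul] at hconv
    refine le_trans (le_of_eq ?_) hconv
    rw [isingWeight, ← Real.exp_add]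
    congr 1
    field_simp
  have hZ : isingZ T' (lam + t) = isingZ T (lam + t) := by
    rw [isingZ_eq hT', isingZ_eq hT, isingZ_zero, isingZ_zero]
  have hZ' : isingZ T (lam + t) =
      isingZ T lam * (Real.cosh t + Real.tanh lam * Real.sinh t) ^ (Fintype.card V - 1) := by
    rw [isingZ_eq hT (lam + t), isingZ_eq hT lam, mul_assoc, ← mul_pow, Real.cosh_add,
      Real.tanh_eq_sinh_div_cosh]
    congr 2
    field_simp
  have hle : ∑ x : V → ℤˣ, isingWeight T lam x * Real.exp (t * graphWeight (spinProd x) T') ≤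
      isingZ T (lam + t) := by
    refine (Finset.sum_le_sum fun x _ => key x).trans (le_of_eq ?_)
    rw [Finset.sum_add_distrib, ← Finset.mul_sum, ← Finset.mul_sum]
    change lam / (lam + t) * isingZ T (lam + t) + t / (lam + t) * isingZ T' (lam + t) = _
    rw [hZ]
    field_simp
  have h0 := isingZ_pos T lam
  have hE : isingE T lam (fun x => Real.exp (t * graphWeight (spinProd x) T')) =
      (∑ x : V → ℤˣ, isingWeight T lam x * Real.exp (t * graphWeight (spinProd x) T')) /
        isingZ T lam := by
    rw [isingE, Finset.sum_div]
    exact Finset.sum_congr rfl fun x _ => by ring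
  rw [hE, div_le_iff₀ h0, mul_comm, ← hZ']
  exact hle

end IsingE

end ActiveLathe

namespace ActiveLathe

/-! ### Error exponents -/

section Exponent

variable {Ω : Type*} [MeasurableSpace Ω] {μ : Measure Ω} {A : ℕ → Set Ω} {κ C : ℝ}

theorem tendsto_const_sub_div (κ c : ℝ) :
    Tendsto (fun n : ℕ => ((κ - c / n : ℝ) : EReal)) atTop (nhds (κ : EReal)) := by
  have h : Tendsto (fun n : ℕ => κ - c / n) atTop (nhds (κ - 0)) :=
    tendsto_const_nhds.sub (tendsto_const_div_atTop_nhds_zero_nat c)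
  rw [sub_zero] at h
  exact (continuous_coe_real_ereal.tendsto κ).comp h

theorem neg_log_ofReal_div (hC : 0 < C) {n : ℕ} (hn : 1 ≤ n) :
    -ENNReal.log (ENNReal.ofReal (C * Real.exp (-(κ * n)))) / (n : EReal) =
      ((κ - Real.log C / n : ℝ) : EReal) := by
  have hn' : (n : ℝ) ≠ 0 := by positivity
  rw [ENNReal.log_ofReal_of_pos (by positivity), Real.log_mul hC.ne' (Real.exp_pos _).ne',
    Real.log_exp]
  have : (n : EReal) = ((n : ℝ) : EReal) := rfl
  rw [this, ← EReal.coe_neg, ← EReal.coe_div]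
  congr 1
  field_simp
  ring

/-- The constant only contributes log C / n, which vanishes in the limit. -/
theorem le_exponent (hC : 0 < C)
    (h : ∀ n, μ (A n) ≤ ENNReal.ofReal (C * Real.exp (-(κ * n)))) : (κ : EReal) ≤ exponent μ A := by
  rw [← (tendsto_const_sub_div κ (Real.log C)).liminf_eq]
  refine liminf_le_liminf ?_
  filter_upwards [eventually_ge_atTop 1] with n hn
  rw [← neg_log_ofReal_div hC hn]
  exact EReal.div_le_div_right_of_nonneg (by positivity)
    (EReal.neg_le_neg_iff.2 (ENNReal.log_monotone (h n)))

theorem exponent_le (hC : 0 < C)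
    (h : ∀ᶠ n : ℕ in atTop, ENNReal.ofReal (C * Real.exp (-(κ * n))) ≤ μ (A n)) :
    exponent μ A ≤ (κ : EReal) := by
  rw [← (tendsto_const_sub_div κ (Real.log C)).liminf_eq]
  refine liminf_le_liminf ?_
  filter_upwards [eventually_ge_atTop 1, h] with n hn h
  rw [← neg_log_ofReal_div hC hn]
  exact EReal.div_le_div_right_of_nonneg (by positivity)
    (EReal.neg_le_neg_iff.2 (ENNReal.log_monotone h))

end Exponent

/-! ### The Chernoff bound for a stream of samples -/

section Chernoff

instance : MeasurableSingletonClass ℤˣ :=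
  ⟨fun s => ⟨{(s : ℤ)}, trivial, by ext t; simp [Units.ext_iff]⟩⟩

variable {p : ℕ} {T : SimpleGraph (Fin p)} {lam : ℝ} {Ω : Type*} [MeasurableSpace Ω]
  {μ : Measure Ω} {X : ℕ → Ω → Fin p → ℤˣ}

theorem integral_comp_eq_isingE
    (hlaw : ∀ l, HasLaw (X l) (isingPMF T lam).toMeasure μ) (l : ℕ) (f : (Fin p → ℤˣ) → ℝ) :
    ∫ ω, f (X l ω) ∂μ = isingE T lam f := by
  have h := (hlaw l).integral_comp (f := f) (measurable_of_countable f).aestronglyMeasurable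
  rw [PMF.integral_eq_sum] at h
  refine h.trans (Finset.sum_congr rfl fun x _ => ?_)
  have h0 : 0 ≤ isingWeight T lam x / isingZ T lam :=
    div_nonneg (Real.exp_pos _).le (isingZ_pos T lam).le
  rw [isingPMF, PMF.ofFintype_apply, ENNReal.toReal_ofReal h0, smul_eq_mul]

theorem integral_prod_eq (hlaw : ∀ l, HasLaw (X l) (isingPMF T lam).toMeasure μ)
    (hindep : iIndepFun X μ) (N : ℕ) (f : ℕ → (Fin p → ℤˣ) → ℝ) :
    ∫ ω, ∏ l ∈ Finset.range N, f l (X l ω) ∂μ = ∏ l ∈ Finset.range N, isingE T lam (f l) := by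
  have h := (hindep.precomp (g := ((↑) : Fin N → ℕ)) Fin.val_injective).integral_fun_prod_comp
    (ι := Fin N) (X := fun i : Fin N => X i) (f := fun i : Fin N => f i) (fun i => (hlaw i).aemeasurable)
    (fun i => (measurable_of_countable _).aestronglyMeasurable)
  simp only [Finset.prod_range]
  rw [h]
  exact Finset.prod_congr rfl fun i _ => integral_comp_eq_isingE hlaw _ _

variable [IsProbabilityMeasure μ]

theorem integrable_prod (hlaw : ∀ l, HasLaw (X l) (isingPMF T lam).toMeasure μ)
    (N : ℕ) (f : ℕ → (Fin p → ℤˣ) → ℝ) :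
    Integrable (fun ω => ∏ l ∈ Finset.range N, f l (X l ω)) μ := by
  refine Integrable.of_bound (C := ∏ l ∈ Finset.range N, ∑ x, |f l x|) ?_ ?_
  · refine Finset.aestronglyMeasurable_fun_prod _ fun l _ => ?_
    exact ((measurable_of_countable (f l)).comp_aemeasurable
      (hlaw l).aemeasurable).aestronglyMeasurable
  · refine Filter.Eventually.of_forall fun ω => ?_
    rw [Real.norm_eq_abs, Finset.abs_prod]
    exact Finset.prod_le_prod (fun _ _ => abs_nonneg _) fun l _ =>
      Finset.single_le_sum (f := fun x => |f l x|) (fun x _ => abs_nonneg _) (Finset.mem_univ _)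

/-- The Chernoff bound. -/
theorem measure_sum_nonneg_le (hlaw : ∀ l, HasLaw (X l) (isingPMF T lam).toMeasure μ)
    (hindep : iIndepFun X μ) (N : ℕ) (ξ : ℕ → (Fin p → ℤˣ) → ℝ) :
    μ {ω | 0 ≤ ∑ l ∈ Finset.range N, ξ l (X l ω)} ≤
      ENNReal.ofReal (∏ l ∈ Finset.range N, isingE T lam (fun x => Real.exp (ξ l x))) := by
  rw [← integral_prod_eq hlaw hindep]
  have hexp : ∀ ω, ∏ l ∈ Finset.range N, Real.exp (ξ l (X l ω)) =
      Real.exp (∑ l ∈ Finset.range N, ξ l (X l ω)) := fun ω => (Real.exp_sum _ _).symm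
  rw [ofReal_integral_eq_lintegral_ofReal (integrable_prod hlaw N fun l x => Real.exp (ξ l x))
    (Filter.Eventually.of_forall fun ω => Finset.prod_nonneg fun _ _ => (Real.exp_pos _).le)]
  have hmeas : AEMeasurable (fun ω => ENNReal.ofReal (∏ l ∈ Finset.range N,
      Real.exp (ξ l (X l ω)))) μ :=
    (integrable_prod hlaw N fun l x => Real.exp (ξ l x)).aestronglyMeasurable.aemeasurable.ennreal_ofReal
  refine le_trans ?_ ((one_mul _).symm.le.trans (mul_meas_ge_le_lintegral₀ hmeas 1))
  refine measure_mono fun ω hω => ?_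
  simp only [Set.mem_ofPred_eq] at hω ⊢
  rw [hexp, ← ENNReal.ofReal_one]
  exact ENNReal.ofReal_le_ofReal (Real.one_le_exp hω)

/-- The Chernoff bound for identical increments. -/
theorem measure_sum_nonneg_le_pow (hlaw : ∀ l, HasLaw (X l) (isingPMF T lam).toMeasure μ)
    (hindep : iIndepFun X μ) (N : ℕ) (ξ : (Fin p → ℤˣ) → ℝ) {M : ℝ}
    (hM : isingE T lam (fun x => Real.exp (ξ x)) ≤ M) :
    μ {ω | 0 ≤ ∑ l ∈ Finset.range N, ξ (X l ω)} ≤ ENNReal.ofReal (M ^ N) := by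
  refine (measure_sum_nonneg_le hlaw hindep N fun _ => ξ).trans (ENNReal.ofReal_le_ofReal ?_)
  rw [Finset.prod_const, Finset.card_range]
  exact pow_le_pow_left₀ (isingE_nonneg fun _ => (Real.exp_pos _).le) hM N

/-- Exponential tilting: a lower bound for the probability that a sum is positive, in terms of a
tilt under which its increments have the positive mean `c`. -/
theorem le_measure_sum_pos (hlaw : ∀ l, HasLaw (X l) (isingPMF T lam).toMeasure μ)
    (hindep : iIndepFun X μ) (f : (Fin p → ℤˣ) → ℝ) {s c v : ℝ} (hs : 0 ≤ s) (hc : 0 < c)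
    (hmean : isingE T lam (fun x => Real.exp (s * f x) * (f x - c)) = 0)
    (hvar : isingE T lam (fun x => Real.exp (s * f x) * (f x - c) ^ 2) ≤
      v * isingE T lam (fun x => Real.exp (s * f x))) {n : ℕ} (hn : 1 ≤ n) :
    ENNReal.ofReal (Real.exp (-(2 * s * c * n)) *
      (isingE T lam (fun x => Real.exp (s * f x)) ^ n * (1 - v / (n * c ^ 2)))) ≤
      μ {ω | 0 < ∑ l ∈ Finset.range n, f (X l ω)} := by
  classical
  set φ := isingE T lam (fun x => Real.exp (s * f x)) with hφ
  have hφ0 : 0 < φ := isingE_pos fun _ => Real.exp_pos _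
  set S : Ω → ℝ := fun ω => ∑ l ∈ Finset.range n, f (X l ω) with hS
  -- The product over `j` is the `(i, k)` term of exp(sS)(S - nc)². Each term is a product of
  -- independent factors, and those with `i ≠ k` have mean zero by `hmean`; this is Chebyshev for
  -- the tilted law, without constructing that law.
  set h : ℕ → ℕ → ℕ → (Fin p → ℤˣ) → ℝ := fun i k j x => Real.exp (s * f x) *
    (if j = i then f x - c else 1) * (if j = k then f x - c else 1) with hh
  have hexp : ∀ ω, Real.exp (s * S ω) = ∏ l ∈ Finset.range n, Real.exp (s * f (X l ω)) := by
    intro ω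
    rw [← Real.exp_sum, ← Finset.mul_sum]
  have hcross : ∀ ω, ∀ i ∈ Finset.range n, ∀ k ∈ Finset.range n,
      ∏ j ∈ Finset.range n, h i k j (X j ω) =
        Real.exp (s * S ω) * ((f (X i ω) - c) * (f (X k ω) - c)) := by
    intro ω i hi k hk
    rw [hexp, Finset.prod_mul_distrib, Finset.prod_mul_distrib, Finset.prod_ite_eq' _ i,
      Finset.prod_ite_eq' _ k, if_pos hi, if_pos hk, mul_assoc]
  have hsq : ∀ ω, Real.exp (s * S ω) * (S ω - n * c) ^ 2 =
      ∑ i ∈ Finset.range n, ∑ k ∈ Finset.range n, ∏ j ∈ Finset.range n, h i k j (X j ω) := by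
    intro ω
    have h1 : S ω - n * c = ∑ i ∈ Finset.range n, (f (X i ω) - c) := by
      rw [Finset.sum_sub_distrib, Finset.sum_const, Finset.card_range, nsmul_eq_mul]
    rw [h1, sq, Finset.sum_mul_sum, Finset.mul_sum]
    refine Finset.sum_congr rfl fun i hi => ?_
    rw [Finset.mul_sum]
    exact Finset.sum_congr rfl fun k hk => (hcross ω i hi k hk).symm
  have hint1 : Integrable (fun ω => Real.exp (s * S ω)) μ := by
    simp only [hexp]
    exact integrable_prod hlaw n fun _ x => Real.exp (s * f x)
  have hint2 : Integrable (fun ω => Real.exp (s * S ω) * (S ω - n * c) ^ 2) μ := by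
    simp only [hsq]
    exact integrable_finsetSum _ fun i _ => integrable_finsetSum _ fun k _ =>
      integrable_prod hlaw n (h i k)
  have hI1 : ∫ ω, Real.exp (s * S ω) ∂μ = φ ^ n := by
    simp only [hexp]
    rw [integral_prod_eq hlaw hindep n fun _ x => Real.exp (s * f x), Finset.prod_const,
      Finset.card_range]
  have hI2 : ∫ ω, Real.exp (s * S ω) * (S ω - n * c) ^ 2 ∂μ ≤ n * (v * φ ^ n) := by
    simp only [hsq]
    rw [integral_finsetSum _ fun i _ => integrable_finsetSum _ fun k _ =>
      integrable_prod hlaw n (h i k)]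
    have hterm : ∀ i ∈ Finset.range n, ∫ ω, ∑ k ∈ Finset.range n,
        ∏ j ∈ Finset.range n, h i k j (X j ω) ∂μ ≤ v * φ ^ n := by
      intro i hi
      rw [integral_finsetSum _ fun k _ => integrable_prod hlaw n (h i k),
        Finset.sum_eq_single_of_mem i hi]
      · rw [integral_prod_eq hlaw hindep n (h i i), ← Finset.mul_prod_erase _ _ hi]
        have h1 : isingE T lam (h i i i) ≤ v * φ := by
          refine le_trans (le_of_eq ?_) hvar
          congr 1
          funext x
          simp only [hh, if_true]
          ring
        have h2 : ∏ j ∈ (Finset.range n).erase i, isingE T lam (h i i j) = φ ^ (n - 1) := by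
          rw [Finset.prod_congr rfl (g := fun _ => φ), Finset.prod_const,
            Finset.card_erase_of_mem hi, Finset.card_range]
          intro j hj
          rw [Finset.mem_erase] at hj
          simp [hh, hj.1, hφ]
        rw [h2]
        calc isingE T lam (h i i i) * φ ^ (n - 1) ≤ v * φ * φ ^ (n - 1) :=
              mul_le_mul_of_nonneg_right h1 (pow_nonneg hφ0.le _)
          _ = v * φ ^ n := by
              rw [mul_assoc, ← pow_succ', Nat.sub_add_cancel hn]
      · intro k hk hki
        rw [integral_prod_eq hlaw hindep n (h i k)]
        refine Finset.prod_eq_zero hi ?_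
        rw [← hmean]
        congr 1
        funext x
        simp [hh, hki.symm]
    refine (Finset.sum_le_sum hterm).trans (le_of_eq ?_)
    rw [Finset.sum_const, Finset.card_range, nsmul_eq_mul]
  have hn0 : (0 : ℝ) < n := by exact_mod_cast hn
  have hnc : 0 < n * c := mul_pos hn0 hc
  have hSm : AEMeasurable S μ := Finset.aemeasurable_fun_sum _ fun l _ =>
    (measurable_of_countable f).comp_aemeasurable (hlaw l).aemeasurable
  -- The factor 1 - (S - nc)²/(nc)² is positive only for 0 < S < 2nc, where exp(sS) ≤ exp(2scn), and
  -- it never exceeds 1.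
  have hpt : ∀ ω, Real.exp (-(2 * s * c * n)) * (Real.exp (s * S ω) -
      Real.exp (s * S ω) * (S ω - n * c) ^ 2 / (n * c) ^ 2) ≤
      Set.indicator {ω | 0 < S ω} (fun _ => (1 : ℝ)) ω := by
    intro ω
    have e1 : Real.exp (s * S ω) - Real.exp (s * S ω) * (S ω - n * c) ^ 2 / (n * c) ^ 2 =
        Real.exp (s * S ω) * (S ω * (2 * (n * c) - S ω) / (n * c) ^ 2) := by
      field_simp
      ring
    rw [e1]
    by_cases hpos : 0 < S ω
    · rw [Set.indicator_of_mem (by exact hpos)]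
      by_cases h2 : S ω ≤ 2 * (n * c)
      · have h3 : S ω * (2 * (n * c) - S ω) / (n * c) ^ 2 ≤ 1 := by
          rw [div_le_one (by positivity)]
          nlinarith [sq_nonneg (S ω - n * c)]
        have h4 : Real.exp (-(2 * s * c * n)) * Real.exp (s * S ω) ≤ 1 := by
          rw [← Real.exp_add, Real.exp_le_one_iff]
          nlinarith [mul_le_mul_of_nonneg_left h2 hs]
        rw [← mul_assoc]
        calc _ ≤ Real.exp (-(2 * s * c * n)) * Real.exp (s * S ω) * 1 :=
              mul_le_mul_of_nonneg_left h3 (by positivity)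
          _ ≤ 1 := by rw [mul_one]; exact h4
      · push Not at h2
        refine le_trans ?_ zero_le_one
        refine mul_nonpos_of_nonneg_of_nonpos (Real.exp_pos _).le
          (mul_nonpos_of_nonneg_of_nonpos (Real.exp_pos _).le ?_)
        exact div_nonpos_of_nonpos_of_nonneg
          (mul_nonpos_of_nonneg_of_nonpos hpos.le (by linarith)) (by positivity)
    · rw [Set.indicator_of_notMem (by exact hpos)]
      push Not at hpos
      refine mul_nonpos_of_nonneg_of_nonpos (Real.exp_pos _).le
          (mul_nonpos_of_nonneg_of_nonpos (Real.exp_pos _).le ?_)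
      exact div_nonpos_of_nonpos_of_nonneg
          (mul_nonpos_of_nonpos_of_nonneg hpos (by linarith)) (by positivity)
  have hset : NullMeasurableSet {ω | 0 < S ω} μ := nullMeasurableSet_lt aemeasurable_const hSm
  have hle : ∫ ω, Real.exp (-(2 * s * c * n)) * (Real.exp (s * S ω) -
      Real.exp (s * S ω) * (S ω - n * c) ^ 2 / (n * c) ^ 2) ∂μ ≤
      ∫ ω, Set.indicator {ω | 0 < S ω} (fun _ => (1 : ℝ)) ω ∂μ :=
    integral_mono ((hint1.sub (hint2.div_const _)).const_mul _)
      ((integrable_const _).indicator₀ hset) hpt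
  rw [integral_const_mul, integral_sub hint1 (hint2.div_const _), integral_div, hI1,
    integral_indicator₀ hset, setIntegral_const, smul_eq_mul, mul_one] at hle
  rw [← ofReal_measureReal]
  refine ENNReal.ofReal_le_ofReal (le_trans ?_ hle)
  refine mul_le_mul_of_nonneg_left ?_ (Real.exp_pos _).le
  have h1 : (∫ ω, Real.exp (s * S ω) * (S ω - n * c) ^ 2 ∂μ) / (n * c) ^ 2 ≤
      n * (v * φ ^ n) / (n * c) ^ 2 := div_le_div_of_nonneg_right hI2 (by positivity)
  have h2 : n * (v * φ ^ n) / (n * c) ^ 2 = φ ^ n * (v / (n * c ^ 2)) := by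
    field_simp
  rw [h2] at h1
  linarith

end Chernoff

end ActiveLathe

namespace ActiveLathe

/-! ### Error events of maximum-weight trees -/

section PathEdges

variable {V : Type*} {T : SimpleGraph V}

theorem exists_path_cuts (hT : T.IsTree) (u v : V) : ∃ p : T.Walk u v, p.IsPath ∧
    ∀ e ∈ p.edges, e ∈ T.edgeSet ∧ Cuts T e u v := by
  obtain ⟨p, hp⟩ := (hT.connected.preconnected u v).exists_isPath
  exact ⟨p, hp, fun e he => ⟨p.edges_subset_edgeSet he,
    cuts_of_mem_edges hT.isAcyclic p hp.isTrail.edges_nodup he⟩⟩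

/-- The path between the vertices has length at least two. The additional edge supplies the factor ρ
in `isingE_cross_le`. -/
theorem exists_cuts_ne (hT : T.IsTree) {u v : V} (huv : u ≠ v) (hadj : ¬ T.Adj u v) (e : Sym2 V) :
    ∃ e' ∈ T.edgeSet, e' ≠ e ∧ Cuts T e' u v := by
  classical
  obtain ⟨p, hp, hcut⟩ := exists_path_cuts hT u v
  have hcard : p.edges.toFinset.card = p.length := by
    rw [List.toFinset_card_of_nodup hp.isTrail.edges_nodup, p.length_edges]
  have hlen : 2 ≤ p.length := by
    by_contra hlt
    have : p.length = 0 ∨ p.length = 1 := by omega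
    rcases this with h | h
    · exact huv (SimpleGraph.Walk.eq_of_length_eq_zero h)
    · exact hadj (SimpleGraph.Walk.adj_of_length_eq_one h)
  obtain ⟨e', he'⟩ : (p.edges.toFinset.erase e).Nonempty := by
    rw [← Finset.card_pos]
    have := Finset.pred_card_le_card_erase (s := p.edges.toFinset) (a := e)
    omega
  rw [Finset.mem_erase, List.mem_toFinset] at he'
  exact ⟨e', (hcut e' he'.2).1, he'.1, (hcut e' he'.2).2⟩

/-- Two vertices are equal, adjacent, at distance two, or cut by at least three edges. -/
theorem adj_or_exists_cuts (hT : T.IsTree) {u v : V} (huv : u ≠ v) :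
    T.Adj u v ∨ (∃ j, T.Adj u j ∧ T.Adj j v) ∨ ∀ e : Sym2 V, ∃ e₁ ∈ T.edgeSet, ∃ e₂ ∈ T.edgeSet,
      e₁ ≠ e ∧ e₂ ≠ e ∧ e₁ ≠ e₂ ∧ Cuts T e₁ u v ∧ Cuts T e₂ u v := by
  classical
  obtain ⟨p, hp, hcut⟩ := exists_path_cuts hT u v
  have hcard : p.edges.toFinset.card = p.length := by
    rw [List.toFinset_card_of_nodup hp.isTrail.edges_nodup, p.length_edges]
  by_cases hlen : 3 ≤ p.length
  · refine Or.inr (Or.inr fun e => ?_)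
    obtain ⟨e₁, h₁, e₂, h₂, hne⟩ : ∃ e₁ ∈ p.edges.toFinset.erase e,
        ∃ e₂ ∈ p.edges.toFinset.erase e, e₁ ≠ e₂ := by
      apply Finset.one_lt_card.1
      have := Finset.pred_card_le_card_erase (s := p.edges.toFinset) (a := e)
      omega
    rw [Finset.mem_erase, List.mem_toFinset] at h₁ h₂
    exact ⟨e₁, (hcut e₁ h₁.2).1, e₂, (hcut e₂ h₂.2).1, h₁.1, h₂.1, hne, (hcut e₁ h₁.2).2,
      (hcut e₂ h₂.2).2⟩
  · cases p with
    | nil => exact absurd rfl huv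
    | cons h q =>
      cases q with
      | nil => exact Or.inl h
      | cons h' q' =>
        cases q' with
        | nil => exact Or.inr (Or.inl ⟨_, h, h'⟩)
        | cons h'' q'' => simp at hlen

theorem cuts_path_left (hT : T.IsAcyclic) {i j k : V} (hij : T.Adj i j) (hjk : T.Adj j k)
    (hik : i ≠ k) : Cuts T s(i, j) i k := by
  intro h
  have hne : s(j, k) ≠ s(i, j) := by
    simp [hik.symm, hij.ne']
  exact cuts_of_adj hT hij (h.trans (reachable_deleteEdges_of_adj hjk hne).symm)

theorem cuts_path_right (hT : T.IsAcyclic) {i j k : V} (hij : T.Adj i j) (hjk : T.Adj j k)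
    (hik : i ≠ k) : Cuts T s(j, k) i k := by
  have := (cuts_path_left hT hjk.symm hij.symm hik.symm).symm
  rwa [Sym2.eq_swap] at this

end PathEdges

/-! ### The moment generating function of a crossover -/

section Cross

variable {V : Type*} [Fintype V] [DecidableEq V] {T : SimpleGraph V} {lam : ℝ}

theorem cosh_sub_tanh_mul_sinh (a b : ℝ) :
    Real.cosh a - Real.tanh b * Real.sinh a = Real.cosh (a - b) / Real.cosh b := by
  have := Real.cosh_pos b
  rw [Real.cosh_sub, Real.tanh_eq_sinh_div_cosh]
  field_simp

theorem inv_cosh_eq_sqrt (lam : ℝ) :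
    1 / Real.cosh lam = Real.sqrt (1 - Real.tanh lam ^ 2) := by
  have h := Real.cosh_pos lam
  rw [eq_comm, Real.sqrt_eq_iff_mul_self_eq (by
    rw [Real.tanh_eq_sinh_div_cosh, div_pow, sub_nonneg, div_le_one (by positivity)]
    nlinarith [Real.cosh_sq lam]) (by positivity), Real.tanh_eq_sinh_div_cosh]
  field_simp
  nlinarith [Real.cosh_sq lam]

theorem pos_of_tanh_pos {lam : ℝ} (h : 0 < Real.tanh lam) : 0 < lam := by
  rw [Real.tanh_eq_sinh_div_cosh] at h
  exact Real.sinh_pos_iff.1 (by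
    have := mul_pos h (Real.cosh_pos lam)
    rwa [div_mul_cancel₀ _ (Real.cosh_pos lam).ne'] at this)

/-- The weighted average of `exp (-lam)` and `exp lam`. -/
theorem average_exp_neg (lam : ℝ) : (1 + Real.tanh lam) / 2 * Real.exp (-lam) +
    (1 - Real.tanh lam) / 2 * Real.exp lam = 1 / Real.cosh lam := by
  have := cosh_sub_tanh_mul_sinh lam lam
  rw [sub_self, Real.cosh_zero] at this
  rw [← this, Real.cosh_eq, Real.sinh_eq]
  ring

theorem isingE_le_one {g : (V → ℤˣ) → ℝ} (h : ∀ x, g x ≤ 1) : isingE T lam g ≤ 1 := by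
  have := isingE_mono (T := T) (lam := lam) h
  rwa [isingE_const] at this

/-- With s_uv = s_e z, the sign z is invariant under the flip at `e`, hence independent of s_e. The
exponent is 0 if z = 1 and -λ s_e if z = -1, and exp(-λ s_e) has mean 1 / cosh λ; the event z = -1
has probability (1 - E z) / 2. -/
theorem isingE_exp_cross (hT : T.IsTree) {e : Sym2 V} (he : e ∈ T.edgeSet) {u v : V}
    (hcut : Cuts T e u v) :
    isingE T lam (fun x => Real.exp (lam / 2 * (spinProd x s(u, v) - spinProd x e))) =
      1 - (1 - isingE T lam (fun x => spinProd x s(u, v) * spinProd x e)) / 2 *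
        (1 - 1 / Real.cosh lam) := by
  set z : (V → ℤˣ) → ℝ := fun x => spinProd x s(u, v) * spinProd x e with hz
  have hzf : ∀ x, z (flip T e x) = z x := fun x => by
    simp only [hz, spinProd_flip_self hT he, spinProd_flip_of_cuts hT he hcut]
    ring
  have hz1 : ∀ x, z x = 1 ∨ z x = -1 := fun x => by
    rcases spinProd_eq_one_or x s(u, v) with h | h <;>
      rcases spinProd_eq_one_or x e with h' | h' <;> simp [hz, h, h']
  have h1 : (fun x => Real.exp (lam / 2 * (spinProd x s(u, v) - spinProd x e))) =
      fun x => Real.exp (lam / 2 * (spinProd x e * z x - spinProd x e)) := by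
    funext x
    congr 3
    simp only [hz]
    linear_combination (-spinProd x s(u, v)) * spinProd_mul_self x e
  rw [h1, isingE_average hT he (fun s x => Real.exp (lam / 2 * (s * z x - s)))
    (fun x => by rw [hzf]) (fun x => by rw [hzf])]
  have h2 : (fun x => (1 + Real.tanh lam) / 2 * Real.exp (lam / 2 * (1 * z x - 1)) +
      (1 - Real.tanh lam) / 2 * Real.exp (lam / 2 * (-1 * z x - -1))) =
      fun x => (1 + 1 / Real.cosh lam) / 2 + (1 - 1 / Real.cosh lam) / 2 * z x := by
    funext x
    rw [← average_exp_neg]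
    rcases hz1 x with h | h
    · rw [h]; norm_num; ring
    · rw [h]
      have e1 : lam / 2 * (1 * -1 - 1) = -lam := by ring
      have e2 : lam / 2 * (-1 * -1 - -1) = lam := by ring
      rw [e1, e2]
      ring
  rw [h2, isingE_add, isingE_const, isingE_const_mul]
  ring

/-- The edge `e₁` splits off as an independent factor of mean tanh λ; the remaining sign has mean at
most 1. -/
theorem isingE_cross_le (hT : T.IsTree) (hlam : 0 ≤ Real.tanh lam) {e e₁ : Sym2 V}
    (he : e ∈ T.edgeSet) (he₁ : e₁ ∈ T.edgeSet) (hne : e₁ ≠ e) {u v : V} (hcut : Cuts T e₁ u v) :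
    isingE T lam (fun x => spinProd x s(u, v) * spinProd x e) ≤ Real.tanh lam := by
  have h1 : (fun x => spinProd x s(u, v) * spinProd x e) =
      fun x => spinProd x e₁ * (spinProd x e₁ * (spinProd x s(u, v) * spinProd x e)) := by
    funext x
    linear_combination (-spinProd x s(u, v) * spinProd x e) * spinProd_mul_self x e₁
  rw [h1, isingE_spinProd_mul hT he₁ (fun x => by
    rw [spinProd_flip_self hT he₁, spinProd_flip_of_cuts hT he₁ hcut,
      spinProd_flip_of_ne hT he₁ he hne.symm]
    ring)]
  refine mul_le_of_le_one_right hlam (isingE_le_one fun x => ?_)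
  rcases spinProd_eq_one_or x s(u, v) with h | h <;>
    rcases spinProd_eq_one_or x e with h' | h' <;>
      rcases spinProd_eq_one_or x e₁ with h'' | h'' <;> norm_num [h, h', h'']

theorem isingE_cross_le_sq (hT : T.IsTree) {e e₁ e₂ : Sym2 V}
    (he : e ∈ T.edgeSet) (he₁ : e₁ ∈ T.edgeSet) (he₂ : e₂ ∈ T.edgeSet) (hne₁ : e₁ ≠ e)
    (hne₂ : e₂ ≠ e) (hne : e₁ ≠ e₂) {u v : V} (hcut₁ : Cuts T e₁ u v) (hcut₂ : Cuts T e₂ u v) :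
    isingE T lam (fun x => spinProd x s(u, v) * spinProd x e) ≤ Real.tanh lam ^ 2 := by
  have h1 : (fun x => spinProd x s(u, v) * spinProd x e) =
      fun x => spinProd x e₁ * (spinProd x e₂ *
        (spinProd x e₂ * spinProd x e₁ * (spinProd x s(u, v) * spinProd x e))) := by
    funext x
    linear_combination (-spinProd x s(u, v) * spinProd x e) * spinProd_mul_self x e₁ -
      (spinProd x s(u, v) * spinProd x e * spinProd x e₁ * spinProd x e₁) *
        spinProd_mul_self x e₂
  rw [h1, isingE_spinProd_mul hT he₁ (fun x => by
    rw [spinProd_flip_self hT he₁, spinProd_flip_of_cuts hT he₁ hcut₁,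
      spinProd_flip_of_ne hT he₁ he hne₁.symm, spinProd_flip_of_ne hT he₁ he₂ hne.symm]
    ring), isingE_spinProd_mul hT he₂ (fun x => by
    rw [spinProd_flip_self hT he₂, spinProd_flip_of_cuts hT he₂ hcut₂,
      spinProd_flip_of_ne hT he₂ he hne₂.symm, spinProd_flip_of_ne hT he₂ he₁ hne]
    ring), ← mul_assoc, ← sq]
  refine mul_le_of_le_one_right (sq_nonneg _) (isingE_le_one fun x => ?_)
  rcases spinProd_eq_one_or x s(u, v) with h | h <;>
    rcases spinProd_eq_one_or x e with h' | h' <;>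
      rcases spinProd_eq_one_or x e₁ with h'' | h'' <;>
        rcases spinProd_eq_one_or x e₂ with h''' | h''' <;> norm_num [h, h', h'', h''']

end Cross

/-! ### The passive rate as a function of ρ -/

section Rate

/-- One minus the optimal moment generating function of a crossover at distance two. -/
noncomputable def crossRate (ρ : ℝ) : ℝ := (1 - ρ) / 2 * (1 - Real.sqrt (1 - ρ ^ 2))

theorem kPassive_eq (ρ : ℝ) : kPassive ρ = -Real.log (1 - crossRate ρ) := rfl

variable {ρ : ℝ}

theorem sqrt_nonneg_lt_one (h0 : 0 < ρ) : 0 ≤ Real.sqrt (1 - ρ ^ 2) ∧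
    Real.sqrt (1 - ρ ^ 2) < 1 := by
  refine ⟨Real.sqrt_nonneg _, ?_⟩
  rw [Real.sqrt_lt' one_pos]
  nlinarith

theorem crossRate_pos (h0 : 0 < ρ) (h1 : ρ < 1) : 0 < crossRate ρ := by
  have := sqrt_nonneg_lt_one h0
  unfold crossRate
  apply mul_pos <;> linarith

theorem crossRate_lt_half (h0 : 0 < ρ) : crossRate ρ < 1 / 2 := by
  have := sqrt_nonneg_lt_one h0
  unfold crossRate
  nlinarith

theorem kPassive_pos (h0 : 0 < ρ) (h1 : ρ < 1) : 0 < kPassive ρ := by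
  have h2 := crossRate_pos h0 h1
  have h3 := crossRate_lt_half h0
  rw [kPassive_eq, neg_pos]
  exact Real.log_neg (by linarith) (by linarith)

theorem exp_neg_kPassive (h0 : 0 < ρ) (h1 : ρ < 1) : Real.exp (-kPassive ρ) = 1 - crossRate ρ := by
  have h3 := crossRate_lt_half h0
  rw [kPassive_eq, neg_neg, Real.exp_log (by linarith)]

end Rate

/-! ### The passive exponent -/

section Events

theorem sum_spinProd {V : Type*} (x : ℕ → V → ℤˣ) (m : ℕ) (e : Sym2 V) :
    ∑ l ∈ Finset.range m, spinProd (x l) e = m * empCorr x m e := by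
  rcases Nat.eq_zero_or_pos m with rfl | hm
  · simp
  · have : (m : ℝ) ≠ 0 := by positivity
    unfold empCorr
    field_simp

theorem measure_le_card_mul {Ω ι : Type*} [MeasurableSpace Ω] {μ : Measure Ω} [Fintype ι]
    {A : Set Ω} {cond : ι → Prop} {B : ι → Set Ω} {c : ℝ} (hA : ∀ ω ∈ A, ∃ i, cond i ∧ ω ∈ B i)
    (hB : ∀ i, cond i → μ (B i) ≤ ENNReal.ofReal c) :
    μ A ≤ ENNReal.ofReal (Fintype.card ι * c) := by
  have h1 : μ A ≤ μ (⋃ i, {ω | cond i ∧ ω ∈ B i}) := by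
    refine measure_mono fun ω hω => ?_
    obtain ⟨i, hi⟩ := hA ω hω
    exact Set.mem_iUnion.2 ⟨i, hi⟩
  refine h1.trans ((measure_iUnion_fintype_le μ _).trans ?_)
  have h2 : ∀ i, μ {ω | cond i ∧ ω ∈ B i} ≤ ENNReal.ofReal c := by
    intro i
    by_cases hi : cond i
    · exact (measure_mono fun ω hω => hω.2).trans (hB i hi)
    · have : {ω | cond i ∧ ω ∈ B i} = ∅ := by
        ext ω
        simp [hi]
      rw [this, measure_empty]
      exact zero_le
  refine (Finset.sum_le_sum fun i _ => h2 i).trans (le_of_eq ?_)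
  rw [Finset.sum_const, Finset.card_univ, nsmul_eq_mul, ENNReal.ofReal_mul (by positivity),
    ENNReal.ofReal_natCast]

variable {p : ℕ} {T : SimpleGraph (Fin p)} {lam : ℝ} {Ω : Type*} [MeasurableSpace Ω]
  {μ : Measure Ω} [IsProbabilityMeasure μ] {X : ℕ → Ω → Fin p → ℤˣ}

/-- A crossover of a non-edge with an edge. -/
theorem measure_cross_le (hT : T.IsTree) (hlam : 0 < Real.tanh lam)
    (hlaw : ∀ l, HasLaw (X l) (isingPMF T lam).toMeasure μ) (hindep : iIndepFun X μ)
    {u v a b : Fin p} (huv : u ≠ v) (hadj : ¬ T.Adj u v) (hab : T.Adj a b)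
    (hcut : Cuts T s(a, b) u v) (N : ℕ) :
    μ {ω | empCorr (fun l => X l ω) N s(a, b) ≤ empCorr (fun l => X l ω) N s(u, v)} ≤
      ENNReal.ofReal ((1 - crossRate (Real.tanh lam)) ^ N) := by
  obtain ⟨e₁, he₁, hne₁, hcut₁⟩ := exists_cuts_ne hT huv hadj s(a, b)
  refine le_trans (measure_mono fun ω hω => ?_) (measure_sum_nonneg_le_pow hlaw hindep N
    (fun x => lam / 2 * (spinProd x s(u, v) - spinProd x s(a, b))) ?_)
  · have hl := pos_of_tanh_pos hlam
    simp only [Set.mem_ofPred_eq] at hω ⊢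
    rw [← Finset.mul_sum, Finset.sum_sub_distrib, sum_spinProd (fun l => X l ω),
      sum_spinProd (fun l => X l ω), ← mul_sub]
    have := sub_nonneg.2 hω
    positivity
  · rw [isingE_exp_cross hT hab hcut, inv_cosh_eq_sqrt, crossRate]
    have h1 := isingE_cross_le (lam := lam) hT hlam.le hab he₁ hne₁ hcut₁
    have h2 := sqrt_nonneg_lt_one hlam
    nlinarith

/-- Union bound over the quadruples of a non-edge and an edge of `T` that cuts it; their number does
not depend on `n`. -/
theorem passive_le (hT : T.IsTree) {ρ : ℝ} (hlam : ρ = Real.tanh lam) (h0 : 0 < ρ) (h1 : ρ < 1)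
    (hlaw : ∀ l, HasLaw (X l) (isingPMF T lam).toMeasure μ) (hindep : iIndepFun X μ)
    (R : MaxTreeRule (Fin p)) : ((kPassive ρ : ℝ) : EReal) ≤ passiveExponent μ X R T := by
  subst hlam
  have hp : Nonempty (Fin p) := hT.connected.nonempty
  refine le_exponent (C := Fintype.card (Fin p × Fin p × Fin p × Fin p))
    (by exact_mod_cast Fintype.card_pos) fun n => ?_
  have hexp : Real.exp (-(kPassive (Real.tanh lam) * n)) =
      (1 - crossRate (Real.tanh lam)) ^ n := by
    rw [← exp_neg_kPassive h0 h1, ← Real.exp_nat_mul]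
    ring_nf
  rw [hexp]
  refine measure_le_card_mul
    (cond := fun i => i.1 ≠ i.2.1 ∧ ¬ T.Adj i.1 i.2.1 ∧ T.Adj i.2.2.1 i.2.2.2 ∧
      Cuts T s(i.2.2.1, i.2.2.2) i.1 i.2.1)
    (B := fun i => {ω | empCorr (fun l => X l ω) n s(i.2.2.1, i.2.2.2) ≤
      empCorr (fun l => X l ω) n s(i.1, i.2.1)}) ?_ ?_
  · intro ω hω
    by_contra! hno
    refine hω (sclTree_eq_of_separated hT R _ n fun u v huv hadj a b hab hcut => ?_)
    have := hno (u, v, a, b) ⟨huv, hadj, hab, hcut⟩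
    simpa using this
  · rintro ⟨u, v, a, b⟩ ⟨huv, hadj, hab, hcut⟩
    exact measure_cross_le hT h0 hlaw hindep huv hadj hab hcut n

/-- The increment of a crossover of `ik` with `jk` vanishes unless the pivot `ij` has spin product
-1. -/
theorem spinProd_path (x : Fin p → ℤˣ) (i j k : Fin p) :
    spinProd x s(i, k) - spinProd x s(j, k) = spinProd x s(j, k) * (spinProd x s(i, j) - 1) := by
  rw [← spinProd_mul_spinProd x i j k]
  ring

/-- Tilting the crossover of a path slightly beyond the optimal tilt. -/
theorem passiveExponent_le_add (hT : T.IsTree) (h0 : 0 < Real.tanh lam) (h1 : Real.tanh lam < 1)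
    (hlaw : ∀ l, HasLaw (X l) (isingPMF T lam).toMeasure μ) (hindep : iIndepFun X μ)
    (R : MaxTreeRule (Fin p)) {i j k : Fin p} (hij : T.Adj i j) (hjk : T.Adj j k) (hik : i ≠ k)
    {u : ℝ} (hu : 0 < u) :
    passiveExponent μ X R T ≤
      ((kPassive (Real.tanh lam) + (u + lam) * (2 * Real.sinh u) : ℝ) : EReal) := by
  have hl := pos_of_tanh_pos h0
  have hcosh := Real.cosh_pos lam
  have hcosh1 := Real.one_le_cosh lam
  have hsinh : 0 < Real.sinh u := Real.sinh_pos_iff.2 hu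
  set ρ := Real.tanh lam with hρ
  -- At the optimal tilt `lam / 2` the increment has tilted mean zero; `u > 0` makes this mean
  -- positive.
  set s : ℝ := (u + lam) / 2 with hs
  have hne : s(i, j) ≠ s(j, k) := by
    simp [hik, hij.ne]
  set f : (Fin p → ℤˣ) → ℝ := fun x => spinProd x s(i, k) - spinProd x s(j, k) with hf
  have hφ : isingE T lam (fun x => Real.exp (s * f x)) =
      (1 + ρ) / 2 + (1 - ρ) / 2 * (Real.cosh u / Real.cosh lam) := by
    have h := isingE_edge_edge (lam := lam) hT (e := s(i, j)) (e' := s(j, k)) hij hjk hne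
      (fun a b => Real.exp (s * (b * (a - 1))))
    simp only [hf, spinProd_path]
    rw [h]
    have e1 := cosh_sub_tanh_mul_sinh (2 * s) lam
    rw [show 2 * s - lam = u by rw [hs]; ring, Real.cosh_eq, Real.sinh_eq] at e1
    rw [← e1, ← hρ]
    norm_num
    rw [show s * 2 = 2 * s by ring]
    ring
  have hnum : isingE T lam (fun x => Real.exp (s * f x) * f x) =
      (1 - ρ) * (Real.sinh u / Real.cosh lam) := by
    have h := isingE_edge_edge (lam := lam) hT (e := s(i, j)) (e' := s(j, k)) hij hjk hne
      (fun a b => Real.exp (s * (b * (a - 1))) * (b * (a - 1)))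
    simp only [hf, spinProd_path]
    rw [h]
    have e1 : Real.sinh (2 * s) - ρ * Real.cosh (2 * s) = Real.sinh u / Real.cosh lam := by
      rw [show u = 2 * s - lam by rw [hs]; ring, Real.sinh_sub, hρ, Real.tanh_eq_sinh_div_cosh]
      field_simp
    rw [Real.cosh_eq, Real.sinh_eq] at e1
    rw [← e1, ← hρ]
    norm_num
    rw [show s * 2 = 2 * s by ring]
    ring
  set φ := isingE T lam (fun x => Real.exp (s * f x)) with hφdef
  have hr := sqrt_nonneg_lt_one h0
  have hφ1 : 1 - crossRate ρ ≤ φ := by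
    have e2 : Real.sqrt (1 - ρ ^ 2) ≤ Real.cosh u / Real.cosh lam := by
      rw [← inv_cosh_eq_sqrt]
      exact div_le_div_of_nonneg_right (Real.one_le_cosh u) hcosh.le
    rw [hφ, crossRate]
    nlinarith
  have hy := crossRate_lt_half h0
  have hφ0 : 1 / 2 < φ := by linarith
  set c : ℝ := (1 - ρ) * (Real.sinh u / Real.cosh lam) / φ with hc
  have hc0 : 0 < c := by
    have : 0 < 1 - ρ := by linarith
    positivity
  have hc1 : c ≤ 2 * Real.sinh u := by
    have e3 : Real.sinh u / Real.cosh lam ≤ Real.sinh u := div_le_self hsinh.le hcosh1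
    have e4 : 0 < Real.sinh u / Real.cosh lam := by positivity
    rw [hc, div_le_iff₀ (by linarith)]
    nlinarith
  have hmean : isingE T lam (fun x => Real.exp (s * f x) * (f x - c)) = 0 := by
    have : (fun x => Real.exp (s * f x) * (f x - c)) =
        fun x => Real.exp (s * f x) * f x + (-c) * Real.exp (s * f x) := by
      funext x
      ring
    rw [this, isingE_add, isingE_const_mul, hnum, ← hφdef, hc]
    field_simp
    ring
  have hvar : isingE T lam (fun x => Real.exp (s * f x) * (f x - c) ^ 2) ≤
      (2 + c) ^ 2 * isingE T lam (fun x => Real.exp (s * f x)) := by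
    rw [← isingE_const_mul]
    refine isingE_mono fun x => ?_
    rw [mul_comm]
    refine mul_le_mul_of_nonneg_right ?_ (Real.exp_pos _).le
    have hfx : -2 ≤ f x ∧ f x ≤ 2 := by
      simp only [hf]
      rcases spinProd_eq_one_or x s(i, k) with h | h <;>
        rcases spinProd_eq_one_or x s(j, k) with h' | h' <;> rw [h, h'] <;> norm_num
    apply sq_le_sq' <;> linarith [hfx.1, hfx.2]
  -- For large `n` the Chebyshev correction removes at most half of the tilted mass.
  refine exponent_le (C := 1 / 2) (by norm_num) ?_
  have hbig : ∀ᶠ n : ℕ in atTop, 2 * (2 + c) ^ 2 / c ^ 2 ≤ (n : ℝ) :=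
    tendsto_natCast_atTop_atTop.eventually_ge_atTop _
  filter_upwards [eventually_ge_atTop 1, hbig] with n hn hbign
  have hn0 : (0 : ℝ) < n := by exact_mod_cast hn
  refine le_trans ?_ ((le_measure_sum_pos hlaw hindep f (s := s) (c := c) (by positivity) hc0
    hmean hvar hn).trans (measure_mono fun ω hω heq => ?_))
  · refine ENNReal.ofReal_le_ofReal ?_
    have e5 : 1 / 2 ≤ 1 - (2 + c) ^ 2 / (n * c ^ 2) := by
      have : (2 + c) ^ 2 / (n * c ^ 2) ≤ 1 / 2 := by
        rw [div_le_iff₀ (by positivity)] at hbign ⊢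
        linarith
      linarith
    have e6 : Real.exp (-(kPassive ρ * n)) ≤ φ ^ n := by
      have : Real.exp (-(kPassive ρ * n)) = (1 - crossRate ρ) ^ n := by
        rw [← exp_neg_kPassive h0 h1, ← Real.exp_nat_mul]
        ring_nf
      rw [this]
      exact pow_le_pow_left₀ (by linarith) hφ1 n
    have e7 : Real.exp (-((u + lam) * (2 * Real.sinh u) * n)) ≤ Real.exp (-(2 * s * c * n)) := by
      rw [Real.exp_le_exp, hs]
      have := mul_le_mul_of_nonneg_right (mul_le_mul_of_nonneg_left hc1
        (show 0 ≤ u + lam by linarith)) hn0.le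
      linarith
    calc 1 / 2 * Real.exp (-((kPassive ρ + (u + lam) * (2 * Real.sinh u)) * n))
        = Real.exp (-((u + lam) * (2 * Real.sinh u) * n)) *
            (Real.exp (-(kPassive ρ * n)) * (1 / 2)) := by
          rw [add_mul, neg_add, Real.exp_add]
          ring
      _ ≤ _ := by gcongr
  -- A strict crossover contradicts the maximality of `T`, whatever the tie-breaking rule.
  · have := hT.connected.nonempty
    have hle := sclTree_le_of_cuts R (fun l => X l ω) n (c := j) (d := k) (a := i) (b := k)
      (by rw [heq]; exact hjk) (by rw [heq]; exact cuts_path_right hT.isAcyclic hij hjk hik)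
    simp only [hf, Set.mem_ofPred_eq] at hω
    rw [Finset.sum_sub_distrib, sum_spinProd (fun l => X l ω),
      sum_spinProd (fun l => X l ω), ← mul_sub] at hω
    nlinarith

theorem passiveExponent_eq (hT : T.IsTree) {ρ : ℝ} (hlam : ρ = Real.tanh lam) (h0 : 0 < ρ)
    (h1 : ρ < 1) (hlaw : ∀ l, HasLaw (X l) (isingPMF T lam).toMeasure μ) (hindep : iIndepFun X μ)
    (R : MaxTreeRule (Fin p)) {i j k : Fin p} (hij : T.Adj i j) (hjk : T.Adj j k) (hik : i ≠ k) :
    passiveExponent μ X R T = ((kPassive ρ : ℝ) : EReal) := by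
  refine le_antisymm ?_ (passive_le hT hlam h0 h1 hlaw hindep R)
  subst hlam
  have hcont : Continuous fun u : ℝ =>
      ((kPassive (Real.tanh lam) + (u + lam) * (2 * Real.sinh u) : ℝ) : EReal) :=
    continuous_coe_real_ereal.comp (by fun_prop)
  have hlim : Tendsto (fun u : ℝ =>
      ((kPassive (Real.tanh lam) + (u + lam) * (2 * Real.sinh u) : ℝ) : EReal))
      (nhdsWithin 0 (Set.Ioi 0)) (nhds ((kPassive (Real.tanh lam) : ℝ) : EReal)) := by
    have := (hcont.tendsto 0).mono_left (nhdsWithin_le_nhds (s := Set.Ioi 0))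
    simpa using this
  refine ge_of_tendsto hlim ?_
  filter_upwards [self_mem_nhdsWithin] with u hu
  exact passiveExponent_le_add hT h0 h1 hlaw hindep R hij hjk hik hu

end Events

end ActiveLathe

namespace ActiveLathe

/-! ### The structure of the error events of the active algorithm -/

section Regular

variable {V : Type*} {T : SimpleGraph V} {w : Sym2 V → ℝ} {f : ℝ}

/-- `i - j - k` is a path of `T` along which the pair `ik` is at least as heavy as the edge `jk`. -/
def Arc (T : SimpleGraph V) (w : Sym2 V → ℝ) (i j k : V) : Prop :=
  T.Adj i j ∧ T.Adj j k ∧ i ≠ k ∧ w s(j, k) ≤ w s(i, k)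

/-- Weights for which the errors of the maximum-weight tree can be detected locally. -/
structure Regular (T : SimpleGraph V) (w : Sym2 V → ℝ) (f : ℝ) : Prop where
  long : ∀ ⦃u v : V⦄, u ≠ v → ¬ T.Adj u v → (¬ ∃ j, T.Adj u j ∧ T.Adj j v) → Separated T w u v
  pos : ∀ ⦃i j : V⦄, T.Adj i j → 0 < w s(i, j)
  conf : ∀ ⦃i j k : V⦄, T.Adj i j → T.Adj j k → i ≠ k → f * w s(i, k) < w s(j, k)
  arcs : ∀ ⦃i j k i' j' k' : V⦄, Arc T w i j k → Arc T w i' j' k' →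
    s(i, j) = s(i', j') ∨ (s(i, j) = s(j', k') ∧ s(j, k) = s(i', j'))

/-- The pairs of edges `ab`, `bc` and `a'b'`, `b'c'` are disjoint. -/
def EdgeDisjoint (a b c a' b' c' : V) : Prop :=
  s(a, b) ≠ s(a', b') ∧ s(a, b) ≠ s(b', c') ∧ s(b, c) ≠ s(a', b') ∧ s(b, c) ≠ s(b', c')

/-- Each vertex of a path of length two has a neighbour on either of its edges, in particular on the
shared one. -/
theorem adj_of_not_edgeDisjoint {a b c a' b' c' v : V} (hab : T.Adj a b) (hbc : T.Adj b c)
    (h : ¬ EdgeDisjoint a b c a' b' c') (hv : v = a ∨ v = b ∨ v = c) :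
    T.Adj a' v ∨ T.Adj b' v ∨ T.Adj c' v := by
  have h1 := hab.symm
  have h2 := hbc.symm
  simp only [EdgeDisjoint, not_and_or, not_not, Sym2.eq_iff, ne_eq] at h
  rcases hv with rfl | rfl | rfl <;>
    rcases h with (⟨rfl, rfl⟩ | ⟨rfl, rfl⟩) | (⟨rfl, rfl⟩ | ⟨rfl, rfl⟩) | (⟨rfl, rfl⟩ | ⟨rfl, rfl⟩) |
      (⟨rfl, rfl⟩ | ⟨rfl, rfl⟩) <;> tauto

variable [Fintype V] {H : SimpleGraph V}

/-- The `T`-path from `u` to `v` has an edge across the cut of `H` at `uv`. By maximality this edge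
is not heavier than `uv`, which `long` forbids at distance at least three. -/
theorem Regular.adj_or (hreg : Regular T w f) (hT : T.IsTree) (hH : IsMaxTreeOn Set.univ w H)
    {u v : V} (huv : H.Adj u v) : T.Adj u v ∨ ∃ j, T.Adj u j ∧ T.Adj j v := by
  by_contra! hno
  obtain ⟨p, -, hcut⟩ := exists_path_cuts hT u v
  obtain ⟨a, b, hab, hmem, hcut'⟩ := (cuts_of_adj hH.1.isAcyclic huv).exists_mem_walk p
  have h1 := hH.le_of_cuts huv (Set.mem_univ a) (Set.mem_univ b) hcut'
  have h2 := hreg.long huv.ne hno.1 (by rintro ⟨j, h, h'⟩; exact hno.2 j h h') hab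
    (hcut _ hmem).2
  linarith

/-- If `j` is on the side of `u` in `H` without `uv`, then `uv` also cuts `jv`, which gives the arc.
That the pivot `uj` survives in `H` is what makes the wrong edge visible: `j - u - v` is then a path
of `H`. -/
theorem Regular.adj_and_arc_of_reachable (hreg : Regular T w f) (hT : T.IsTree)
    (hH : IsMaxTreeOn Set.univ w H) {u j v : V} (huv : H.Adj u v) (huj : T.Adj u j)
    (hjv : T.Adj j v) (hr : (H.deleteEdges {s(u, v)}).Reachable u j) :
    H.Adj j u ∧ Arc T w u j v := by
  have hcut : Cuts H s(u, v) j v := fun h => cuts_of_adj hH.1.isAcyclic huv (hr.trans h)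
  have harc : Arc T w u j v :=
    ⟨huj, hjv, huv.ne, hH.le_of_cuts huv (Set.mem_univ _) (Set.mem_univ _) hcut⟩
  refine ⟨?_, harc⟩
  obtain ⟨q, hq⟩ := hr.symm.exists_isPath
  obtain ⟨a, b, hab, hmem, hcutT⟩ := (cuts_of_adj hT.isAcyclic huj.symm).exists_mem_walk q
  have habH : H.Adj a b := SimpleGraph.deleteEdges_le _ hab
  have hne : s(a, b) ≠ s(u, v) := by
    rw [SimpleGraph.deleteEdges_adj] at hab
    exact hab.2
  have hcutH : Cuts H s(a, b) j u := by
    have hp := (SimpleGraph.Walk.isPath_mapLe (SimpleGraph.deleteEdges_le {s(u, v)})).2 hq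
    refine cuts_of_mem_edges hH.1.isAcyclic _ hp.isTrail.edges_nodup ?_
    rw [SimpleGraph.Walk.edges_mapLe_eq_edges]
    exact hmem
  have hle := hH.le_of_cuts habH (Set.mem_univ _) (Set.mem_univ _) hcutH
  rcases hreg.adj_or hT hH habH with hT' | ⟨c, hac, hcb⟩
  · have := hcutT.eq_of_adj hT'
    rwa [← SimpleGraph.mem_edgeSet, ← this]
  · exfalso
    -- The wrong edge `ab` shortcuts a path of `T` through `uj`, and yields an arc that overtakes
    -- `uj`, with the other edge as pivot. Compatibility with the arc `u - j - v` forces it to be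
    -- the reversed arc, so `ab = uv`, which the walk `q` avoids.
    have hor : s(a, c) = s(j, u) ∨ s(c, b) = s(j, u) := by
      by_contra! hno
      exact hcutT ((reachable_deleteEdges_of_adj hac hno.1).trans
        (reachable_deleteEdges_of_adj hcb hno.2))
    have hab' := habH.ne
    have huv' := huv.ne
    have huj' := huj.ne
    have hjv' := hjv.ne
    rcases hor with h | h
    · have harc' : Arc T w b c a := by
        refine ⟨hcb.symm, hac.symm, habH.ne', ?_⟩
        rw [Sym2.eq_swap, h, Sym2.eq_swap (a := b)]
        exact hle
      have := hreg.arcs harc' harc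
      simp only [Sym2.eq_iff, ne_eq] at this h hne
      grind
    · have harc' : Arc T w a c b := by
        refine ⟨hac, hcb, habH.ne, ?_⟩
        rw [h]
        exact hle
      have := hreg.arcs harc' harc
      simp only [Sym2.eq_iff, ne_eq] at this h hne
      grind

theorem Regular.adj_and_arc (hreg : Regular T w f) (hT : T.IsTree)
    (hH : IsMaxTreeOn Set.univ w H) {u j v : V} (huv : H.Adj u v) (huj : T.Adj u j)
    (hjv : T.Adj j v) : (H.Adj j u ∧ Arc T w u j v) ∨ (H.Adj j v ∧ Arc T w v j u) := by
  rcases reachable_deleteEdges_or (a := u) (b := v)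
    (hH.1.reachable (Set.mem_univ u) (Set.mem_univ j))
    (Or.inl (SimpleGraph.Reachable.refl _)) with h | h
  · exact Or.inl (hreg.adj_and_arc_of_reachable hT hH huv huj hjv h)
  · refine Or.inr (hreg.adj_and_arc_of_reachable hT hH huv.symm hjv.symm huj.symm ?_)
    rwa [Sym2.eq_swap]

end Regular

/-! ### Detection of the errors, and the number of unconfident nodes -/

section Unconfident

variable {V : Type*} [Fintype V] {T : SimpleGraph V} {R : MaxTreeRule V} {x : ℕ → V → ℤˣ} {m : ℕ}

theorem isMaxTreeOn_sclTree [Nonempty V] (R : MaxTreeRule V) (x : ℕ → V → ℤˣ) (m : ℕ) :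
    IsMaxTreeOn Set.univ (empCorr x m) (sclTree R x m) :=
  R.isMax _ _ Set.univ_nonempty

theorem UnconfidentTriple.adj_left {i j k : V} (h : UnconfidentTriple R x m i j k) :
    (unconfidentGraph R x m).Adj i j := by
  rw [unconfidentGraph, SimpleGraph.fromRel_adj]
  exact ⟨h.2.1.ne, Or.inl ⟨k, Or.inl h⟩⟩

theorem UnconfidentTriple.adj_right {i j k : V} (h : UnconfidentTriple R x m i j k) :
    (unconfidentGraph R x m).Adj j k := by
  rw [unconfidentGraph, SimpleGraph.fromRel_adj]
  exact ⟨h.2.2.1.ne, Or.inl ⟨i, Or.inr h⟩⟩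

theorem UnconfidentTriple.symm {i j k : V} (h : UnconfidentTriple R x m i j k) :
    UnconfidentTriple R x m k j i := by
  refine ⟨h.1.symm, h.2.2.1.symm, h.2.1.symm, fun hc => h.2.2.2 ?_⟩
  rw [Confident, Sym2.eq_swap (a := k) (b := i), Sym2.eq_swap (a := k) (b := j),
    Sym2.eq_swap (a := j) (b := i)] at hc
  exact ⟨hc.2, hc.1⟩

theorem exists_unconfidentTriple {a b : V} (h : (unconfidentGraph R x m).Adj a b) :
    ∃ i j k, UnconfidentTriple R x m i j k ∧ (a = i ∨ a = j ∨ a = k) ∧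
      (sclTree R x m).Adj a b := by
  rw [unconfidentGraph, SimpleGraph.fromRel_adj] at h
  rcases h with ⟨-, ⟨c, h | h⟩ | ⟨c, h | h⟩⟩
  · exact ⟨_, _, _, h, Or.inl rfl, h.2.1⟩
  · exact ⟨_, _, _, h, Or.inr (Or.inl rfl), h.2.2.1⟩
  · exact ⟨_, _, _, h, Or.inr (Or.inl rfl), h.2.1.symm⟩
  · exact ⟨_, _, _, h, Or.inr (Or.inr rfl), h.2.2.1.symm⟩

/-- The factor of the confident event. -/
noncomputable def confFactor (R : MaxTreeRule V) (x : ℕ → V → ℤˣ) (m : ℕ) : ℝ :=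
  (11 + 9 * rhoHat R x m) / 20

/-- The path `j - u - v` or `j - v - u` of the learned tree fails the test: its outer pair is an
edge of `T`, and `conf` keeps that edge too heavy. Both edges of the failing path enter the graph
`U`, so the midpoint is in the component of the wrong edge. -/
theorem Regular.unconfident (hreg : Regular T (empCorr x m) (confFactor R x m)) (hT : T.IsTree)
    {u j v : V} (huv : (sclTree R x m).Adj u v) (huj : T.Adj u j) (hjv : T.Adj j v) :
    (unconfidentGraph R x m).Adj u v ∧ (unconfidentGraph R x m).Reachable u j := by
  have := hT.connected.nonempty
  have key : ∀ ⦃u v : V⦄, (sclTree R x m).Adj u v → T.Adj u j → T.Adj j v →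
      (sclTree R x m).Adj j u → UnconfidentTriple R x m j u v := by
    intro u v huv huj hjv hju
    refine ⟨hjv.ne, hju, huv, fun hc => ?_⟩
    have h1 := hreg.conf huj hjv huv.ne
    have h2 := hc.2
    rw [confFactor] at h1
    linarith
  rcases hreg.adj_and_arc hT (isMaxTreeOn_sclTree R x m) huv huj hjv with ⟨h, -⟩ | ⟨h, -⟩
  · have h3 := key huv huj hjv h
    exact ⟨h3.adj_right, h3.adj_left.symm.reachable⟩
  · have h3 := key huv.symm hjv.symm huj.symm h
    exact ⟨h3.adj_right.symm, h3.adj_right.symm.reachable.trans h3.adj_left.symm.reachable⟩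

/-- Separation is needed only if there are unconfident nodes: otherwise every component is a single
vertex and there is nothing to relearn. -/
theorem activeTree_eq {n : ℕ} (hT : T.IsTree)
    (hreg : Regular T (empCorr x (globalCount R x n)) (confFactor R x (globalCount R x n)))
    (hsep : unconfidentCount R x (globalCount R x n) ≠ 0 → ∀ u v, u ≠ v → ¬ T.Adj u v →
      Separated T (empCorr x (globalCount R x n + localCount R x n)) u v) :
    activeTree R x n = T := by
  have := hT.connected.nonempty
  have hH := isMaxTreeOn_sclTree R x (globalCount R x n)
  refine repair_eq hT.isAcyclic (isTree_sclTree R x (globalCount R x n)).connected ?_ ?_ R ?_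
  · intro a b hab hU
    rcases hreg.adj_or hT hH hab with h | ⟨j, h1, h2⟩
    · exact h
    · exact absurd (hreg.unconfident hT hab h1 h2).1 hU
  · intro a b hab
    obtain ⟨-, -, -, -, -, habH⟩ := exists_unconfidentTriple hab
    rcases hreg.adj_or hT hH habH with h | ⟨j, h1, h2⟩
    · exact Or.inl h
    · exact Or.inr ⟨j, h1, h2, (hreg.unconfident hT habH h1 h2).2⟩
  · intro u v hr huv hadj
    refine hsep (fun h0 => huv ?_) u v huv hadj
    rw [unconfidentCount, Set.ncard_eq_zero (Set.toFinite _)] at h0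
    obtain ⟨p⟩ := hr
    cases p with
    | nil => rfl
    | cons h q =>
      have : u ∈ (unconfidentGraph R x (globalCount R x n)).support := ⟨_, h⟩
      rw [h0] at this
      exact absurd this (Set.notMem_empty u)

/-- A path `a - b - c` of `T`, possibly prolonged by the edge `e₀ = cd`, along which a confident
event with factor `f` fails. -/
def WeakPath (T : SimpleGraph V) (w : Sym2 V → ℝ) (f : ℝ) (e₀ : Sym2 V) (a b c d : V) : Prop :=
  T.Adj a b ∧ T.Adj b c ∧ a ≠ c ∧ (d = c ∨ s(c, d) = e₀) ∧
    (f * w s(a, b) < w s(a, d) ∨ f * w s(b, c) < w s(a, d))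

/-- The unconfident nodes are neighbours of one path of `T`, or lie on weak paths. -/
theorem Regular.exists_weakPath (hreg : Regular T (empCorr x m) (confFactor R x m))
    (hf : 0 ≤ confFactor R x m) (hT : T.IsTree) {i₁ j₁ k₁ : V} (hij₁ : T.Adj i₁ j₁)
    (hjk₁ : T.Adj j₁ k₁) (hik₁ : i₁ ≠ k₁) :
    ∃ i₀ j₀ k₀, T.Adj i₀ j₀ ∧ T.Adj j₀ k₀ ∧ i₀ ≠ k₀ ∧
      ∀ v ∈ (unconfidentGraph R x m).support, (T.Adj i₀ v ∨ T.Adj j₀ v ∨ T.Adj k₀ v) ∨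
        ∃ a b c d, WeakPath T (empCorr x m) (confFactor R x m) s(i₀, j₀) a b c d ∧
          (v = a ∨ v = b ∨ v = c) := by
  have := hT.connected.nonempty
  have hH := isMaxTreeOn_sclTree R x m
  set w := empCorr x m with hw
  set f := confFactor R x m with hfdef
  -- By `arcs`, one arc determines all others up to its pivot. If there is no arc, an arbitrary path
  -- takes its place.
  obtain ⟨i₀, j₀, k₀, hij₀, hjk₀, hik₀, hwrong⟩ : ∃ i₀ j₀ k₀, T.Adj i₀ j₀ ∧ T.Adj j₀ k₀ ∧
      i₀ ≠ k₀ ∧ ∀ i j k, Arc T w i j k →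
        s(i, j) = s(i₀, j₀) ∨ (s(i, j) = s(j₀, k₀) ∧ s(j, k) = s(i₀, j₀)) := by
    by_cases h : ∃ i j k, Arc T w i j k
    · obtain ⟨i₀, j₀, k₀, h₀⟩ := h
      exact ⟨i₀, j₀, k₀, h₀.1, h₀.2.1, h₀.2.2.1, fun i j k h => hreg.arcs h h₀⟩
    · push Not at h
      exact ⟨i₁, j₁, k₁, hij₁, hjk₁, hik₁, fun i j k h' => absurd h' (h i j k)⟩
  refine ⟨i₀, j₀, k₀, hij₀, hjk₀, hik₀, ?_⟩
  have hmid : ∀ ⦃u j v : V⦄, (sclTree R x m).Adj u v → T.Adj u j → T.Adj j v →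
      s(u, j) = s(i₀, j₀) ∨ s(j, v) = s(i₀, j₀) := by
    intro u j v huv huj hjv
    rcases hreg.adj_and_arc hT hH huv huj hjv with ⟨-, h⟩ | ⟨-, h⟩
    · exact (hwrong _ _ _ h).imp_right And.right
    · rw [Sym2.eq_swap (a := u), Sym2.eq_swap (a := j) (b := v)]
      exact (hwrong _ _ _ h).symm.imp_left And.right
  have hends : ∀ ⦃u v : V⦄, (sclTree R x m).Adj u v → ¬ T.Adj u v →
      (T.Adj i₀ u ∨ T.Adj j₀ u) ∧ (T.Adj i₀ v ∨ T.Adj j₀ v) := by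
    intro u v huv hn
    obtain ⟨j, huj, hjv⟩ := (hreg.adj_or hT hH huv).resolve_left hn
    have := huj.symm
    have := hjv.symm
    have := hij₀.symm
    rcases hmid huv huj hjv with h | h <;> rcases Sym2.eq_iff.1 h with ⟨rfl, rfl⟩ | ⟨rfl, rfl⟩ <;>
      tauto
  -- Unless `j` is on the special path, the wrong edge `jk` shortcuts `j - l - k` with `lk` the
  -- pivot, so `jk` is at least as heavy as `jl`. The failed test on `i - j - k` thus becomes one on
  -- `i - j - l`, prolonged by the pivot.
  have key : ∀ ⦃i j k : V⦄, UnconfidentTriple R x m i j k → T.Adj i j → ¬ T.Adj j k →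
      (T.Adj i₀ i ∨ T.Adj j₀ i ∨ T.Adj k₀ i) ∨ ∃ a b c d,
        WeakPath T w f s(i₀, j₀) a b c d ∧ i = a := by
    intro i j k htr hij hjk
    by_cases hj : j = i₀ ∨ j = j₀ ∨ j = k₀
    · left
      rcases hj with rfl | rfl | rfl
      · exact Or.inl hij.symm
      · exact Or.inr (Or.inl hij.symm)
      · exact Or.inr (Or.inr hij.symm)
    · push Not at hj
      right
      obtain ⟨l, hjl, hlk⟩ := (hreg.adj_or hT hH htr.2.2.1).resolve_left hjk
      have hlk₀ : s(l, k) = s(i₀, j₀) := by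
        rcases hmid htr.2.2.1 hjl hlk with h | h
        · rcases Sym2.eq_iff.1 h with ⟨h, -⟩ | ⟨h, -⟩
          · exact absurd h hj.1
          · exact absurd h hj.2.1
        · exact h
      rcases hreg.adj_and_arc hT hH htr.2.2.1 hjl hlk with ⟨-, h⟩ | ⟨hlk', h⟩
      · exfalso
        rcases hwrong _ _ _ h with h | ⟨h, -⟩ <;> rcases Sym2.eq_iff.1 h with ⟨h, -⟩ | ⟨h, -⟩
        · exact hj.1 h
        · exact hj.2.1 h
        · exact hj.2.1 h
        · exact hj.2.2 h
      -- Otherwise `i`, `j`, `k` would form a triangle in the learned tree.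
      · have hil : i ≠ l := by
          rintro rfl
          refine cuts_of_adj hH.1.isAcyclic htr.2.2.1 (SimpleGraph.Reachable.trans
            (reachable_deleteEdges_of_adj (v := i) htr.2.1.symm ?_)
            (reachable_deleteEdges_of_adj hlk' ?_))
          · simp [htr.1, hjl.ne']
          · simp [hjl.ne', htr.1]
        refine ⟨i, j, l, k, ⟨hij, hjl, hil, Or.inr hlk₀, ?_⟩, rfl⟩
        have hnc := htr.2.2.2
        rw [Confident, not_and_or, not_le, not_le] at hnc
        rcases hnc with hnc | hnc
        · left
          rw [mul_comm]
          exact hnc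
        · right
          refine lt_of_le_of_lt ?_ hnc
          rw [mul_comm]
          refine mul_le_mul_of_nonneg_right ?_ hf
          have := h.2.2.2
          rw [Sym2.eq_swap, Sym2.eq_swap (a := k)] at this
          exact this
  rintro v ⟨y, hvy⟩
  obtain ⟨i, j, k, htr, hv, -⟩ := exists_unconfidentTriple hvy
  by_cases hij : T.Adj i j <;> by_cases hjk : T.Adj j k
  · right
    refine ⟨i, j, k, k, ⟨hij, hjk, htr.1, Or.inl rfl, ?_⟩, hv⟩
    have hnc := htr.2.2.2
    rw [Confident, not_and_or, not_le, not_le] at hnc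
    rw [mul_comm f, mul_comm f]
    exact hnc
  · rcases hv with rfl | rfl | rfl
    · rcases key htr hij hjk with h | ⟨a, b, c, d, h, h'⟩
      · exact Or.inl h
      · exact Or.inr ⟨a, b, c, d, h, Or.inl h'⟩
    · have := hends htr.2.2.1 hjk
      tauto
    · have := hends htr.2.2.1 hjk
      tauto
  · rcases hv with rfl | rfl | rfl
    · have := hends htr.2.1 hij
      tauto
    · have := hends htr.2.1 hij
      tauto
    · rcases key htr.symm hjk.symm (fun h => hij h.symm) with h | ⟨a, b, c, d, h, h'⟩
      · exact Or.inl h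
      · exact Or.inr ⟨a, b, c, d, h, Or.inl h'⟩
  · have h1 := hends htr.2.1 hij
    have h2 := hends htr.2.2.1 hjk
    rcases hv with rfl | rfl | rfl <;> tauto

theorem card_neighbors_le [DecidableEq V] [DecidableRel T.Adj] (a b c : V) :
    (T.neighborFinset a ∪ T.neighborFinset b ∪ T.neighborFinset c).card ≤ 3 * T.maxDegree := by
  have h : ∀ v, (T.neighborFinset v).card ≤ T.maxDegree := fun v => by
    rw [SimpleGraph.card_neighborFinset_eq_degree]
    exact T.degree_le_maxDegree v
  have h1 := Finset.card_union_le (T.neighborFinset a ∪ T.neighborFinset b) (T.neighborFinset c)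
  have h2 := Finset.card_union_le (T.neighborFinset a) (T.neighborFinset b)
  have := h a
  have := h b
  have := h c
  omega

/-- If there are many unconfident nodes, then there are many disjoint weak paths. -/
theorem Regular.exists_disjoint_weakPaths [DecidableRel T.Adj]
    (hreg : Regular T (empCorr x m) (confFactor R x m))
    (hf : 0 ≤ confFactor R x m) (hT : T.IsTree) {i₁ j₁ k₁ : V} (hij₁ : T.Adj i₁ j₁)
    (hjk₁ : T.Adj j₁ k₁) (hik₁ : i₁ ≠ k₁) {r : ℕ}
    (hcount : 3 * T.maxDegree * (r + 1) < unconfidentCount R x m) :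
    ∃ e₀ ∈ T.edgeSet, ∃ q : Fin r → V × V × V × V,
      (∀ s, WeakPath T (empCorr x m) (confFactor R x m) e₀ (q s).1 (q s).2.1 (q s).2.2.1
          (q s).2.2.2 ∧ s((q s).1, (q s).2.1) ≠ e₀ ∧ s((q s).2.1, (q s).2.2.1) ≠ e₀ ∧
          EdgeDisjoint (q s).1 (q s).2.1 (q s).2.2.1 i₁ j₁ k₁) ∧
      ∀ s s', s ≠ s' → EdgeDisjoint (q s).1 (q s).2.1 (q s).2.2.1
        (q s').1 (q s').2.1 (q s').2.2.1 := by
  classical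
  obtain ⟨i₀, j₀, k₀, hij₀, hjk₀, hik₀, hcov⟩ := hreg.exists_weakPath hf hT hij₁ hjk₁ hik₁
  set w := empCorr x m with hw
  set f := confFactor R x m with hfdef
  refine ⟨s(i₀, j₀), hij₀, ?_⟩
  let ok : V × V × V × V → Prop := fun q => WeakPath T w f s(i₀, j₀) q.1 q.2.1 q.2.2.1 q.2.2.2 ∧
    EdgeDisjoint q.1 q.2.1 q.2.2.1 i₀ j₀ k₀ ∧ EdgeDisjoint q.1 q.2.1 q.2.2.1 i₁ j₁ k₁
  let good : Finset (V × V × V × V) → Prop := fun M => (∀ q ∈ M, ok q) ∧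
    ∀ q ∈ M, ∀ q' ∈ M, q ≠ q' → EdgeDisjoint q.1 q.2.1 q.2.2.1 q'.1 q'.2.1 q'.2.2.1
  -- In a maximal disjoint family, an unconfident node not adjacent to any selected or special path
  -- would lie on a weak path that could be added.
  obtain ⟨M, hM, hmax⟩ := Finset.exists_max_image
    (Finset.univ.filter fun M : Finset (V × V × V × V) => good M) Finset.card
    ⟨∅, by simp [good]⟩
  rw [Finset.mem_filter] at hM
  let nb : V → V → V → Finset V := fun a b c =>
    T.neighborFinset a ∪ T.neighborFinset b ∪ T.neighborFinset c
  have hnb : ∀ a b c v, v ∈ nb a b c ↔ T.Adj a v ∨ T.Adj b v ∨ T.Adj c v := by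
    intro a b c v
    simp [nb]
  have hsub : (unconfidentGraph R x m).support ⊆
      ((nb i₀ j₀ k₀ ∪ nb i₁ j₁ k₁ ∪ M.biUnion fun q => nb q.1 q.2.1 q.2.2.1 : Finset V) : Set V) := by
    intro v hv
    rw [Finset.mem_coe, Finset.mem_union, Finset.mem_union, Finset.mem_biUnion, hnb, hnb]
    rcases hcov v hv with h | ⟨a, b, c, d, hweak, hv⟩
    · exact Or.inl (Or.inl h)
    by_cases h0 : EdgeDisjoint a b c i₀ j₀ k₀
    · by_cases h1 : EdgeDisjoint a b c i₁ j₁ k₁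
      · right
        by_contra! hno
        have hdis : ∀ q ∈ M, EdgeDisjoint a b c q.1 q.2.1 q.2.2.1 := by
          intro q hq
          by_contra hd
          exact hno q hq ((hnb _ _ _ _).2 (adj_of_not_edgeDisjoint hweak.1 hweak.2.1 hd hv))
        have hnot : (a, b, c, d) ∉ M := fun hq => (hdis _ hq).1 rfl
        have hgood : good (insert (a, b, c, d) M) := by
          refine ⟨?_, ?_⟩
          · intro q hq
            rcases Finset.mem_insert.1 hq with rfl | hq
            · exact ⟨hweak, h0, h1⟩
            · exact hM.2.1 q hq
          · intro q hq q' hq' hne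
            rcases Finset.mem_insert.1 hq with rfl | hq <;>
              rcases Finset.mem_insert.1 hq' with rfl | hq'
            · exact absurd rfl hne
            · exact hdis q' hq'
            · obtain ⟨d1, d2, d3, d4⟩ := hdis q hq
              exact ⟨d1.symm, d3.symm, d2.symm, d4.symm⟩
            · exact hM.2.2 q hq q' hq' hne
        have := hmax _ (Finset.mem_filter.2 ⟨Finset.mem_univ _, hgood⟩)
        rw [Finset.card_insert_of_notMem hnot] at this
        omega
      · exact Or.inl (Or.inr (adj_of_not_edgeDisjoint hweak.1 hweak.2.1 h1 hv))
    · exact Or.inl (Or.inl (adj_of_not_edgeDisjoint hweak.1 hweak.2.1 h0 hv))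
  -- At most `r - 1` selected paths and the two special ones have at most (r + 1)·3d neighbours in
  -- all.
  have hcard : r ≤ M.card := by
    have h1 : unconfidentCount R x m ≤ (nb i₀ j₀ k₀ ∪ nb i₁ j₁ k₁ ∪
        M.biUnion fun q => nb q.1 q.2.1 q.2.2.1).card := by
      rw [unconfidentCount, ← Set.ncard_coe_finset]
      exact Set.ncard_le_ncard hsub (Set.toFinite _)
    have h2 := Finset.card_union_le (nb i₀ j₀ k₀ ∪ nb i₁ j₁ k₁)
      (M.biUnion fun q => nb q.1 q.2.1 q.2.2.1)
    have h3 := Finset.card_union_le (nb i₀ j₀ k₀) (nb i₁ j₁ k₁)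
    have h4 : (nb i₀ j₀ k₀).card ≤ 3 * T.maxDegree := card_neighbors_le i₀ j₀ k₀
    have h5 : (nb i₁ j₁ k₁).card ≤ 3 * T.maxDegree := card_neighbors_le i₁ j₁ k₁
    have h6 : (M.biUnion fun q => nb q.1 q.2.1 q.2.2.1).card ≤ M.card * (3 * T.maxDegree) :=
      Finset.card_biUnion_le_card_mul _ _ _ fun q _ => card_neighbors_le _ _ _
    by_contra! hlt
    have h7 : M.card * (3 * T.maxDegree) + 3 * T.maxDegree ≤ r * (3 * T.maxDegree) := by
      have := Nat.mul_le_mul_right (3 * T.maxDegree) (Nat.succ_le_of_lt hlt)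
      rw [Nat.succ_mul] at this
      exact this
    nlinarith
  obtain ⟨M', hM', hcard'⟩ := Finset.exists_subset_card_eq hcard
  let q : Fin r → V × V × V × V := fun s => (M'.equivFinOfCardEq hcard').symm s
  have hq : ∀ s, q s ∈ M := fun s => hM' ((M'.equivFinOfCardEq hcard').symm s).2
  refine ⟨q, fun s => ?_, fun s s' hne => hM.2.2 _ (hq s) _ (hq s') fun h => hne ?_⟩
  · obtain ⟨h1, h2, h3⟩ := hM.2.1 _ (hq s)
    exact ⟨h1, h2.1, h2.2.2.1, h3⟩
  · exact (M'.equivFinOfCardEq hcard').symm.injective (Subtype.ext h)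

end Unconfident

end ActiveLathe

namespace ActiveLathe

/-! ### Elementary estimates -/

section Elementary

theorem exp_le_cubic {x : ℝ} (h0 : 0 ≤ x) (h1 : x ≤ 1) :
    Real.exp x ≤ 1 + x + x ^ 2 / 2 + 2 / 9 * x ^ 3 := by
  have h := Real.exp_bound' h0 h1 (n := 3) (by norm_num)
  norm_num [Finset.sum_range_succ, Nat.factorial] at h
  linarith

theorem cosh_le_quartic {x : ℝ} (h0 : 0 ≤ x) (h1 : x ≤ 4 / 5) :
    Real.cosh x ≤ 1 + x ^ 2 / 2 + x ^ 4 / 7 := by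
  have hx : x ^ 2 ≤ 16 / 25 := by nlinarith
  have h := (Real.cosh_le_exp_half_sq x).trans
    (exp_le_cubic (x := x ^ 2 / 2) (by positivity) (by linarith))
  have h4 : 0 ≤ x ^ 4 := by positivity
  nlinarith

theorem cubic_le_sinh {x : ℝ} (h0 : 0 ≤ x) : x + x ^ 3 / 6 ≤ Real.sinh x := by
  have h := sum_le_hasSum (Finset.range 2) (fun i _ => by positivity) (Real.hasSum_sinh x)
  norm_num [Finset.sum_range_succ, Nat.factorial] at h
  exact h

/-- Truncation of the series of artanh, whose terms are nonnegative. -/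
theorem series_le_of_tanh {lam ρ : ℝ} (hlam : ρ = Real.tanh lam) (h0 : 0 < ρ) (h1 : ρ < 1) :
    ρ + ρ ^ 3 / 3 + ρ ^ 5 / 5 + ρ ^ 7 / 7 ≤ lam := by
  have h := sum_le_hasSum (Finset.range 4) (fun i _ => by positivity)
    (Real.hasSum_log_sub_log_of_abs_lt_one (x := ρ) (by rw [abs_of_pos h0]; exact h1))
  have h2 := Real.artanh_eq_half_log (x := ρ) ⟨by linarith, h1.le⟩
  rw [hlam, Real.artanh_tanh, ← hlam, Real.log_div (by linarith) (by linarith)] at h2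
  rw [h2]
  norm_num [Finset.sum_range_succ] at h
  linarith

theorem two_fifths_le_log : 2 / 5 ≤ Real.log (3 / 2) := by
  rw [Real.le_log_iff_exp_le (by norm_num)]
  refine (exp_le_cubic (by norm_num) (by norm_num)).trans (by norm_num)

theorem log_three_halves_le : Real.log (3 / 2) ≤ 1 / 2 := by
  have := Real.log_le_sub_one_of_pos (x := 3 / 2) (by norm_num)
  linarith

/-- `cosh θ - tanh lam * sinh θ` decreases up to `lam`. -/
theorem quadratic_le_of_le {lam ρ θ θ' : ℝ} (hlam : ρ = Real.tanh lam) (hρ : 0 ≤ ρ) (h0 : 0 ≤ θ')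
    (h1 : θ' ≤ 1 / 5) (h2 : θ' ≤ θ) (h3 : θ ≤ lam) :
    ρ * θ' - 51 / 100 * θ' ^ 2 ≤ 1 - (Real.cosh θ - ρ * Real.sinh θ) := by
  have e1 : Real.cosh θ - ρ * Real.sinh θ ≤ Real.cosh θ' - ρ * Real.sinh θ' := by
    rw [hlam, cosh_sub_tanh_mul_sinh, cosh_sub_tanh_mul_sinh]
    refine div_le_div_of_nonneg_right ?_ (Real.cosh_pos lam).le
    rw [Real.cosh_le_cosh, abs_of_nonpos (by linarith), abs_of_nonpos (by linarith)]
    linarith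
  have e2 := cosh_le_quartic h0 (by linarith)
  have e3 := mul_le_mul_of_nonneg_left (Real.self_le_sinh_iff.2 h0) hρ
  have e4 : θ' ^ 4 ≤ θ' ^ 2 / 25 := by
    have : θ' ^ 2 ≤ 1 / 25 := by nlinarith
    nlinarith [sq_nonneg θ']
  nlinarith [sq_nonneg θ']

/-- The factor of the exponent that is guaranteed for the error events of the global phase. -/
noncomputable def globalGain (ρ : ℝ) : ℝ := if ρ < 4 / 5 then 1 + 15 / 16 * ρ else 7 / 4

/-- A lower bound for one minus the factor of the confident event. -/
noncomputable def confGap (ρ : ℝ) : ℝ := (9 / 20 - 3 / 40 * ρ) * (1 - ρ)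

variable {lam ρ : ℝ}

theorem one_le_globalGain (h0 : 0 < ρ) : 1 ≤ globalGain ρ := by
  unfold globalGain
  split_ifs <;> linarith

theorem globalGain_le (h0 : 0 < ρ) : globalGain ρ ≤ 1 + ρ := by
  unfold globalGain
  split_ifs <;> linarith

/-- The left side is minimal at `lam`; a shift by log σ multiplies the minimum by cosh(log σ). -/
theorem cosh_sub_mul_sinh_add_log (hlam : ρ = Real.tanh lam) {σ : ℝ} (hσ : 0 < σ) :
    Real.cosh (lam + Real.log σ) - ρ * Real.sinh (lam + Real.log σ) =
      (σ + σ⁻¹) / 2 * Real.sqrt (1 - ρ ^ 2) := by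
  rw [hlam, cosh_sub_tanh_mul_sinh, ← inv_cosh_eq_sqrt, add_sub_cancel_left, Real.cosh_eq,
    Real.exp_neg, Real.exp_log hσ]
  ring

/-- The moment generating function of the failure of a confident event on a path of `T`. -/
noncomputable def confMgf (ρ t : ℝ) : ℝ :=
  (1 + ρ) / 2 * (Real.cosh (t * confGap ρ) - ρ * Real.sinh (t * confGap ρ)) +
    (1 - ρ) / 2 * (Real.cosh (t * (2 - confGap ρ)) - ρ * Real.sinh (t * (2 - confGap ρ)))

theorem confGap_pos (h0 : 0 < ρ) (h1 : ρ < 1) : 0 < confGap ρ := by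
  unfold confGap
  apply mul_pos <;> linarith

theorem confGap_lt_half (h0 : 0 < ρ) (h1 : ρ < 1) : confGap ρ < 1 / 2 := by
  unfold confGap
  nlinarith

theorem le_of_tanh_eq (hlam : ρ = Real.tanh lam) (h0 : 0 < ρ) (h1 : ρ < 1) : ρ ≤ lam := by
  have := series_le_of_tanh hlam h0 h1
  have : 0 < ρ ^ 3 / 3 + ρ ^ 5 / 5 + ρ ^ 7 / 7 := by positivity
  linarith

/-- A tilt for which the second term of the moment generating function is explicit. -/
theorem exists_confMgf_le (hlam : ρ = Real.tanh lam) (h0 : 0 < ρ) (h1 : ρ < 1) {σ θ : ℝ}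
    (hσ : 0 < σ) (hb : 0 ≤ lam + Real.log σ) (hθ0 : 0 ≤ θ) (hθ1 : θ ≤ 1 / 5)
    (hθ2 : θ * (2 - confGap ρ) ≤ (lam + Real.log σ) * confGap ρ)
    (hθ3 : (lam + Real.log σ) * confGap ρ ≤ lam * (2 - confGap ρ))
    (hfin : globalGain ρ * ((1 - ρ) * (1 - Real.sqrt (1 - ρ ^ 2))) ≤
      (1 + ρ) * (ρ * θ - 51 / 100 * θ ^ 2) +
        (1 - ρ) * (1 - (σ + σ⁻¹) / 2 * Real.sqrt (1 - ρ ^ 2))) :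
    ∃ t, 0 ≤ t ∧ confMgf ρ t ≤ 1 - globalGain ρ * crossRate ρ := by
  have h2u : 0 < 2 - confGap ρ := by linarith [confGap_lt_half h0 h1]
  refine ⟨(lam + Real.log σ) / (2 - confGap ρ), by positivity, ?_⟩
  rw [confMgf, div_mul_cancel₀ _ h2u.ne', cosh_sub_mul_sinh_add_log hlam hσ]
  have := quadratic_le_of_le (θ := (lam + Real.log σ) / (2 - confGap ρ) * confGap ρ) hlam h0.le
    hθ0 hθ1 (by rw [div_mul_eq_mul_div, le_div_iff₀ h2u]; exact hθ2)
    (by rw [div_mul_eq_mul_div, div_le_iff₀ h2u]; exact hθ3)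
  have h3 := mul_le_mul_of_nonneg_left this (show 0 ≤ 1 + ρ by linarith)
  rw [crossRate]
  linarith

/-- The choice `σ = 1` minimises the second term. The value of `θ` comes from `lam ≥ ρ` and a linear
lower bound for the remaining factor of `confGap ρ / (2 - confGap ρ)`. -/
theorem exists_confMgf_le_of_lt (hlam : ρ = Real.tanh lam) (h0 : 0 < ρ) (h1 : ρ < 3 / 5) :
    ∃ t, 0 ≤ t ∧ confMgf ρ t ≤ 1 - globalGain ρ * crossRate ρ := by
  have hl1 := le_of_tanh_eq hlam h0 (by linarith)
  have hu0 := confGap_pos h0 (by linarith)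
  have hu1 := confGap_lt_half h0 (by linarith)
  have hr3 : 1 - 14 / 25 * ρ ^ 2 ≤ Real.sqrt (1 - ρ ^ 2) := by
    refine Real.le_sqrt_of_sq_le ?_
    have : ρ ^ 2 ≤ 9 / 25 := by nlinarith
    nlinarith [sq_nonneg ρ]
  have hq : 0 ≤ ρ * (1 - ρ) := mul_nonneg h0.le (by linarith)
  refine exists_confMgf_le hlam h0 (by linarith) (σ := 1)
    (θ := ρ * (1 - ρ) * (57 / 200 - 23 / 200 * ρ)) one_pos
    (by rw [Real.log_one]; linarith) (mul_nonneg hq (by linarith)) (by nlinarith) ?_ ?_ ?_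
  · rw [Real.log_one, add_zero]
    have key : (57 / 200 - 23 / 200 * ρ) * (2 - confGap ρ) ≤ 9 / 20 - 3 / 40 * ρ := by
      unfold confGap
      nlinarith [sq_nonneg (ρ - 13 / 50), mul_nonneg h0.le (sq_nonneg (ρ - 3 / 10))]
    calc ρ * (1 - ρ) * (57 / 200 - 23 / 200 * ρ) * (2 - confGap ρ)
        = ρ * (1 - ρ) * ((57 / 200 - 23 / 200 * ρ) * (2 - confGap ρ)) := by ring
      _ ≤ ρ * (1 - ρ) * (9 / 20 - 3 / 40 * ρ) := mul_le_mul_of_nonneg_left key hq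
      _ = ρ * confGap ρ := by unfold confGap; ring
      _ ≤ lam * confGap ρ := mul_le_mul_of_nonneg_right hl1 hu0.le
  · rw [Real.log_one, add_zero]
    exact mul_le_mul_of_nonneg_left (by linarith) (by linarith)
  · have hG : globalGain ρ = 1 + 15 / 16 * ρ := by
      rw [globalGain, if_pos (by linarith)]
    rw [hG]
    have key : 21 / 40 * ρ ≤ (1 + ρ) * ((57 / 200 - 23 / 200 * ρ) -
        51 / 100 * (1 - ρ) * (57 / 200 - 23 / 200 * ρ) ^ 2) := by
      nlinarith [mul_nonneg h0.le (show 0 ≤ 3 / 5 - ρ by linarith),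
        mul_nonneg (mul_nonneg h0.le h0.le) (show 0 ≤ 3 / 5 - ρ by linarith), pow_pos h0 3,
        pow_pos h0 4, pow_pos h0 2]
    have h3 := mul_le_mul_of_nonneg_left key (show 0 ≤ ρ ^ 2 * (1 - ρ) from
      mul_nonneg (sq_nonneg _) (by linarith))
    have h4 := mul_le_mul_of_nonneg_left hr3 (show 0 ≤ 15 / 16 * ρ * (1 - ρ) from
      mul_nonneg (by linarith) (by linarith))
    have h5 : ((1 : ℝ) + 1⁻¹) / 2 = 1 := by norm_num
    rw [h5]
    linarith

/-- For `ρ ≥ 3/5` the tilt is increased: `z` is a lower bound for the slope of the first term. -/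
theorem exists_confMgf_le_of_ge (hlam : ρ = Real.tanh lam) (h0 : 3 / 5 ≤ ρ) (h1 : ρ < 1) {B z : ℝ}
    (hB : B ≤ 2 / 5 + (ρ + ρ ^ 3 / 3 + ρ ^ 5 / 5 + ρ ^ 7 / 7))
    (hz : z ≤ B * (9 / 40 - 3 / 80 * ρ)) (hz0 : 0 ≤ z) (hz1 : z ≤ 2 / 5)
    (hfin : globalGain ρ * (1 - Real.sqrt (1 - ρ ^ 2)) ≤
      (1 + ρ) * (ρ * z - 51 / 100 * (1 - ρ) * z ^ 2) + 1 - 13 / 12 * Real.sqrt (1 - ρ ^ 2)) :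
    ∃ t, 0 ≤ t ∧ confMgf ρ t ≤ 1 - globalGain ρ * crossRate ρ := by
  have hρ : 0 < ρ := by linarith
  have hser := series_le_of_tanh hlam hρ h1
  have hl1 := le_of_tanh_eq hlam hρ h1
  have hu0 := confGap_pos hρ h1
  have hlog1 := two_fifths_le_log
  have hlog2 := log_three_halves_le
  have hu2 : confGap ρ ≤ 17 / 100 := by unfold confGap; nlinarith
  -- This raises the second term only by the factor 13/12, while the first one, which has the larger
  -- weight, gains from the larger tilt.
  refine exists_confMgf_le hlam hρ h1 (σ := 3 / 2) (θ := z * (1 - ρ)) (by norm_num) (by linarith)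
    (mul_nonneg hz0 (by linarith)) (by nlinarith) ?_ ?_ ?_
  · have e1 : z * (1 - ρ) * (2 - confGap ρ) ≤ z * (1 - ρ) * 2 :=
      mul_le_mul_of_nonneg_left (by linarith) (mul_nonneg hz0 (by linarith))
    have e2 : z * (1 - ρ) ≤ B * (9 / 40 - 3 / 80 * ρ) * (1 - ρ) :=
      mul_le_mul_of_nonneg_right hz (by linarith)
    have e3 : B * confGap ρ ≤ (lam + Real.log (3 / 2)) * confGap ρ :=
      mul_le_mul_of_nonneg_right (by linarith) hu0.le
    have e4 : B * confGap ρ = B * (9 / 40 - 3 / 80 * ρ) * (1 - ρ) * 2 := by unfold confGap; ring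
    linarith
  · have : (lam + Real.log (3 / 2)) * confGap ρ ≤ (lam + 1 / 2) * (17 / 100) := by
      apply mul_le_mul <;> linarith
    have : lam * (183 / 100) ≤ lam * (2 - confGap ρ) :=
      mul_le_mul_of_nonneg_left (by linarith) (by linarith)
    linarith
  · have hs : ((3 / 2 : ℝ) + (3 / 2)⁻¹) / 2 = 13 / 12 := by norm_num
    rw [hs]
    have := mul_le_mul_of_nonneg_right hfin (show 0 ≤ 1 - ρ by linarith)
    linarith

/-- Convexity of powers; it replaces the lower bound on `lam` by one that is linear in ρ. -/
theorem tangent_le_pow {c : ℝ} (hc : 0 ≤ c) (h0 : 0 ≤ ρ) (k : ℕ) :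
    c ^ (k + 1) + (k + 1) * c ^ k * (ρ - c) ≤ ρ ^ (k + 1) := by
  induction k with
  | zero => simp
  | succ k ih =>
    have h2 := mul_le_mul_of_nonneg_right ih h0
    have h3 : 0 ≤ (k + 1) * c ^ k * (ρ - c) ^ 2 := by positivity
    push_cast
    rw [pow_succ ρ (k + 1)]
    refine le_trans (le_of_sub_nonneg ?_) h2
    have : (c ^ (k + 1) + (k + 1) * c ^ k * (ρ - c)) * ρ -
      (c ^ (k + 1 + 1) + (k + 1 + 1) * c ^ (k + 1) * (ρ - c)) =
      (k + 1) * c ^ k * (ρ - c) ^ 2 := by ring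
    rw [this]
    exact h3

theorem tangent_le_series {c : ℝ} (hc : 0 ≤ c) (h0 : 0 ≤ ρ) :
    c + c ^ 3 / 3 + c ^ 5 / 5 + c ^ 7 / 7 + (1 + c ^ 2 + c ^ 4 + c ^ 6) * (ρ - c) ≤
      ρ + ρ ^ 3 / 3 + ρ ^ 5 / 5 + ρ ^ 7 / 7 := by
  have h2 := tangent_le_pow hc h0 2
  have h4 := tangent_le_pow hc h0 4
  have h6 := tangent_le_pow hc h0 6
  norm_num at h2 h4 h6
  linarith

theorem exists_confMgf_le_of_mid (hlam : ρ = Real.tanh lam) (h0 : 3 / 5 ≤ ρ) (h1 : ρ < 4 / 5) :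
    ∃ t, 0 ≤ t ∧ confMgf ρ t ≤ 1 - globalGain ρ * crossRate ρ := by
  have hser := tangent_le_series (c := 7 / 10) (by norm_num) (show 0 ≤ ρ by linarith)
  norm_num at hser
  -- A chord of the concave function √(1 - ρ²), through its values at 3/5 and 4/5.
  have hr : 7 / 5 - ρ ≤ Real.sqrt (1 - ρ ^ 2) := Real.le_sqrt_of_sq_le (by nlinarith)
  refine exists_confMgf_le_of_ge hlam h0 (by linarith) (B := 251 / 200 + 184 / 100 * (ρ - 7 / 10))
    (z := 108 / 500 + 16 / 50 * (ρ - 3 / 5)) (by linarith) (by nlinarith)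
    (by linarith) (by linarith) ?_
  rw [globalGain, if_pos h1]
  have h5 := mul_le_mul_of_nonneg_left hr (show 0 ≤ 15 / 16 * ρ - 1 / 12 by linarith)
  have h6 : (108 / 500 + 16 / 50 * (ρ - 3 / 5)) ^ 2 ≤ 8 / 100 := by nlinarith
  have h7 := mul_le_mul_of_nonneg_left h6 (show 0 ≤ (1 + ρ) * (1 - ρ) from
    mul_nonneg (by linarith) (by linarith))
  have key : 15 / 16 * ρ - (15 / 16 * ρ - 1 / 12) * (7 / 5 - ρ) ≤
      (1 + ρ) * (ρ * (108 / 500 + 16 / 50 * (ρ - 3 / 5))) -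
        51 / 100 * ((1 + ρ) * (1 - ρ) * (8 / 100)) := by
    have h8 := mul_nonneg (sub_nonneg.2 h0) (sub_nonneg.2 h1.le)
    nlinarith [mul_nonneg h8 (show 0 ≤ ρ by linarith)]
  linarith

theorem exists_confMgf_le_of_high (hlam : ρ = Real.tanh lam) (h0 : 4 / 5 ≤ ρ) (h1 : ρ < 1) :
    ∃ t, 0 ≤ t ∧ confMgf ρ t ≤ 1 - globalGain ρ * crossRate ρ := by
  have hser := tangent_le_series (c := 9 / 10) (by norm_num) (show 0 ≤ ρ by linarith)
  norm_num at hser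
  -- Again linear lower bounds close to chords, on either side of 9/10.
  obtain ⟨r', hr', hkey⟩ : ∃ r' ≤ Real.sqrt (1 - ρ ^ 2), 3 / 4 - 2 / 3 * r' ≤
      (1 + ρ) * (ρ * (276 / 1000 + 51 / 100 * (ρ - 4 / 5)) - 51 / 100 * (1 - ρ) * (16 / 100)) := by
    rcases lt_or_ge ρ (9 / 10) with h | h
    · have h8 := mul_nonneg (sub_nonneg.2 h0) (sub_nonneg.2 h.le)
      exact ⟨27 / 100 + 33 / 20 * (1 - ρ), Real.le_sqrt_of_sq_le (by nlinarith),
        by nlinarith [mul_nonneg h8 (show 0 ≤ ρ by linarith)]⟩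
    · have h8 := mul_nonneg (sub_nonneg.2 h) (sub_nonneg.2 h1.le)
      exact ⟨87 / 20 * (1 - ρ), Real.le_sqrt_of_sq_le (by nlinarith),
        by nlinarith [mul_nonneg h8 (show 0 ≤ ρ by linarith)]⟩
  refine exists_confMgf_le_of_ge hlam (by linarith) h1 (B := 172 / 100 + 3 * (ρ - 9 / 10))
    (z := 276 / 1000 + 51 / 100 * (ρ - 4 / 5)) (by linarith) (by nlinarith)
    (by linarith) (by linarith) ?_
  rw [globalGain, if_neg (by linarith)]
  have h6 : (276 / 1000 + 51 / 100 * (ρ - 4 / 5)) ^ 2 ≤ 16 / 100 := by nlinarith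
  have h7 := mul_le_mul_of_nonneg_left h6 (show 0 ≤ (1 + ρ) * (1 - ρ) from
    mul_nonneg (by linarith) (by linarith))
  linarith

theorem exists_confMgf_le_globalGain (hlam : ρ = Real.tanh lam) (h0 : 0 < ρ) (h1 : ρ < 1) :
    ∃ t, 0 ≤ t ∧ confMgf ρ t ≤ 1 - globalGain ρ * crossRate ρ := by
  rcases lt_or_ge ρ (3 / 5) with h | h
  · exact exists_confMgf_le_of_lt hlam h0 h
  · rcases lt_or_ge ρ (4 / 5) with h' | h'
    · exact exists_confMgf_le_of_mid hlam h h'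
    · exact exists_confMgf_le_of_high hlam h' h1

end Elementary

end ActiveLathe

namespace ActiveLathe

/-! ### Rates -/

section Rates

variable {lam ρ : ℝ}

/-- Bernoulli's inequality: multiplying the rate 1 - mgf by `c` multiplies the exponent by at least
`c`. -/
theorem one_sub_crossRate_mul_le (h0 : 0 < ρ) (h1 : ρ < 1) {c : ℝ} (hc : 1 ≤ c) :
    1 - c * crossRate ρ ≤ Real.exp (-(c * kPassive ρ)) := by
  have hy := crossRate_lt_half h0
  have h := one_add_mul_self_le_rpow_one_add (s := -crossRate ρ) (by linarith) hc
  rw [← sub_eq_add_neg, Real.rpow_def_of_pos (by linarith)] at h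
  rw [kPassive_eq]
  refine le_trans (le_of_eq (by ring)) (h.trans (le_of_eq ?_))
  congr 1
  ring

theorem crossRate_le (h0 : 0 < ρ) (h1 : ρ < 1) : crossRate ρ ≤ ρ ^ 2 * (1 - ρ) / 2 := by
  have h3 : ρ ^ 2 ≤ 1 := by nlinarith
  have h2 : 1 - ρ ^ 2 ≤ Real.sqrt (1 - ρ ^ 2) :=
    Real.le_sqrt_of_sq_le (by nlinarith [sq_nonneg ρ])
  rw [crossRate]
  nlinarith

/-- For y = `crossRate ρ`, -log(1 - y) ≤ y/(1 - y), and y ≤ 2/27 because ρ²(1 - ρ) is largest at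
2/3. All other costs are compared with ρ²(1 - ρ) as well. -/
theorem kPassive_le (h0 : 0 < ρ) (h1 : ρ < 1) : kPassive ρ ≤ 27 / 50 * (ρ ^ 2 * (1 - ρ)) := by
  have hy := crossRate_le h0 h1
  have hy0 := crossRate_pos h0 h1
  have hmax : ρ ^ 2 * (1 - ρ) ≤ 4 / 27 := by
    nlinarith [mul_nonneg (show 0 ≤ ρ + 1 / 3 by linarith) (sq_nonneg (ρ - 2 / 3))]
  have hpos : 0 < 1 - crossRate ρ := by linarith
  have h := Real.one_sub_inv_le_log_of_pos hpos
  have h2 : (1 - crossRate ρ)⁻¹ ≤ 1 + 27 / 25 * crossRate ρ := by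
    rw [inv_le_iff_one_le_mul₀ hpos]
    nlinarith
  rw [kPassive_eq]
  linarith

/-- The variance proxy must carry the factor 1 - ρ: only then does a deviation of order ρ(1 - ρ)
cost ρ²(1 - ρ), the order of the passive exponent. -/
theorem cosh_add_mul_sinh_le (hρ : ρ ≤ 1) {t : ℝ} (ht : 0 ≤ t) :
    Real.cosh t + ρ * Real.sinh t ≤ Real.exp (ρ * t + (1 - ρ) * t ^ 2) := by
  have h1 : Real.exp (-(2 * t)) ≤ 1 - 2 * t + 2 * t ^ 2 := by
    have h2 := Real.quadratic_le_exp_of_nonneg (x := 2 * t) (by linarith)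
    rw [Real.exp_neg, inv_le_iff_one_le_mul₀ (Real.exp_pos _)]
    have h3 : 0 ≤ 1 - 2 * t + 2 * t ^ 2 := by nlinarith [sq_nonneg (2 * t - 1)]
    have h4 := mul_le_mul_of_nonneg_left h2 h3
    have h5 : 0 ≤ t ^ 4 := by positivity
    nlinarith
  have h2 : Real.cosh t + ρ * Real.sinh t =
      Real.exp t * (1 - (1 - ρ) / 2 * (1 - Real.exp (-(2 * t)))) := by
    rw [Real.cosh_eq, Real.sinh_eq, show -(2 * t) = -t + -t by ring, Real.exp_add]
    have : Real.exp t * Real.exp (-t) = 1 := by rw [← Real.exp_add]; simp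
    linear_combination (-(1 - ρ) / 2 * Real.exp (-t)) * this
  have h3 := Real.add_one_le_exp (-((1 - ρ) / 2 * (1 - Real.exp (-(2 * t)))))
  rw [h2]
  calc Real.exp t * (1 - (1 - ρ) / 2 * (1 - Real.exp (-(2 * t))))
      ≤ Real.exp t * Real.exp (-((1 - ρ) / 2 * (1 - Real.exp (-(2 * t))))) :=
        mul_le_mul_of_nonneg_left (by linarith) (Real.exp_pos _).le
    _ = Real.exp (t - (1 - ρ) / 2 * (1 - Real.exp (-(2 * t)))) := by
        rw [← Real.exp_add]; ring_nf
    _ ≤ _ := by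
        rw [Real.exp_le_exp]
        have := mul_le_mul_of_nonneg_left h1 (show 0 ≤ (1 - ρ) / 2 by linarith)
        linarith

theorem cosh_sub_mul_sinh_le (hρ : ρ ≤ 1) {t : ℝ} (ht : 0 ≤ t) (ht' : t ≤ 1 / 12) :
    Real.cosh t - ρ * Real.sinh t ≤ Real.exp (-(ρ * t) + 43 / 40 * (1 - ρ) * t ^ 2) := by
  have h1 : Real.exp (2 * t) ≤ 1 + 2 * t + 43 / 20 * t ^ 2 := by
    have := exp_le_cubic (x := 2 * t) (by linarith) (by linarith)
    nlinarith [sq_nonneg t]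
  have h2 : Real.cosh t - ρ * Real.sinh t =
      Real.exp (-t) * (1 + (1 - ρ) / 2 * (Real.exp (2 * t) - 1)) := by
    rw [Real.cosh_eq, Real.sinh_eq, show 2 * t = t + t by ring, Real.exp_add]
    have : Real.exp t * Real.exp (-t) = 1 := by rw [← Real.exp_add]; simp
    linear_combination (-(1 - ρ) / 2 * Real.exp t) * this
  have h3 := Real.add_one_le_exp ((1 - ρ) / 2 * (Real.exp (2 * t) - 1))
  rw [h2]
  calc Real.exp (-t) * (1 + (1 - ρ) / 2 * (Real.exp (2 * t) - 1))
      ≤ Real.exp (-t) * Real.exp ((1 - ρ) / 2 * (Real.exp (2 * t) - 1)) :=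
        mul_le_mul_of_nonneg_left (by linarith) (Real.exp_pos _).le
    _ = Real.exp (-t + (1 - ρ) / 2 * (Real.exp (2 * t) - 1)) := by
        rw [← Real.exp_add]
    _ ≤ _ := by
        rw [Real.exp_le_exp]
        have := mul_le_mul_of_nonneg_left h1 (show 0 ≤ (1 - ρ) / 2 by linarith)
        linarith

/-- The moment generating function of one weak path. -/
theorem weak_mgf_le (h0 : 0 < ρ) (h1 : ρ < 1) {s : ℝ} (hs : s = 1 ∨ s = -1) :
    (1 + ρ) / 2 * ((1 + ρ) / 2 * Real.exp (2 / 5 * ρ * (1 * (1 * s - (1 - 21 / 40 * (1 - ρ))))) +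
      (1 - ρ) / 2 * Real.exp (2 / 5 * ρ * (-1 * (1 * s - (1 - 21 / 40 * (1 - ρ)))))) +
    (1 - ρ) / 2 * ((1 + ρ) / 2 * Real.exp (2 / 5 * ρ * (1 * (-1 * s - (1 - 21 / 40 * (1 - ρ))))) +
      (1 - ρ) / 2 * Real.exp (2 / 5 * ρ * (-1 * (-1 * s - (1 - 21 / 40 * (1 - ρ)))))) ≤
      1 - 27 / 800 * (ρ ^ 2 * (1 - ρ)) := by
  -- The exponents are ±a when the second edge's sign agrees with `s`, and ±b when it does not. The
  -- tilt is 2/5 ρ.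
  set a := 21 / 100 * (ρ * (1 - ρ)) with ha
  set b := ρ * (59 / 100 + 21 / 100 * ρ) with hb
  have hq : 0 < ρ * (1 - ρ) := mul_pos h0 (by linarith)
  have ha0 : 0 ≤ a := by positivity
  have ha1 : a ≤ 6 / 100 := by rw [ha]; nlinarith [sq_nonneg (ρ - 1 / 2)]
  have hb0 : 0 ≤ b := by positivity
  have hb1 : b ≤ 4 / 5 * ρ := by rw [hb]; nlinarith
  have hU1 : (1 + ρ) / 2 * Real.exp a + (1 - ρ) / 2 * Real.exp (-a) ≤
      1 + ρ * a + 13 / 25 * a ^ 2 := by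
    have e1 : Real.exp a ≤ 1 + a + 13 / 25 * a ^ 2 := by
      have := exp_le_cubic ha0 (by linarith)
      nlinarith [sq_nonneg a]
    have e2 : Real.cosh a ≤ 1 + 13 / 25 * a ^ 2 := by
      have := cosh_le_quartic ha0 (by linarith)
      have h3 : a ^ 2 ≤ 36 / 10000 := by nlinarith
      nlinarith [sq_nonneg a]
    rw [Real.cosh_eq] at e2
    have e3 := mul_le_mul_of_nonneg_left e1 h0.le
    have e4 := mul_le_mul_of_nonneg_left e2 (show 0 ≤ 1 - ρ by linarith)
    linarith
  have hU2 : (1 + ρ) / 2 * Real.exp (-b) + (1 - ρ) / 2 * Real.exp b ≤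
      1 - ρ ^ 2 * ((59 / 100 + 21 / 100 * ρ) - (59 / 100 + 21 / 100 * ρ) ^ 2 / 2 +
        1 / 100 * ρ ^ 2) := by
    have e1 := cosh_le_quartic hb0 (by linarith)
    have e2 := mul_le_mul_of_nonneg_left (cubic_le_sinh hb0) h0.le
    rw [Real.cosh_eq] at e1
    rw [Real.sinh_eq] at e2
    have e3 : 1 / 100 * ρ ^ 4 ≤ ρ * b ^ 3 / 6 - b ^ 4 / 7 := by
      have h3 : (59 / 100 : ℝ) ^ 3 ≤ (59 / 100 + 21 / 100 * ρ) ^ 3 := by gcongr; linarith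
      have h4 : ρ * b ^ 3 / 6 - b ^ 4 / 7 = ρ ^ 4 * ((59 / 100 + 21 / 100 * ρ) ^ 3 *
          (1 / 6 - (59 / 100 + 21 / 100 * ρ) / 7)) := by rw [hb]; ring
      rw [h4, mul_comm]
      refine mul_le_mul_of_nonneg_left ?_ (by positivity)
      have h5 : (1 / 20 : ℝ) ≤ 1 / 6 - (59 / 100 + 21 / 100 * ρ) / 7 := by linarith
      calc (1 / 100 : ℝ) ≤ (59 / 100) ^ 3 * (1 / 20) := by norm_num
        _ ≤ _ := mul_le_mul h3 h5 (by norm_num) (by positivity)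
    have e4 : ρ * b - b ^ 2 / 2 = ρ ^ 2 * ((59 / 100 + 21 / 100 * ρ) -
        (59 / 100 + 21 / 100 * ρ) ^ 2 / 2) := by rw [hb]; ring
    linarith
  have hV : (0 : ℝ) ≤ (59 / 100 + 21 / 100 * ρ) - (59 / 100 + 21 / 100 * ρ) ^ 2 / 2 +
        1 / 100 * ρ ^ 2 := by nlinarith
  have hV2 := mul_nonneg (sq_nonneg ρ) hV
  have hV3 : 0 ≤ ρ * a + 13 / 25 * a ^ 2 := by positivity
  have hγ : 27 / 800 ≤ 1 / 2 * ((59 / 100 + 21 / 100 * ρ) - (59 / 100 + 21 / 100 * ρ) ^ 2 / 2 +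
        1 / 100 * ρ ^ 2) - (1 + ρ) / 2 * (21 / 100 + 13 / 25 * (441 / 10000) * (1 - ρ)) := by
    nlinarith
  have hmain : (1 + ρ) / 2 * (1 + ρ * a + 13 / 25 * a ^ 2) + (1 - ρ) / 2 *
      (1 - ρ ^ 2 * ((59 / 100 + 21 / 100 * ρ) - (59 / 100 + 21 / 100 * ρ) ^ 2 / 2 +
        1 / 100 * ρ ^ 2)) ≤ 1 - 27 / 800 * (ρ ^ 2 * (1 - ρ)) := by
    have := mul_le_mul_of_nonneg_left hγ (show 0 ≤ ρ ^ 2 * (1 - ρ) from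
      mul_nonneg (sq_nonneg _) (by linarith))
    rw [ha]
    linarith
  have hr1 : (0 : ℝ) ≤ (1 + ρ) / 2 := by linarith
  have hr2 : (0 : ℝ) ≤ (1 - ρ) / 2 := by linarith
  rcases hs with rfl | rfl
  · have e1 : 2 / 5 * ρ * (1 * (1 * 1 - (1 - 21 / 40 * (1 - ρ)))) = a := by rw [ha]; ring
    have e2 : 2 / 5 * ρ * (-1 * (1 * 1 - (1 - 21 / 40 * (1 - ρ)))) = -a := by rw [ha]; ring
    have e3 : 2 / 5 * ρ * (1 * (-1 * 1 - (1 - 21 / 40 * (1 - ρ)))) = -b := by rw [hb]; ring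
    have e4 : 2 / 5 * ρ * (-1 * (-1 * 1 - (1 - 21 / 40 * (1 - ρ)))) = b := by rw [hb]; ring
    rw [e1, e2, e3, e4]
    have f1 := mul_le_mul_of_nonneg_left hU1 hr1
    have f2 := mul_le_mul_of_nonneg_left hU2 hr2
    linarith
  · have e1 : 2 / 5 * ρ * (1 * (1 * -1 - (1 - 21 / 40 * (1 - ρ)))) = -b := by rw [hb]; ring
    have e2 : 2 / 5 * ρ * (-1 * (1 * -1 - (1 - 21 / 40 * (1 - ρ)))) = b := by rw [hb]; ring
    have e3 : 2 / 5 * ρ * (1 * (-1 * -1 - (1 - 21 / 40 * (1 - ρ)))) = a := by rw [ha]; ring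
    have e4 : 2 / 5 * ρ * (-1 * (-1 * -1 - (1 - 21 / 40 * (1 - ρ)))) = -a := by rw [ha]; ring
    rw [e1, e2, e3, e4]
    have f1 := mul_le_mul_of_nonneg_left hU1 hr2
    have f2 := mul_le_mul_of_nonneg_left hU2 hr1
    have f3 := mul_nonneg h0.le (add_nonneg hV3 hV2)
    linarith

theorem alphaTable_mem (r : ℝ) :
    alphaTable r ∈ ({1, 0.995, 0.985, 0.95, 0.9, 0.85, 0.8} : Finset ℝ) := by
  unfold alphaTable
  split_ifs <;> simp

theorem gain_le (ρ : ℝ) : (ρ < 0.03 → gain ρ ≤ 1) ∧ (ρ < 0.1 → gain ρ ≤ 1.01) ∧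
    (ρ < 0.2 → gain ρ ≤ 1.03) ∧ (ρ < 0.4 → gain ρ ≤ 1.08) ∧ (ρ < 0.6 → gain ρ ≤ 1.19) ∧
    (ρ < 0.8 → gain ρ ≤ 1.29) ∧ gain ρ ≤ 1.4 := by
  unfold gain
  refine ⟨fun h => ?_, fun h => ?_, fun h => ?_, fun h => ?_, fun h => ?_, fun h => ?_, ?_⟩ <;>
    split_ifs <;> norm_num

/-- The fraction of the global phase is suitable if the correlation is estimated well. -/
theorem gain_le_alphaTable (h0 : 0 < ρ) {r : ℝ} (hr : |r - ρ| ≤ ρ * (1 - ρ) / 6) :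
    gain ρ ≤ alphaTable r * globalGain ρ ∧ gain ρ ≤ 3 - 2 * alphaTable r := by
  rw [abs_le] at hr
  obtain ⟨hl, hu⟩ := hr
  -- Tangents of ρ² make the bounds on `r` linear near the breakpoints of the two tables.
  have hq : ∀ c : ℝ, 2 * c * ρ - c ^ 2 ≤ ρ ^ 2 := fun c => by linarith [sq_nonneg (ρ - c)]
  have hup : r ≤ 7 / 6 * ρ := by linarith [hq 0]
  have hlo : 5 / 6 * ρ ≤ r := by linarith [hq 0]
  obtain ⟨g1, g2, g3, g4, g5, g6, g7⟩ := gain_le ρ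
  have hG : ρ < 0.8 → globalGain ρ = 1 + 15 / 16 * ρ := fun h => by
    rw [globalGain, if_pos (by linarith)]
  unfold alphaTable
  split_ifs with c1 c2 c3 c4 c5 c6
  · have := g1 (by linarith)
    rw [hG (by linarith)]
    constructor <;> linarith
  · have := g2 (by linarith)
    rw [hG (by linarith)]
    constructor <;> linarith
  · have := g3 (by linarith)
    rw [hG (by linarith)]
    constructor <;> linarith
  · have h := g4 (by linarith [hq (2 / 5)])
    rw [hG (by linarith)]
    rcases lt_or_ge ρ 0.2 with h' | h'
    · have := g3 h'
      constructor <;> linarith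
    · constructor <;> linarith
  · have h := g5 (by linarith [hq (3 / 5)])
    rw [hG (by linarith)]
    rcases lt_or_ge ρ 0.4 with h' | h'
    · have := g4 h'
      constructor <;> linarith
    · constructor <;> linarith
  · have hρ : ρ < 0.8 := by linarith [hq (4 / 5)]
    have h := g6 hρ
    rw [hG hρ]
    rcases lt_or_ge ρ 0.6 with h' | h'
    · have := g5 h'
      constructor <;> linarith
    · constructor <;> linarith
  · have hlow : 0.7 ≤ ρ := by linarith [hq (7 / 10)]
    rcases lt_or_ge ρ 0.8 with h' | h'
    · have := g6 h'
      rw [hG h']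
      constructor <;> linarith
    · rw [globalGain, if_neg (by linarith)]
      constructor <;> linarith

theorem alphaTable_ge (r : ℝ) : 4 / 5 ≤ alphaTable r := by
  unfold alphaTable
  split_ifs <;> norm_num

theorem alphaTable_le_one (r : ℝ) : alphaTable r ≤ 1 := by
  unfold alphaTable
  split_ifs <;> norm_num

end Rates

end ActiveLathe

namespace ActiveLathe

/-! ### Moment generating functions of the error events of the global phase -/

section GlobalMgf

variable {V : Type*} [Fintype V] [DecidableEq V] {T : SimpleGraph V} {lam : ℝ}

theorem exp_mul_sqrt (lam : ℝ) :
    Real.exp lam * Real.sqrt (1 - Real.tanh lam ^ 2) = 1 + Real.tanh lam := by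
  have := Real.cosh_pos lam
  rw [← inv_cosh_eq_sqrt, Real.tanh_eq_sinh_div_cosh, ← Real.cosh_add_sinh]
  field_simp

theorem exp_neg_mul (lam : ℝ) :
    Real.exp (-lam) * (1 + Real.tanh lam) = Real.sqrt (1 - Real.tanh lam ^ 2) := by
  rw [← exp_mul_sqrt, ← mul_assoc, ← Real.exp_add]
  simp

theorem exp_mul (lam : ℝ) :
    Real.exp lam * (1 - Real.tanh lam) = Real.sqrt (1 - Real.tanh lam ^ 2) := by
  have h := exp_neg_mul (-lam)
  rw [Real.tanh_neg, neg_neg, neg_sq] at h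
  rw [← h]
  ring

theorem exp_neg_mul_sqrt (lam : ℝ) :
    Real.exp (-lam) * Real.sqrt (1 - Real.tanh lam ^ 2) = 1 - Real.tanh lam := by
  have h := exp_mul_sqrt (-lam)
  rwa [Real.tanh_neg, neg_sq, ← sub_eq_add_neg] at h

theorem long_rate_le {ρ : ℝ} (h0 : 0 < ρ) (h1 : ρ < 1) :
    1 - (1 + ρ) * crossRate ρ ≤ 1 - globalGain ρ * crossRate ρ := by
  have := mul_le_mul_of_nonneg_right (globalGain_le h0) (crossRate_pos h0 h1).le
  linarith

theorem long_rate_eq {ρ : ℝ} : 1 - (1 + ρ) * crossRate ρ =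
    1 - (1 - ρ ^ 2) / 2 * (1 - Real.sqrt (1 - ρ ^ 2)) := by
  rw [crossRate]
  ring

/-- At distance three there are two independent signs besides `e`, so (1 - ρ)/2 improves to (1 -
ρ²)/2. -/
theorem isingE_long_le (hT : T.IsTree) (h0 : 0 < Real.tanh lam) {e e₁ e₂ : Sym2 V}
    (he : e ∈ T.edgeSet) (he₁ : e₁ ∈ T.edgeSet) (he₂ : e₂ ∈ T.edgeSet) (hne₁ : e₁ ≠ e)
    (hne₂ : e₂ ≠ e) (hne : e₁ ≠ e₂) {u v : V} (hcut : Cuts T e u v) (hcut₁ : Cuts T e₁ u v)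
    (hcut₂ : Cuts T e₂ u v) :
    isingE T lam (fun x => Real.exp (lam / 2 * (spinProd x s(u, v) - spinProd x e))) ≤
      1 - (1 + Real.tanh lam) * crossRate (Real.tanh lam) := by
  rw [isingE_exp_cross hT he hcut, long_rate_eq, inv_cosh_eq_sqrt]
  have h1 := isingE_cross_le_sq (lam := lam) hT he he₁ he₂ hne₁ hne₂ hne hcut₁ hcut₂
  have h2 := sqrt_nonneg_lt_one h0
  nlinarith

theorem isingE_exp_neg_edge (hT : T.IsTree) {e : Sym2 V} (he : e ∈ T.edgeSet) :
    isingE T lam (fun x => Real.exp (-(lam * spinProd x e))) =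
      Real.sqrt (1 - Real.tanh lam ^ 2) := by
  rw [isingE_edge hT he (fun s => Real.exp (-(lam * s))), ← inv_cosh_eq_sqrt, ← average_exp_neg]
  norm_num

theorem isingE_nonpos_edge_le (hT : T.IsTree) (h0 : 0 < Real.tanh lam) (h1 : Real.tanh lam < 1)
    {e : Sym2 V} (he : e ∈ T.edgeSet) :
    isingE T lam (fun x => Real.exp (-(lam * spinProd x e))) ≤
      1 - (1 + Real.tanh lam) * crossRate (Real.tanh lam) := by
  have h2 := sqrt_nonneg_lt_one h0
  rw [isingE_exp_neg_edge hT he, long_rate_eq]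
  have h3 : (1 - Real.tanh lam ^ 2) / 2 ≤ 1 := by nlinarith
  have := mul_le_mul_of_nonneg_right h3 (show 0 ≤ 1 - Real.sqrt (1 - Real.tanh lam ^ 2) by linarith)
  linarith

/-- The increment of an arc with edges `e` and `e'`. -/
noncomputable def arcStep (lam : ℝ) (a b : ℝ) : ℝ := lam / 2 * (b * (a - 1))

theorem isingE_arc (hT : T.IsTree) {e e' : Sym2 V} (he : e ∈ T.edgeSet) (he' : e' ∈ T.edgeSet)
    (hne : e ≠ e') :
    isingE T lam (fun x => Real.exp (arcStep lam (spinProd x e) (spinProd x e'))) =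
      1 - crossRate (Real.tanh lam) := by
  rw [isingE_edge_edge hT he he' hne (fun a b => Real.exp (arcStep lam a b)), crossRate,
    ← inv_cosh_eq_sqrt, ← average_exp_neg]
  have e1 : arcStep lam 1 1 = 0 := by simp [arcStep]
  have e2 : arcStep lam 1 (-1) = 0 := by simp [arcStep]
  have e3 : arcStep lam (-1) 1 = -lam := by simp only [arcStep]; ring
  have e4 : arcStep lam (-1) (-1) = lam := by simp only [arcStep]; ring
  rw [e1, e2, e3, e4, Real.exp_zero]
  ring

/-- The mean over `e₃` is √(1 - ρ²) if exactly one pivot is flipped. It is 1 if none is, and again 1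
if both are, as cosh(2λ) - ρ sinh(2λ) = 1. -/
theorem isingE_arcs_same_end (hT : T.IsTree) {e₁ e₂ e₃ : Sym2 V} (h₁ : e₁ ∈ T.edgeSet)
    (h₂ : e₂ ∈ T.edgeSet) (h₃ : e₃ ∈ T.edgeSet) (h₁₂ : e₁ ≠ e₂) (h₁₃ : e₁ ≠ e₃) (h₂₃ : e₂ ≠ e₃) :
    isingE T lam (fun x => Real.exp (arcStep lam (spinProd x e₁) (spinProd x e₃) +
      arcStep lam (spinProd x e₂) (spinProd x e₃))) =
      1 - (1 + Real.tanh lam) * crossRate (Real.tanh lam) := by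
  rw [isingE_three_edges hT h₁ h₂ h₃ h₁₃ h₂₃ (fun a b c => Real.exp (arcStep lam a c +
    arcStep lam b c)), isingE_edge_edge hT h₁ h₂ h₁₂ (fun a b => Real.exp (arcStep lam a 1 +
    arcStep lam b 1)), isingE_edge_edge hT h₁ h₂ h₁₂ (fun a b => Real.exp (arcStep lam a (-1) +
    arcStep lam b (-1))), long_rate_eq]
  have e1 : arcStep lam 1 1 = 0 := by simp [arcStep]
  have e2 : arcStep lam 1 (-1) = 0 := by simp [arcStep]
  have e3 : arcStep lam (-1) 1 = -lam := by simp only [arcStep]; ring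
  have e4 : arcStep lam (-1) (-1) = lam := by simp only [arcStep]; ring
  rw [e1, e2, e3, e4]
  simp only [Real.exp_add, Real.exp_zero]
  have hp := exp_mul lam
  have hn := exp_neg_mul lam
  have hp' := exp_mul_sqrt lam
  have hn' := exp_neg_mul_sqrt lam
  set ρ := Real.tanh lam
  set r := Real.sqrt (1 - ρ ^ 2)
  linear_combination ((1 - ρ) ^ 2 / 8 * Real.exp (-lam) + (1 + ρ) * (1 - ρ) / 4) * hn +
    (1 - ρ) ^ 2 / 8 * hn' + ((1 - ρ) ^ 2 / 8 * Real.exp lam + (1 + ρ) * (1 - ρ) / 4) * hp +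
    (1 - ρ) ^ 2 / 8 * hp'

theorem isingE_arcs_chain_le (hT : T.IsTree) (h0 : 0 < Real.tanh lam) (h1 : Real.tanh lam < 1)
    {e₁ e₂ e₃ : Sym2 V} (h₁ : e₁ ∈ T.edgeSet)
    (h₂ : e₂ ∈ T.edgeSet) (h₃ : e₃ ∈ T.edgeSet) (h₁₂ : e₁ ≠ e₂) (h₁₃ : e₁ ≠ e₃) (h₂₃ : e₂ ≠ e₃) :
    isingE T lam (fun x => Real.exp (arcStep lam (spinProd x e₁) (spinProd x e₂) +
      arcStep lam (spinProd x e₂) (spinProd x e₃))) ≤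
      1 - (1 + Real.tanh lam) * crossRate (Real.tanh lam) := by
  rw [isingE_three_edges hT h₁ h₂ h₃ h₁₃ h₂₃ (fun a b c => Real.exp (arcStep lam a b +
    arcStep lam b c)), isingE_edge_edge hT h₁ h₂ h₁₂ (fun a b => Real.exp (arcStep lam a b +
    arcStep lam b 1)), isingE_edge_edge hT h₁ h₂ h₁₂ (fun a b => Real.exp (arcStep lam a b +
    arcStep lam b (-1))), long_rate_eq]
  have hr := sqrt_nonneg_lt_one h0
  have e1 : arcStep lam 1 1 = 0 := by simp [arcStep]
  have e2 : arcStep lam 1 (-1) = 0 := by simp [arcStep]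
  have e3 : arcStep lam (-1) 1 = -lam := by simp only [arcStep]; ring
  have e4 : arcStep lam (-1) (-1) = lam := by simp only [arcStep]; ring
  rw [e1, e2, e3, e4]
  simp only [Real.exp_add, Real.exp_zero]
  have hp := exp_mul lam
  have hn := exp_neg_mul lam
  have hp' := exp_mul_sqrt lam
  have hpn : Real.exp lam * Real.exp (-lam) = 1 := by rw [← Real.exp_add]; simp
  set ρ := Real.tanh lam
  set r := Real.sqrt (1 - ρ ^ 2)
  have hlow : 1 - ρ ≤ r := Real.le_sqrt_of_sq_le (by nlinarith)
  have hkey : 0 ≤ ρ * (1 - ρ) * (r - (1 - ρ)) / 4 := by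
    have : 0 ≤ ρ * (1 - ρ) := mul_nonneg h0.le (by linarith)
    have : 0 ≤ r - (1 - ρ) := by linarith
    positivity
  refine le_of_sub_nonneg (hkey.trans (le_of_eq ?_))
  linear_combination ((1 - ρ) / 4 + (1 + ρ) * (1 - ρ) / 8) * hn +
    (1 + ρ) * (1 - ρ) ^ 2 / 8 * hpn + ((1 + ρ) * (1 - ρ) / 8 + (1 - ρ) ^ 2 / 8 * Real.exp lam) * hp +
    (1 - ρ) ^ 2 / 8 * hp'

/-- Independence gives (1 - y)², and y ≤ 1 - ρ. -/
theorem isingE_arcs_disjoint_le (hT : T.IsTree) (h0 : 0 < Real.tanh lam) (h1 : Real.tanh lam < 1)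
    {e₁ e₁' e₂ e₂' : Sym2 V} (h₁ : e₁ ∈ T.edgeSet) (h₁' : e₁' ∈ T.edgeSet)
    (h₂ : e₂ ∈ T.edgeSet) (h₂' : e₂' ∈ T.edgeSet) (hne₁ : e₁ ≠ e₁') (hne₂ : e₂ ≠ e₂')
    (ha : e₁ ≠ e₂) (hb : e₁ ≠ e₂') (hc : e₁' ≠ e₂) (hd : e₁' ≠ e₂') :
    isingE T lam (fun x => Real.exp (arcStep lam (spinProd x e₁) (spinProd x e₁') +
      arcStep lam (spinProd x e₂) (spinProd x e₂'))) ≤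
      1 - (1 + Real.tanh lam) * crossRate (Real.tanh lam) := by
  have hQ : ∀ e ∈ T.edgeSet, e₁ ≠ e → e₁' ≠ e → ∀ x,
      Real.exp (arcStep lam (spinProd (flip T e x) e₁) (spinProd (flip T e x) e₁')) =
      Real.exp (arcStep lam (spinProd x e₁) (spinProd x e₁')) := by
    intro e he hx hy x
    rw [spinProd_flip_of_ne hT he h₁ hx, spinProd_flip_of_ne hT he h₁' hy]
  have hM : (1 + Real.tanh lam) / 2 * ((1 + Real.tanh lam) / 2 * Real.exp (arcStep lam 1 1) +
      (1 - Real.tanh lam) / 2 * Real.exp (arcStep lam (-1) 1)) +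
      (1 - Real.tanh lam) / 2 * ((1 + Real.tanh lam) / 2 * Real.exp (arcStep lam 1 (-1)) +
      (1 - Real.tanh lam) / 2 * Real.exp (arcStep lam (-1) (-1))) =
      1 - crossRate (Real.tanh lam) := by
    rw [← isingE_arc (lam := lam) hT h₂ h₂' hne₂,
      isingE_edge_edge hT h₂ h₂' hne₂ (fun a b => Real.exp (arcStep lam a b))]
  have h := isingE_mul_pair_le (lam := lam) hT h₂ h₂' hne₂
    (Q := fun x => Real.exp (arcStep lam (spinProd x e₁) (spinProd x e₁')))
    (fun x => (Real.exp_pos _).le) (hQ e₂ h₂ ha hc) (hQ e₂' h₂' hb hd) (η := fun _ => 1)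
    (fun _ => rfl) (fun _ => rfl) (fun _ => Or.inl rfl)
    (fun a b _ => Real.exp (arcStep lam a b)) (M := 1 - crossRate (Real.tanh lam))
    (fun _ _ => hM.le)
  rw [isingE_arc hT h₁ h₁' hne₁] at h
  simp only [← Real.exp_add] at h
  refine h.trans ?_
  have hy := crossRate_pos h0 h1
  have hr := sqrt_nonneg_lt_one h0
  have hy1 : crossRate (Real.tanh lam) ≤ 1 - Real.tanh lam := by
    rw [crossRate]
    nlinarith
  nlinarith

/-- The excluded cases, a common pivot and a reversed path, are those that `Regular.arcs` permits.
-/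
theorem isingE_arcs_le (hT : T.IsTree) (h0 : 0 < Real.tanh lam) (h1 : Real.tanh lam < 1)
    {e₁ e₁' e₂ e₂' : Sym2 V} (h₁ : e₁ ∈ T.edgeSet) (h₁' : e₁' ∈ T.edgeSet)
    (h₂ : e₂ ∈ T.edgeSet) (h₂' : e₂' ∈ T.edgeSet) (hne₁ : e₁ ≠ e₁') (hne₂ : e₂ ≠ e₂')
    (ha : e₁ ≠ e₂) (hb : ¬ (e₁ = e₂' ∧ e₁' = e₂)) :
    isingE T lam (fun x => Real.exp (arcStep lam (spinProd x e₁) (spinProd x e₁') +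
      arcStep lam (spinProd x e₂) (spinProd x e₂'))) ≤
      1 - (1 + Real.tanh lam) * crossRate (Real.tanh lam) := by
  by_cases hd : e₁' = e₂'
  · subst hd
    exact (isingE_arcs_same_end hT h₁ h₂ h₁' ha hne₁ hne₂).le
  by_cases hc : e₁' = e₂
  · subst hc
    exact isingE_arcs_chain_le hT h0 h1 h₁ h₁' h₂' hne₁ (fun h => hb ⟨h, rfl⟩) hd
  by_cases hb' : e₁ = e₂'
  · subst hb'
    have := isingE_arcs_chain_le hT h0 h1 h₂ h₁ h₁' hne₂ (Ne.symm hc) hne₁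
    simpa only [add_comm] using this
  exact isingE_arcs_disjoint_le hT h0 h1 h₁ h₁' h₂ h₂' hne₁ hne₂ ha hb' hc hd

/-- With g = `confGap ρ`, the increment is -g s_e' or -(2 - g) s_e', according to the sign of `e`.
-/
theorem isingE_conf (hT : T.IsTree) {e e' : Sym2 V} (he : e ∈ T.edgeSet) (he' : e' ∈ T.edgeSet)
    (hne : e ≠ e') (t : ℝ) :
    isingE T lam (fun x => Real.exp (t * (spinProd x e' *
      ((1 - confGap (Real.tanh lam)) * spinProd x e - 1)))) = confMgf (Real.tanh lam) t := by
  rw [isingE_edge_edge hT he he' hne (fun a b => Real.exp (t * (b *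
      ((1 - confGap (Real.tanh lam)) * a - 1)))), confMgf]
  simp only [Real.cosh_eq, Real.sinh_eq]
  ring_nf

end GlobalMgf

end ActiveLathe

namespace ActiveLathe

/-! ### Sequences of events of bounded probability -/

section BoundedBy

variable {Ω : Type*} [MeasurableSpace Ω] {μ : Measure Ω} {A B : ℕ → Set Ω} {b : ℕ → ℝ}

/-- The probabilities of the events `A n` are at most a constant times `b n`. -/
def BoundedBy (μ : Measure Ω) (A : ℕ → Set Ω) (b : ℕ → ℝ) : Prop :=
  ∃ C, 0 ≤ C ∧ ∀ n, μ (A n) ≤ ENNReal.ofReal (C * b n)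

theorem BoundedBy.mono (h : BoundedBy μ B b) (hAB : ∀ n, A n ⊆ B n) : BoundedBy μ A b := by
  obtain ⟨C, hC, h⟩ := h
  exact ⟨C, hC, fun n => (measure_mono (hAB n)).trans (h n)⟩

theorem BoundedBy.exists {ι : Type*} [Finite ι] {B : ι → ℕ → Set Ω} (hb : ∀ n, 0 ≤ b n)
    (hB : ∀ i, BoundedBy μ (B i) b) : BoundedBy μ (fun n => {ω | ∃ i, ω ∈ B i n}) b := by
  have := Fintype.ofFinite ι
  choose C hC h using hB
  refine ⟨∑ i, C i, Finset.sum_nonneg fun i _ => hC i, fun n => ?_⟩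
  rw [Finset.sum_mul, ENNReal.ofReal_sum_of_nonneg fun i _ => mul_nonneg (hC i) (hb n)]
  have : {ω | ∃ i, ω ∈ B i n} = ⋃ i, B i n := by
    ext ω
    simp
  beta_reduce
  rw [this]
  exact (measure_iUnion_fintype_le μ _).trans (Finset.sum_le_sum fun i _ => h i n)

theorem BoundedBy.or (hb : ∀ n, 0 ≤ b n) (hA : BoundedBy μ A b) (hB : BoundedBy μ B b) :
    BoundedBy μ (fun n => {ω | ω ∈ A n ∨ ω ∈ B n}) b := by
  refine (BoundedBy.exists (ι := Bool) (B := fun i => bif i then A else B) hb ?_).mono ?_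
  · rintro (_ | _)
    · exact hB
    · exact hA
  · rintro n ω (h | h)
    · exact ⟨true, h⟩
    · exact ⟨false, h⟩

theorem BoundedBy.const_and {P : Prop} (h : P → BoundedBy μ A b) :
    BoundedBy μ (fun n => {ω | P ∧ ω ∈ A n}) b := by
  by_cases hP : P
  · exact (h hP).mono fun n ω hω => hω.2
  · refine ⟨0, le_rfl, fun n => ?_⟩
    simp [hP]

/-- The slack 2 absorbs up to two roundings of sample sizes, at the price of a constant. -/
theorem BoundedBy.of_pow {M κ β κ' : ℝ} {N : ℕ → ℕ} (hμ : ∀ n, μ (A n) ≤ ENNReal.ofReal (M ^ N n))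
    (hM0 : 0 ≤ M) (hM : M ≤ Real.exp (-κ)) (hκ : 0 ≤ κ) (hN : ∀ n : ℕ, β * n - 2 ≤ N n)
    (hκ' : κ' ≤ κ * β) : BoundedBy μ A (fun n => Real.exp (-(κ' * n))) := by
  refine ⟨Real.exp (κ * 2), (Real.exp_pos _).le, fun n => (hμ n).trans
    (ENNReal.ofReal_le_ofReal ((pow_le_pow_left₀ hM0 hM _).trans ?_))⟩
  rw [← Real.exp_nat_mul, ← Real.exp_add, Real.exp_le_exp]
  have h1 := mul_le_mul_of_nonneg_left (hN n) hκ
  have h2 := mul_le_mul_of_nonneg_right hκ' (Nat.cast_nonneg (α := ℝ) n)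
  linarith

theorem BoundedBy.le_exponent {κ : ℝ} (h : BoundedBy μ A (fun n => Real.exp (-(κ * n)))) :
    (κ : EReal) ≤ exponent μ A := by
  obtain ⟨C, hC, h⟩ := h
  refine ActiveLathe.le_exponent (C := C + 1) (by linarith) fun n => (h n).trans
    (ENNReal.ofReal_le_ofReal (mul_le_mul_of_nonneg_right (by linarith) (Real.exp_pos _).le))

end BoundedBy

/-! ### The error events of the global phase -/

section Global

variable {p : ℕ} {T : SimpleGraph (Fin p)} {lam ρ : ℝ} {Ω : Type*} [MeasurableSpace Ω]
  {μ : Measure Ω} [IsProbabilityMeasure μ] {X : ℕ → Ω → Fin p → ℤˣ}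

theorem globalRate_pos (h0 : 0 < ρ) (h1 : ρ < 1) : 0 ≤ 1 - globalGain ρ * crossRate ρ := by
  have h2 := crossRate_lt_half h0
  have h3 := globalGain_le h0
  have h4 := crossRate_pos h0 h1
  nlinarith

theorem measure_long_le (hT : T.IsTree) (hlam : ρ = Real.tanh lam) (h0 : 0 < ρ) (h1 : ρ < 1)
    (hlaw : ∀ l, HasLaw (X l) (isingPMF T lam).toMeasure μ) (hindep : iIndepFun X μ)
    {u v a b : Fin p} (huv : u ≠ v) (hadj : ¬ T.Adj u v) (hmid : ¬ ∃ j, T.Adj u j ∧ T.Adj j v)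
    (hab : T.Adj a b) (hcut : Cuts T s(a, b) u v) (N : ℕ) :
    μ {ω | empCorr (fun l => X l ω) N s(a, b) ≤ empCorr (fun l => X l ω) N s(u, v)} ≤
      ENNReal.ofReal ((1 - globalGain ρ * crossRate ρ) ^ N) := by
  obtain ⟨e₁, he₁, e₂, he₂, hne₁, hne₂, hne, hcut₁, hcut₂⟩ :=
    ((adj_or_exists_cuts hT huv).resolve_left hadj).resolve_left hmid s(a, b)
  subst hlam
  refine le_trans (measure_mono fun ω hω => ?_) (measure_sum_nonneg_le_pow hlaw hindep N
    (fun x => lam / 2 * (spinProd x s(u, v) - spinProd x s(a, b)))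
    ((isingE_long_le hT h0 hab he₁ he₂ hne₁ hne₂ hne hcut hcut₁ hcut₂).trans (long_rate_le h0 h1)))
  have hl := pos_of_tanh_pos h0
  simp only [Set.mem_ofPred_eq] at hω ⊢
  rw [← Finset.mul_sum, Finset.sum_sub_distrib, sum_spinProd (fun l => X l ω),
    sum_spinProd (fun l => X l ω), ← mul_sub]
  have := sub_nonneg.2 hω
  positivity

theorem measure_nonpos_le (hT : T.IsTree) (hlam : ρ = Real.tanh lam) (h0 : 0 < ρ) (h1 : ρ < 1)
    (hlaw : ∀ l, HasLaw (X l) (isingPMF T lam).toMeasure μ) (hindep : iIndepFun X μ)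
    {a b : Fin p} (hab : T.Adj a b) (N : ℕ) :
    μ {ω | empCorr (fun l => X l ω) N s(a, b) ≤ 0} ≤
      ENNReal.ofReal ((1 - globalGain ρ * crossRate ρ) ^ N) := by
  subst hlam
  refine le_trans (measure_mono fun ω hω => ?_) (measure_sum_nonneg_le_pow hlaw hindep N
    (fun x => -(lam * spinProd x s(a, b)))
    ((isingE_nonpos_edge_le hT h0 h1 hab).trans (long_rate_le h0 h1)))
  have hl := pos_of_tanh_pos h0
  simp only [Set.mem_ofPred_eq] at hω ⊢
  rw [Finset.sum_neg_distrib, ← Finset.mul_sum, sum_spinProd (fun l => X l ω)]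
  have : 0 ≤ -empCorr (fun l => X l ω) N s(a, b) := by linarith
  have : 0 ≤ lam * (N * -empCorr (fun l => X l ω) N s(a, b)) := by positivity
  linarith

theorem measure_conf_le (hT : T.IsTree) (hlam : ρ = Real.tanh lam) (h0 : 0 < ρ) (h1 : ρ < 1)
    (hlaw : ∀ l, HasLaw (X l) (isingPMF T lam).toMeasure μ) (hindep : iIndepFun X μ)
    {i j k : Fin p} (hij : T.Adj i j) (hjk : T.Adj j k) (hik : i ≠ k) (N : ℕ) :
    μ {ω | empCorr (fun l => X l ω) N s(j, k) ≤
        (1 - confGap ρ) * empCorr (fun l => X l ω) N s(i, k)} ≤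
      ENNReal.ofReal ((1 - globalGain ρ * crossRate ρ) ^ N) := by
  subst hlam
  obtain ⟨t, ht, hle⟩ := exists_confMgf_le_globalGain (lam := lam) rfl h0 h1
  have hne : s(i, j) ≠ s(j, k) := by simp [hik, hij.ne]
  rw [← isingE_conf hT hij hjk hne] at hle
  refine le_trans (measure_mono fun ω hω => ?_) (measure_sum_nonneg_le_pow hlaw hindep N _ hle)
  simp only [Set.mem_ofPred_eq] at hω ⊢
  have hx : ∀ x : Fin p → ℤˣ, spinProd x s(j, k) *
      ((1 - confGap (Real.tanh lam)) * spinProd x s(i, j) - 1) =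
      (1 - confGap (Real.tanh lam)) * spinProd x s(i, k) - spinProd x s(j, k) := by
    intro x
    rw [← spinProd_mul_spinProd x i j k]
    ring
  simp only [hx]
  rw [← Finset.mul_sum, Finset.sum_sub_distrib, ← Finset.mul_sum, sum_spinProd (fun l => X l ω),
    sum_spinProd (fun l => X l ω)]
  have h2 := mul_nonneg (Nat.cast_nonneg (α := ℝ) N) (sub_nonneg.2 hω)
  refine mul_nonneg ht ?_
  linarith

theorem measure_arcs_le (hT : T.IsTree) (hlam : ρ = Real.tanh lam) (h0 : 0 < ρ) (h1 : ρ < 1)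
    (hlaw : ∀ l, HasLaw (X l) (isingPMF T lam).toMeasure μ) (hindep : iIndepFun X μ)
    {i j k i' j' k' : Fin p} (hij : T.Adj i j) (hjk : T.Adj j k) (hik : i ≠ k)
    (hij' : T.Adj i' j') (hjk' : T.Adj j' k') (hik' : i' ≠ k')
    (hne : ¬ (s(i, j) = s(i', j') ∨ (s(i, j) = s(j', k') ∧ s(j, k) = s(i', j')))) (N : ℕ) :
    μ {ω | empCorr (fun l => X l ω) N s(j, k) ≤ empCorr (fun l => X l ω) N s(i, k) ∧
        empCorr (fun l => X l ω) N s(j', k') ≤ empCorr (fun l => X l ω) N s(i', k')} ≤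
      ENNReal.ofReal ((1 - globalGain ρ * crossRate ρ) ^ N) := by
  subst hlam
  rw [not_or] at hne
  have hne₁ : s(i, j) ≠ s(j, k) := by simp [hik, hij.ne]
  have hne₂ : s(i', j') ≠ s(j', k') := by simp [hik', hij'.ne]
  refine le_trans (measure_mono fun ω hω => ?_) (measure_sum_nonneg_le_pow hlaw hindep N _
    ((isingE_arcs_le (lam := lam) hT h0 h1 hij hjk hij' hjk' hne₁ hne₂ hne.1 hne.2).trans
      (long_rate_le h0 h1)))
  have hl := pos_of_tanh_pos h0
  simp only [Set.mem_ofPred_eq] at hω ⊢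
  simp only [arcStep, ← spinProd_path]
  rw [Finset.sum_add_distrib, ← Finset.mul_sum, ← Finset.mul_sum, Finset.sum_sub_distrib,
    Finset.sum_sub_distrib, sum_spinProd (fun l => X l ω), sum_spinProd (fun l => X l ω),
    sum_spinProd (fun l => X l ω), sum_spinProd (fun l => X l ω), ← mul_sub, ← mul_sub]
  have h2 := sub_nonneg.2 hω.1
  have h3 := sub_nonneg.2 hω.2
  positivity

theorem sub_two_le_floor {α : ℝ} (n : ℕ) : α * n - 2 ≤ (⌊α * n⌋₊ : ℝ) := by
  linarith [Nat.sub_one_lt_floor (α * n)]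

/-- The weights are regular, unless the correlation is badly estimated. -/
theorem boundedBy_not_regular (hT : T.IsTree) (hlam : ρ = Real.tanh lam) (h0 : 0 < ρ) (h1 : ρ < 1)
    (hlaw : ∀ l, HasLaw (X l) (isingPMF T lam).toMeasure μ) (hindep : iIndepFun X μ)
    (R : MaxTreeRule (Fin p)) {α c : ℝ} (hc : c ≤ α * globalGain ρ) :
    BoundedBy μ (fun n => {ω | |rhoHat R (fun l => X l ω) ⌊α * n⌋₊ - ρ| ≤ ρ * (1 - ρ) / 6 ∧
      ¬ Regular T (empCorr (fun l => X l ω) ⌊α * n⌋₊)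
        (confFactor R (fun l => X l ω) ⌊α * n⌋₊)})
      (fun n => Real.exp (-(c * kPassive ρ * n))) := by
  have hb : ∀ n : ℕ, 0 ≤ Real.exp (-(c * kPassive ρ * n)) := fun n => (Real.exp_pos _).le
  have hpow : ∀ A : ℕ → Set Ω, (∀ n, μ (A n) ≤
      ENNReal.ofReal ((1 - globalGain ρ * crossRate ρ) ^ ⌊α * n⌋₊)) →
      BoundedBy μ A (fun n => Real.exp (-(c * kPassive ρ * n))) := by
    intro A hA
    refine BoundedBy.of_pow hA (globalRate_pos h0 h1)
      (one_sub_crossRate_mul_le h0 h1 (one_le_globalGain h0))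
      (mul_nonneg (by linarith [one_le_globalGain h0]) (kPassive_pos h0 h1).le)
      sub_two_le_floor ?_
    have := mul_le_mul_of_nonneg_right hc (kPassive_pos h0 h1).le
    linarith
  have long : BoundedBy μ (fun n => {ω | ∃ q : Fin p × Fin p × Fin p × Fin p,
      ω ∈ {ω | (q.1 ≠ q.2.1 ∧ ¬ T.Adj q.1 q.2.1 ∧ (¬ ∃ j, T.Adj q.1 j ∧ T.Adj j q.2.1) ∧
        T.Adj q.2.2.1 q.2.2.2 ∧ Cuts T s(q.2.2.1, q.2.2.2) q.1 q.2.1) ∧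
        ω ∈ {ω | empCorr (fun l => X l ω) ⌊α * n⌋₊ s(q.2.2.1, q.2.2.2) ≤
          empCorr (fun l => X l ω) ⌊α * n⌋₊ s(q.1, q.2.1)}}})
      (fun n => Real.exp (-(c * kPassive ρ * n))) :=
    BoundedBy.exists hb fun q => BoundedBy.const_and fun hq => hpow _ fun n =>
      measure_long_le hT hlam h0 h1 hlaw hindep hq.1 hq.2.1 hq.2.2.1 hq.2.2.2.1 hq.2.2.2.2 _
  have pos : BoundedBy μ (fun n => {ω | ∃ q : Fin p × Fin p,
      ω ∈ {ω | T.Adj q.1 q.2 ∧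
        ω ∈ {ω | empCorr (fun l => X l ω) ⌊α * n⌋₊ s(q.1, q.2) ≤ 0}}})
      (fun n => Real.exp (-(c * kPassive ρ * n))) :=
    BoundedBy.exists hb fun q => BoundedBy.const_and fun hq => hpow _ fun n =>
      measure_nonpos_le hT hlam h0 h1 hlaw hindep hq _
  have conf : BoundedBy μ (fun n => {ω | ∃ q : Fin p × Fin p × Fin p,
      ω ∈ {ω | (T.Adj q.1 q.2.1 ∧ T.Adj q.2.1 q.2.2 ∧ q.1 ≠ q.2.2) ∧
        ω ∈ {ω | empCorr (fun l => X l ω) ⌊α * n⌋₊ s(q.2.1, q.2.2) ≤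
          (1 - confGap ρ) * empCorr (fun l => X l ω) ⌊α * n⌋₊ s(q.1, q.2.2)}}})
      (fun n => Real.exp (-(c * kPassive ρ * n))) :=
    BoundedBy.exists hb fun q => BoundedBy.const_and fun hq => hpow _ fun n =>
      measure_conf_le hT hlam h0 h1 hlaw hindep hq.1 hq.2.1 hq.2.2 _
  have arcs : BoundedBy μ (fun n => {ω | ∃ q : (Fin p × Fin p × Fin p) × Fin p × Fin p × Fin p,
      ω ∈ {ω | (T.Adj q.1.1 q.1.2.1 ∧ T.Adj q.1.2.1 q.1.2.2 ∧ q.1.1 ≠ q.1.2.2 ∧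
        T.Adj q.2.1 q.2.2.1 ∧ T.Adj q.2.2.1 q.2.2.2 ∧ q.2.1 ≠ q.2.2.2 ∧
        ¬ (s(q.1.1, q.1.2.1) = s(q.2.1, q.2.2.1) ∨ (s(q.1.1, q.1.2.1) = s(q.2.2.1, q.2.2.2) ∧
          s(q.1.2.1, q.1.2.2) = s(q.2.1, q.2.2.1)))) ∧
        ω ∈ {ω | empCorr (fun l => X l ω) ⌊α * n⌋₊ s(q.1.2.1, q.1.2.2) ≤
          empCorr (fun l => X l ω) ⌊α * n⌋₊ s(q.1.1, q.1.2.2) ∧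
          empCorr (fun l => X l ω) ⌊α * n⌋₊ s(q.2.2.1, q.2.2.2) ≤
          empCorr (fun l => X l ω) ⌊α * n⌋₊ s(q.2.1, q.2.2.2)}}})
      (fun n => Real.exp (-(c * kPassive ρ * n))) :=
    BoundedBy.exists hb fun q => BoundedBy.const_and fun hq => hpow _ fun n =>
      measure_arcs_le hT hlam h0 h1 hlaw hindep hq.1 hq.2.1 hq.2.2.1 hq.2.2.2.1 hq.2.2.2.2.1
        hq.2.2.2.2.2.1 hq.2.2.2.2.2.2 _
  refine ((long.or hb pos).or hb (conf.or hb arcs)).mono ?_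
  rintro n ω ⟨hrho, hreg⟩
  by_contra hno
  simp only [Set.mem_ofPred_eq, not_or, not_exists, Prod.forall] at hno
  obtain ⟨⟨n1, n2⟩, n3, n4⟩ := hno
  have hpos : ∀ ⦃i j : Fin p⦄, T.Adj i j → 0 < empCorr (fun l => X l ω) ⌊α * n⌋₊ s(i, j) :=
    fun i j hij => by
      by_contra hle
      exact n2 i j ⟨hij, not_lt.1 hle⟩
  refine hreg ⟨?_, hpos, ?_, ?_⟩
  · intro u v huv hadj hmid a b hab hcut
    by_contra hle
    exact n1 u v a b ⟨⟨huv, hadj, fun j h => hmid ⟨j, h⟩, hab, hcut⟩, not_lt.1 hle⟩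
  · intro i j k hij hjk hik
    by_contra hle
    refine n3 i j k ⟨⟨hij, hjk, hik⟩, ?_⟩
    rw [not_lt] at hle
    rw [abs_le] at hrho
    have hf0 : 0 ≤ confFactor R (fun l => X l ω) ⌊α * n⌋₊ := by
      rw [confFactor]
      nlinarith [hrho.1]
    -- `confGap` is made for this: (11 + 9(ρ + ρ(1-ρ)/6))/20 equals `1 - confGap ρ`.
    have hf1 : confFactor R (fun l => X l ω) ⌊α * n⌋₊ ≤ 1 - confGap ρ := by
      rw [confFactor, confGap]
      nlinarith [hrho.2]
    have hw : 0 ≤ empCorr (fun l => X l ω) ⌊α * n⌋₊ s(i, k) := by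
      have h2 := hpos hjk
      by_contra hneg
      have := mul_nonpos_of_nonneg_of_nonpos hf0 (not_le.1 hneg).le
      linarith
    exact hle.trans (mul_le_mul_of_nonneg_right hf1 hw)
  · intro i j k i' j' k' ha ha'
    by_contra hne
    exact n4 i j k i' j' k' ⟨⟨ha.1, ha.2.1, ha.2.2.1, ha'.1, ha'.2.1, ha'.2.2.1, not_or.1 hne⟩,
      ha.2.2.2, ha'.2.2.2⟩

end Global

end ActiveLathe

namespace ActiveLathe

/-! ### Concentration of the estimated correlation -/

section Concentration

variable {p : ℕ} {T : SimpleGraph (Fin p)} {lam ρ : ℝ} {Ω : Type*} [MeasurableSpace Ω]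
  {μ : Measure Ω} [IsProbabilityMeasure μ] {X : ℕ → Ω → Fin p → ℤˣ}

theorem sum_graphWeight (x : ℕ → Fin p → ℤˣ) (m : ℕ) (H : SimpleGraph (Fin p)) :
    ∑ l ∈ Finset.range m, graphWeight (spinProd (x l)) H = m * graphWeight (empCorr x m) H := by
  classical
  simp only [graphWeight_eq_sum]
  rw [Finset.sum_comm, Finset.mul_sum]
  exact Finset.sum_congr rfl fun e _ => sum_spinProd x m e

/-- The tree `T'` is arbitrary because its moment generating function is dominated by that of `T`.
At the tilt ρ/12 each edge contributes ρ²(1-ρ)(1/72 - 1/144). -/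
theorem measure_upper_tail_le (hT : T.IsTree) (hlam : ρ = Real.tanh lam) (h0 : 0 < ρ) (h1 : ρ < 1)
    (hlaw : ∀ l, HasLaw (X l) (isingPMF T lam).toMeasure μ) (hindep : iIndepFun X μ)
    {T' : SimpleGraph (Fin p)} (hT' : T'.IsTree) (hp : 1 ≤ p) (N : ℕ) :
    μ {ω | ((p : ℝ) - 1) * (ρ + ρ * (1 - ρ) / 6) ≤ graphWeight (empCorr (fun l => X l ω) N) T'} ≤
      ENNReal.ofReal (Real.exp (-(((p : ℝ) - 1) * (ρ ^ 2 * (1 - ρ) / 156))) ^ N) := by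
  have hcast : ((p - 1 : ℕ) : ℝ) = (p : ℝ) - 1 := by rw [Nat.cast_sub hp, Nat.cast_one]
  refine le_trans (measure_mono fun ω hω => ?_) (measure_sum_nonneg_le_pow hlaw hindep N
    (fun x => ρ / 12 * graphWeight (spinProd x) T' +
      -(ρ / 12 * (((p : ℝ) - 1) * (ρ + ρ * (1 - ρ) / 6)))) ?_)
  · simp only [Set.mem_ofPred_eq] at hω ⊢
    rw [Finset.sum_add_distrib, ← Finset.mul_sum, sum_graphWeight (fun l => X l ω),
      Finset.sum_const, Finset.card_range, nsmul_eq_mul]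
    have : 0 ≤ ρ / 12 * (N * (graphWeight (empCorr (fun l => X l ω) N) T' -
      ((p : ℝ) - 1) * (ρ + ρ * (1 - ρ) / 6))) :=
      mul_nonneg (by linarith) (mul_nonneg (Nat.cast_nonneg N) (by linarith))
    linarith
  · have hfun : (fun x : Fin p → ℤˣ => Real.exp (ρ / 12 * graphWeight (spinProd x) T' +
        -(ρ / 12 * (((p : ℝ) - 1) * (ρ + ρ * (1 - ρ) / 6))))) = fun x =>
        Real.exp (-(ρ / 12 * (((p : ℝ) - 1) * (ρ + ρ * (1 - ρ) / 6)))) *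
          Real.exp (ρ / 12 * graphWeight (spinProd x) T') := by
      funext x
      rw [Real.exp_add, mul_comm]
    have h2 := isingE_exp_graphWeight_le hT hT' (lam := lam)
      (pos_of_tanh_pos (by rw [← hlam]; exact h0)) (t := ρ / 12) (by linarith)
    rw [← hlam, Fintype.card_fin] at h2
    have h3 : 0 ≤ Real.cosh (ρ / 12) + ρ * Real.sinh (ρ / 12) :=
      add_nonneg (Real.cosh_pos _).le (mul_nonneg h0.le (Real.sinh_nonneg_iff.2 (by linarith)))
    have h4 := pow_le_pow_left₀ h3 (cosh_add_mul_sinh_le h1.le (t := ρ / 12) (by linarith)) (p - 1)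
    rw [hfun, isingE_const_mul]
    refine (mul_le_mul_of_nonneg_left (h2.trans h4) (Real.exp_pos _).le).trans ?_
    rw [← Real.exp_nat_mul, ← Real.exp_add, Real.exp_le_exp, hcast]
    have h5 : 0 ≤ ((p : ℝ) - 1) * (ρ ^ 2 * (1 - ρ)) :=
      mul_nonneg (by rw [← hcast]; positivity) (mul_nonneg (sq_nonneg _) (by linarith))
    linarith

/-- Here each edge contributes ρ²(1-ρ)(1/72 - 43/5760), just above ρ²(1-ρ)/156. -/
theorem measure_lower_tail_le (hT : T.IsTree) (hlam : ρ = Real.tanh lam) (h0 : 0 < ρ) (h1 : ρ < 1)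
    (hlaw : ∀ l, HasLaw (X l) (isingPMF T lam).toMeasure μ) (hindep : iIndepFun X μ)
    (hp : 1 ≤ p) (N : ℕ) :
    μ {ω | graphWeight (empCorr (fun l => X l ω) N) T ≤ ((p : ℝ) - 1) * (ρ - ρ * (1 - ρ) / 6)} ≤
      ENNReal.ofReal (Real.exp (-(((p : ℝ) - 1) * (ρ ^ 2 * (1 - ρ) / 156))) ^ N) := by
  have hcast : ((p - 1 : ℕ) : ℝ) = (p : ℝ) - 1 := by rw [Nat.cast_sub hp, Nat.cast_one]
  refine le_trans (measure_mono fun ω hω => ?_) (measure_sum_nonneg_le_pow hlaw hindep N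
    (fun x => -(ρ / 12) * graphWeight (spinProd x) T +
      ρ / 12 * (((p : ℝ) - 1) * (ρ - ρ * (1 - ρ) / 6))) ?_)
  · simp only [Set.mem_ofPred_eq] at hω ⊢
    rw [Finset.sum_add_distrib, ← Finset.mul_sum, sum_graphWeight (fun l => X l ω),
      Finset.sum_const, Finset.card_range, nsmul_eq_mul]
    have : 0 ≤ ρ / 12 * (N * (((p : ℝ) - 1) * (ρ - ρ * (1 - ρ) / 6) -
      graphWeight (empCorr (fun l => X l ω) N) T)) :=
      mul_nonneg (by linarith) (mul_nonneg (Nat.cast_nonneg N) (by linarith))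
    linarith
  · have hfun : (fun x : Fin p → ℤˣ => Real.exp (-(ρ / 12) * graphWeight (spinProd x) T +
        ρ / 12 * (((p : ℝ) - 1) * (ρ - ρ * (1 - ρ) / 6)))) = fun x =>
        Real.exp (ρ / 12 * (((p : ℝ) - 1) * (ρ - ρ * (1 - ρ) / 6))) *
          Real.exp (-(ρ / 12) * graphWeight (spinProd x) T) := by
      funext x
      rw [Real.exp_add, mul_comm]
    rw [hfun, isingE_const_mul, isingE_exp_graphWeight hT, ← hlam, Fintype.card_fin,
      Real.cosh_neg, Real.sinh_neg, mul_neg, ← sub_eq_add_neg]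
    have h3 : 0 ≤ Real.cosh (ρ / 12) - ρ * Real.sinh (ρ / 12) := by
      rw [hlam, cosh_sub_tanh_mul_sinh]
      exact div_nonneg (Real.cosh_pos _).le (Real.cosh_pos _).le
    have h4 := pow_le_pow_left₀ h3 (cosh_sub_mul_sinh_le h1.le (t := ρ / 12) (by linarith)
      (by linarith)) (p - 1)
    refine (mul_le_mul_of_nonneg_left h4 (Real.exp_pos _).le).trans ?_
    rw [← Real.exp_nat_mul, ← Real.exp_add, Real.exp_le_exp, hcast]
    have h5 : 0 ≤ ((p : ℝ) - 1) * (ρ ^ 2 * (1 - ρ)) :=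
      mul_nonneg (by rw [← hcast]; positivity) (mul_nonneg (sq_nonneg _) (by linarith))
    linarith

/-- The correlation is estimated well. -/
theorem boundedBy_rhoHat (hT : T.IsTree) (hlam : ρ = Real.tanh lam) (h0 : 0 < ρ) (h1 : ρ < 1)
    (hlaw : ∀ l, HasLaw (X l) (isingPMF T lam).toMeasure μ) (hindep : iIndepFun X μ)
    (hp : 164 ≤ p) (R : MaxTreeRule (Fin p)) {α c : ℝ} (hα : 4 / 5 ≤ α) (hc : c ≤ 7 / 5) :
    BoundedBy μ (fun n => {ω | ¬ |rhoHat R (fun l => X l ω) ⌊α * n⌋₊ - ρ| ≤ ρ * (1 - ρ) / 6})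
      (fun n => Real.exp (-(c * kPassive ρ * n))) := by
  have hb : ∀ n : ℕ, 0 ≤ Real.exp (-(c * kPassive ρ * n)) := fun n => (Real.exp_pos _).le
  have hpR : (164 : ℝ) ≤ p := by exact_mod_cast hp
  have hq : 0 < ρ ^ 2 * (1 - ρ) := mul_pos (by positivity) (by linarith)
  have hpow : ∀ A : ℕ → Set Ω, (∀ n, μ (A n) ≤ ENNReal.ofReal
      (Real.exp (-(((p : ℝ) - 1) * (ρ ^ 2 * (1 - ρ) / 156))) ^ ⌊α * n⌋₊)) →
      BoundedBy μ A (fun n => Real.exp (-(c * kPassive ρ * n))) := by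
    intro A hA
    refine BoundedBy.of_pow hA (Real.exp_pos _).le le_rfl
      (mul_nonneg (by linarith) (by linarith)) sub_two_le_floor ?_
    have h2 : c * kPassive ρ ≤ 7 / 5 * kPassive ρ :=
      mul_le_mul_of_nonneg_right hc (kPassive_pos h0 h1).le
    have h3 := kPassive_le h0 h1
    -- With p - 1 ≥ 163 edges, 163·4/(5·156) exceeds 7/5·27/50, the bound on 7/5 K in units of
    -- ρ²(1-ρ).
    have h4 : 163 * (ρ ^ 2 * (1 - ρ) / 156) * (4 / 5) ≤
        ((p : ℝ) - 1) * (ρ ^ 2 * (1 - ρ) / 156) * α := by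
      refine mul_le_mul (mul_le_mul_of_nonneg_right (by linarith) (by linarith)) hα (by norm_num)
        (mul_nonneg (by linarith) (by linarith))
    linarith
  have upper : BoundedBy μ (fun n => {ω | ∃ T' : SimpleGraph (Fin p), ω ∈ {ω | T'.IsTree ∧
      ω ∈ {ω | ((p : ℝ) - 1) * (ρ + ρ * (1 - ρ) / 6) ≤
        graphWeight (empCorr (fun l => X l ω) ⌊α * n⌋₊) T'}}})
      (fun n => Real.exp (-(c * kPassive ρ * n))) :=
    BoundedBy.exists hb fun T' => BoundedBy.const_and fun hT' => hpow _ fun n =>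
      measure_upper_tail_le hT hlam h0 h1 hlaw hindep hT' (by omega) _
  have lower := hpow _ fun n =>
    measure_lower_tail_le hT hlam h0 h1 hlaw hindep (by omega) ⌊α * n⌋₊
  -- Too large an estimate is attained by some tree, hence the union over all trees. Too small an
  -- estimate makes `T` itself light, since the selected tree is at least as heavy.
  refine (upper.or hb lower).mono ?_
  intro n ω hω
  have := hT.connected.nonempty
  simp only [Set.mem_ofPred_eq, abs_le, not_and_or, not_le] at hω ⊢
  rcases hω with hω | hω
  · right
    have hmax := (isMaxTreeOn_sclTree R (fun l => X l ω) ⌊α * n⌋₊).2 T (isTreeOn_univ_iff.2 hT)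
    rw [rhoHat, Fintype.card_fin] at hω
    have h2 : graphWeight (empCorr (fun l => X l ω) ⌊α * n⌋₊) (sclTree R (fun l => X l ω) ⌊α * n⌋₊) /
      ((p : ℝ) - 1) ≤ ρ - ρ * (1 - ρ) / 6 := by linarith
    rw [div_le_iff₀ (by linarith)] at h2
    linarith
  · left
    refine ⟨_, isTree_sclTree R (fun l => X l ω) ⌊α * n⌋₊, ?_⟩
    rw [rhoHat, Fintype.card_fin] at hω
    have h2 : ρ + ρ * (1 - ρ) / 6 ≤ graphWeight (empCorr (fun l => X l ω) ⌊α * n⌋₊)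
      (sclTree R (fun l => X l ω) ⌊α * n⌋₊) / ((p : ℝ) - 1) := by linarith
    rw [le_div_iff₀ (by linarith)] at h2
    linarith

end Concentration

end ActiveLathe

namespace ActiveLathe

/-! ### Disjoint weak paths -/

section Weak

variable {V : Type*} {T : SimpleGraph V}

/-- The increment of a weak path. -/
noncomputable def weakStep (ρ y z : ℝ) : ℝ := 2 / 5 * ρ * (y - (1 - 21 / 40 * (1 - ρ)) * z)

/-- A family of paths `a - b - c`, each possibly prolonged by the edge `e₀ = cd`, which have no edge
in common, neither with each other nor with `e₀` and the path `i - j - k`. -/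
structure DisjointPaths {ι : Type*} (T : SimpleGraph V) (i j k : V) (e₀ : Sym2 V)
    (q : ι → V × V × V × V) : Prop where
  mem : e₀ ∈ T.edgeSet
  left : ∀ s, T.Adj (q s).1 (q s).2.1
  right : ∀ s, T.Adj (q s).2.1 (q s).2.2.1
  ne : ∀ s, (q s).1 ≠ (q s).2.2.1
  last : ∀ s, (q s).2.2.2 = (q s).2.2.1 ∨ s((q s).2.2.1, (q s).2.2.2) = e₀
  left_ne : ∀ s, s((q s).1, (q s).2.1) ≠ e₀
  right_ne : ∀ s, s((q s).2.1, (q s).2.2.1) ≠ e₀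
  disjoint : ∀ s, EdgeDisjoint (q s).1 (q s).2.1 (q s).2.2.1 i j k
  pairwise : ∀ s s', s ≠ s' → EdgeDisjoint (q s).1 (q s).2.1 (q s).2.2.1
    (q s').1 (q s').2.1 (q s').2.2.1

/-- One of the two edges `ab`, `bc` of a path. -/
def pathEdge (q : V × V × V × V) (β : Bool) : Sym2 V :=
  bif β then s(q.1, q.2.1) else s(q.2.1, q.2.2.1)

variable {ι : Type*} {i j k : V} {e₀ : Sym2 V} {q : ι → V × V × V × V}

theorem DisjointPaths.pathEdge_mem (h : DisjointPaths T i j k e₀ q) (s : ι) (β : Bool) :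
    pathEdge (q s) β ∈ T.edgeSet := by
  cases β
  · exact h.right s
  · exact h.left s

theorem DisjointPaths.pathEdge_ne (h : DisjointPaths T i j k e₀ q) (s : ι) (β : Bool) :
    pathEdge (q s) β ≠ e₀ := by
  cases β
  · exact h.right_ne s
  · exact h.left_ne s

theorem DisjointPaths.pathEdge_ne_path (h : DisjointPaths T i j k e₀ q) (s : ι) (β : Bool) :
    s(i, j) ≠ pathEdge (q s) β ∧ s(j, k) ≠ pathEdge (q s) β := by
  obtain ⟨h1, h2, h3, h4⟩ := h.disjoint s
  cases β
  · exact ⟨h3.symm, h4.symm⟩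
  · exact ⟨h1.symm, h2.symm⟩

theorem DisjointPaths.pathEdge_ne_pathEdge (h : DisjointPaths T i j k e₀ q) {s s' : ι}
    (hne : s ≠ s') (β β' : Bool) : pathEdge (q s) β ≠ pathEdge (q s') β' := by
  obtain ⟨h1, h2, h3, h4⟩ := h.pairwise s s' hne
  cases β <;> cases β'
  · exact h4
  · exact h3
  · exact h2
  · exact h1

theorem spinProd_quad (x : V → ℤˣ) (q : V × V × V × V) (β : Bool) : spinProd x s(q.1, q.2.2.2) =
    spinProd x (pathEdge q β) * spinProd x (pathEdge q !β) * spinProd x s(q.2.2.1, q.2.2.2) := by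
  have h : spinProd x s(q.1, q.2.2.2) = spinProd x s(q.1, q.2.1) * spinProd x s(q.2.1, q.2.2.1) *
      spinProd x s(q.2.2.1, q.2.2.2) := by
    rw [spinProd_mul_spinProd, spinProd_mul_spinProd]
  cases β
  · rw [h]
    simp only [pathEdge, Bool.not_false, cond_true, cond_false]
    ring
  · exact h

variable [Fintype V] [DecidableEq V] {lam ρ : ℝ}

/-- This product is 1 or the sign of `e₀`. It is the one sign that the weak paths may share. -/
theorem DisjointPaths.last_flip (h : DisjointPaths T i j k e₀ q) (hT : T.IsTree) {e : Sym2 V}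
    (he : e ∈ T.edgeSet) (hne : e₀ ≠ e) (s : ι) (x : V → ℤˣ) :
    spinProd (flip T e x) s((q s).2.2.1, (q s).2.2.2) = spinProd x s((q s).2.2.1, (q s).2.2.2) := by
  rcases h.last s with h' | h'
  · rw [h', ← spinProd_mul_spinProd _ _ (q s).2.1, ← spinProd_mul_spinProd x _ (q s).2.1,
      Sym2.eq_swap, spinProd_mul_self, spinProd_mul_self]
  · rw [h']
    exact spinProd_flip_of_ne hT he h.mem hne x

/-- The paths are integrated out one at a time: the two edges of a path are free of all other
factors, and the shared sign plays the role of `η`. -/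
theorem DisjointPaths.isingE_le (h : DisjointPaths T i j k e₀ q) (hT : T.IsTree)
    (hlam : ρ = Real.tanh lam) (h0 : 0 < ρ) (h1 : ρ < 1) {A : (V → ℤˣ) → ℝ} (hA0 : ∀ x, 0 ≤ A x)
    (hA : ∀ s β x, A (flip T (pathEdge (q s) β) x) = A x) (β : ι → Bool) (S : Finset ι) :
    isingE T lam (fun x => A x * Real.exp (∑ s ∈ S, weakStep ρ
      (spinProd x s((q s).1, (q s).2.2.2)) (spinProd x (pathEdge (q s) (β s))))) ≤
      (1 - 27 / 800 * (ρ ^ 2 * (1 - ρ))) ^ S.card * isingE T lam A := by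
  classical
  have hM0 : 0 ≤ 1 - 27 / 800 * (ρ ^ 2 * (1 - ρ)) := by
    have : ρ ^ 2 ≤ 1 := by nlinarith
    nlinarith
  induction S using Finset.induction_on with
  | empty => simp
  | insert s S hs ih =>
    rw [Finset.card_insert_of_notMem hs, pow_succ', mul_assoc]
    refine le_trans ?_ (mul_le_mul_of_nonneg_left ih hM0)
    have hQ : ∀ b x, A (flip T (pathEdge (q s) b) x) * Real.exp (∑ s' ∈ S, weakStep ρ
        (spinProd (flip T (pathEdge (q s) b) x) s((q s').1, (q s').2.2.2))
        (spinProd (flip T (pathEdge (q s) b) x) (pathEdge (q s') (β s')))) =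
        A x * Real.exp (∑ s' ∈ S, weakStep ρ
        (spinProd x s((q s').1, (q s').2.2.2)) (spinProd x (pathEdge (q s') (β s')))) := by
      intro b x
      rw [hA]
      congr 2
      refine Finset.sum_congr rfl fun s' hs' => ?_
      have hne : s' ≠ s := by
        rintro rfl
        exact hs hs'
      have hmem := h.pathEdge_mem s b
      rw [spinProd_quad _ (q s') true, spinProd_quad x (q s') true,
        spinProd_flip_of_ne hT hmem (h.pathEdge_mem s' _) (h.pathEdge_ne_pathEdge hne _ _),
        spinProd_flip_of_ne hT hmem (h.pathEdge_mem s' _) (h.pathEdge_ne_pathEdge hne _ _),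
        spinProd_flip_of_ne hT hmem (h.pathEdge_mem s' _) (h.pathEdge_ne_pathEdge hne _ _),
        h.last_flip hT hmem (h.pathEdge_ne s b).symm]
    have hgh : pathEdge (q s) (β s) ≠ pathEdge (q s) !(β s) := by
      have h2 : s((q s).1, (q s).2.1) ≠ s((q s).2.1, (q s).2.2.1) := by
        simp [h.ne s, (h.left s).ne]
      cases β s
      · exact h2.symm
      · exact h2
    have key := isingE_mul_pair_le (lam := lam) hT (h.pathEdge_mem s (β s))
      (h.pathEdge_mem s !(β s)) hgh
      (Q := fun x => A x * Real.exp (∑ s' ∈ S, weakStep ρ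
        (spinProd x s((q s').1, (q s').2.2.2)) (spinProd x (pathEdge (q s') (β s')))))
      (fun x => mul_nonneg (hA0 x) (Real.exp_pos _).le) (hQ _) (hQ _)
      (η := fun x => spinProd x s((q s).2.2.1, (q s).2.2.2))
      (h.last_flip hT (h.pathEdge_mem s _) (h.pathEdge_ne s _).symm s)
      (h.last_flip hT (h.pathEdge_mem s _) (h.pathEdge_ne s _).symm s)
      (fun x => spinProd_eq_one_or x _)
      (fun y z η => Real.exp (2 / 5 * ρ * (y * (z * η - (1 - 21 / 40 * (1 - ρ))))))
      (M := 1 - 27 / 800 * (ρ ^ 2 * (1 - ρ)))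
      (fun η hη => by rw [← hlam]; exact weak_mgf_le h0 h1 hη)
    refine le_trans (le_of_eq ?_) key
    congr 1
    funext x
    rw [Finset.sum_insert hs, add_comm, Real.exp_add, ← mul_assoc]
    congr 2
    rw [weakStep, spinProd_quad x (q s) (β s)]
    ring

end Weak

/-! ### A crossover in the full sample joined with weak paths in the first part -/

section Local

variable {p : ℕ} {T : SimpleGraph (Fin p)} {lam ρ : ℝ} {Ω : Type*} [MeasurableSpace Ω]
  {μ : Measure Ω} [IsProbabilityMeasure μ] {X : ℕ → Ω → Fin p → ℤˣ}

theorem sum_range_ite {m N : ℕ} (hmN : m ≤ N) (f : ℕ → ℝ) :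
    ∑ l ∈ Finset.range N, (if l < m then f l else 0) = ∑ l ∈ Finset.range m, f l := by
  rw [← Finset.sum_filter]
  refine Finset.sum_congr ?_ fun _ _ => rfl
  ext l
  simp only [Finset.mem_filter, Finset.mem_range]
  omega

theorem prod_range_ite {m N : ℕ} (hmN : m ≤ N) (a b : ℝ) :
    ∏ l ∈ Finset.range N, (a * if l < m then b else 1) = a ^ N * b ^ m := by
  have hfilter : (Finset.range N).filter (· < m) = Finset.range m := by
    ext l
    simp only [Finset.mem_filter, Finset.mem_range]
    omega
  rw [Finset.prod_mul_distrib, Finset.prod_const, Finset.card_range, ← Finset.prod_filter,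
    hfilter, Finset.prod_const, Finset.card_range]

/-- A crossover based on `N` samples together with disjoint weak paths based on `m` samples. -/
theorem measure_cross_weak_le (hT : T.IsTree) (hlam : ρ = Real.tanh lam) (h0 : 0 < ρ) (h1 : ρ < 1)
    (hlaw : ∀ l, HasLaw (X l) (isingPMF T lam).toMeasure μ) (hindep : iIndepFun X μ)
    {i j k : Fin p} (hij : T.Adj i j) (hjk : T.Adj j k) (hik : i ≠ k) {e₀ : Sym2 (Fin p)}
    {r : ℕ} {q : Fin r → Fin p × Fin p × Fin p × Fin p} (h : DisjointPaths T i j k e₀ q)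
    (β : Fin r → Bool) {m N : ℕ} (hmN : m ≤ N) :
    μ {ω | empCorr (fun l => X l ω) N s(j, k) ≤ empCorr (fun l => X l ω) N s(i, k) ∧
      ∀ s, (1 - 21 / 40 * (1 - ρ)) * empCorr (fun l => X l ω) m (pathEdge (q s) (β s)) ≤
        empCorr (fun l => X l ω) m s((q s).1, (q s).2.2.2)} ≤
      ENNReal.ofReal ((1 - crossRate ρ) ^ N * ((1 - 27 / 800 * (ρ ^ 2 * (1 - ρ))) ^ r) ^ m) := by
  have hl : 0 < lam := pos_of_tanh_pos (by rw [← hlam]; exact h0)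
  have hne : s(i, j) ≠ s(j, k) := by simp [hik, hij.ne]
  set W : (Fin p → ℤˣ) → ℝ := fun x => ∑ s, weakStep ρ
    (spinProd x s((q s).1, (q s).2.2.2)) (spinProd x (pathEdge (q s) (β s))) with hW
  set A : (Fin p → ℤˣ) → ℝ := fun x =>
    Real.exp (arcStep lam (spinProd x s(i, j)) (spinProd x s(j, k))) with hA
  refine le_trans (measure_mono fun ω hω => ?_) ((measure_sum_nonneg_le hlaw hindep N
    (fun l x => arcStep lam (spinProd x s(i, j)) (spinProd x s(j, k)) +
      if l < m then W x else 0)).trans (ENNReal.ofReal_le_ofReal ?_))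
  · simp only [Set.mem_ofPred_eq] at hω ⊢
    rw [Finset.sum_add_distrib, sum_range_ite hmN (fun l => W (X l ω))]
    refine add_nonneg ?_ ?_
    · simp only [arcStep, ← spinProd_path]
      rw [← Finset.mul_sum, Finset.sum_sub_distrib, sum_spinProd (fun l => X l ω),
        sum_spinProd (fun l => X l ω), ← mul_sub]
      have := sub_nonneg.2 hω.1
      positivity
    · simp only [hW, weakStep]
      rw [Finset.sum_comm]
      refine Finset.sum_nonneg fun s _ => ?_
      rw [← Finset.mul_sum, Finset.sum_sub_distrib, ← Finset.mul_sum,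
        sum_spinProd (fun l => X l ω), sum_spinProd (fun l => X l ω)]
      have h2 := mul_nonneg (Nat.cast_nonneg (α := ℝ) m) (sub_nonneg.2 (hω.2 s))
      refine mul_nonneg (by positivity) ?_
      linarith
  · rw [← prod_range_ite hmN]
    refine Finset.prod_le_prod (fun _ _ => isingE_nonneg fun _ => (Real.exp_pos _).le)
      fun l _ => ?_
    have hAE : isingE T lam A = 1 - crossRate ρ := by
      rw [hlam]
      exact isingE_arc hT hij hjk hne
    split_ifs
    · have := h.isingE_le hT hlam h0 h1 (A := A) (fun x => (Real.exp_pos _).le)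
        (fun s b x => by
          obtain ⟨h2, h3⟩ := h.pathEdge_ne_path s b
          simp only [hA]
          rw [spinProd_flip_of_ne hT (h.pathEdge_mem s b) hij h2,
            spinProd_flip_of_ne hT (h.pathEdge_mem s b) hjk h3]) β Finset.univ
      rw [hAE, Finset.card_univ, Fintype.card_fin] at this
      rw [mul_comm]
      refine le_trans (le_of_eq ?_) this
      congr 1
      funext x
      rw [Real.exp_add]
    · simp only [add_zero, mul_one]
      exact hAE.le

end Local

end ActiveLathe

namespace ActiveLathe

/-! ### The error events of the local phase -/

section LocalEvents

variable {p : ℕ} {T : SimpleGraph (Fin p)} {lam ρ : ℝ} {Ω : Type*} [MeasurableSpace Ω]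
  {μ : Measure Ω} [IsProbabilityMeasure μ] {X : ℕ → Ω → Fin p → ℤˣ}

/-- The number of samples of the unconfident nodes, if there are `P` of them. -/
noncomputable def totalCount (p : ℕ) (α : ℝ) (P n : ℕ) : ℕ :=
  ⌊α * n⌋₊ + ⌊(1 - α) * n * p / (P : ℝ)⌋₊

/-- If `P` nodes are at most p/k, the remaining budget buys at least `k` times as many samples. It
is used with `k = 3` and `k = 1`. -/
theorem le_totalCount {α : ℝ} (hα : α ≤ 1) {P k : ℕ} (hP : P ≠ 0) (hk : k * P ≤ p) (n : ℕ) :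
    (α + (1 - α) * k) * n - 2 ≤ (totalCount p α P n : ℝ) := by
  have hP' : (0 : ℝ) < P := by positivity
  have hk' : (k : ℝ) * P ≤ p := by exact_mod_cast hk
  have h1 : (1 - α) * n * k ≤ (1 - α) * n * p / P := by
    rw [le_div_iff₀ hP', mul_assoc]
    exact mul_le_mul_of_nonneg_left hk' (mul_nonneg (by linarith) (by positivity))
  have h2 := Nat.sub_one_lt_floor (α * n)
  have h3 := Nat.sub_one_lt_floor ((1 - α) * n * p / (P : ℝ))
  rw [totalCount, Nat.cast_add]
  linarith

theorem floor_le_totalCount (α : ℝ) (P n : ℕ) : ⌊α * n⌋₊ ≤ totalCount p α P n :=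
  Nat.le_add_right _ _

/-- For distant pairs the samples of the global phase alone already give the required exponent. -/
theorem boundedBy_long (hT : T.IsTree) (hlam : ρ = Real.tanh lam) (h0 : 0 < ρ) (h1 : ρ < 1)
    (hlaw : ∀ l, HasLaw (X l) (isingPMF T lam).toMeasure μ) (hindep : iIndepFun X μ)
    {α c : ℝ} (hc : c ≤ α * globalGain ρ) (P : ℕ) :
    BoundedBy μ (fun n => {ω | ∃ u v, (u ≠ v ∧ ¬ T.Adj u v ∧ ¬ ∃ j, T.Adj u j ∧ T.Adj j v) ∧
      ¬ Separated T (empCorr (fun l => X l ω) (totalCount p α P n)) u v})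
      (fun n => Real.exp (-(c * kPassive ρ * n))) := by
  have hb : ∀ n : ℕ, 0 ≤ Real.exp (-(c * kPassive ρ * n)) := fun n => (Real.exp_pos _).le
  refine (BoundedBy.exists (ι := Fin p × Fin p × Fin p × Fin p) hb (B := fun q n =>
      {ω | (q.1 ≠ q.2.1 ∧ ¬ T.Adj q.1 q.2.1 ∧ (¬ ∃ j, T.Adj q.1 j ∧ T.Adj j q.2.1) ∧
        T.Adj q.2.2.1 q.2.2.2 ∧ Cuts T s(q.2.2.1, q.2.2.2) q.1 q.2.1) ∧
        ω ∈ {ω | empCorr (fun l => X l ω) (totalCount p α P n) s(q.2.2.1, q.2.2.2) ≤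
          empCorr (fun l => X l ω) (totalCount p α P n) s(q.1, q.2.1)}})
    fun q => BoundedBy.const_and fun hq => ?_).mono ?_
  · refine BoundedBy.of_pow (fun n => measure_long_le hT hlam h0 h1 hlaw hindep hq.1 hq.2.1
      hq.2.2.1 hq.2.2.2.1 hq.2.2.2.2 _) (globalRate_pos h0 h1)
      (one_sub_crossRate_mul_le h0 h1 (one_le_globalGain h0))
      (mul_nonneg (by linarith [one_le_globalGain h0]) (kPassive_pos h0 h1).le)
      (fun n => (sub_two_le_floor (α := α) n).trans
        (Nat.cast_le.2 (floor_le_totalCount α P n))) ?_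
    have := mul_le_mul_of_nonneg_right hc (kPassive_pos h0 h1).le
    linarith
  · rintro n ω ⟨u, v, ⟨huv, hadj, hmid⟩, hsep⟩
    simp only [Separated, not_forall, not_lt] at hsep
    obtain ⟨a, b, hab, hcut, hle⟩ := hsep
    exact ⟨(u, v, a, b), ⟨huv, hadj, hmid, hab, hcut⟩, hle⟩

/-- If there are few unconfident nodes, then the pairs of nodes are separated by the additional
samples. -/
theorem boundedBy_few (hT : T.IsTree) (hlam : ρ = Real.tanh lam) (h0 : 0 < ρ) (h1 : ρ < 1)
    (hlaw : ∀ l, HasLaw (X l) (isingPMF T lam).toMeasure μ) (hindep : iIndepFun X μ)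
    {α c : ℝ} (hα : α ≤ 1) (hc : c ≤ 3 - 2 * α) {P : ℕ} (hP : P ≠ 0) (hP3 : 3 * P ≤ p) :
    BoundedBy μ (fun n => {ω | ∃ u v, (u ≠ v ∧ ¬ T.Adj u v) ∧
      ¬ Separated T (empCorr (fun l => X l ω) (totalCount p α P n)) u v})
      (fun n => Real.exp (-(c * kPassive ρ * n))) := by
  subst hlam
  have hb : ∀ n : ℕ, 0 ≤ Real.exp (-(c * kPassive (Real.tanh lam) * n)) :=
    fun n => (Real.exp_pos _).le
  refine (BoundedBy.exists (ι := Fin p × Fin p × Fin p × Fin p) hb (B := fun q n =>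
      {ω | (q.1 ≠ q.2.1 ∧ ¬ T.Adj q.1 q.2.1 ∧
        T.Adj q.2.2.1 q.2.2.2 ∧ Cuts T s(q.2.2.1, q.2.2.2) q.1 q.2.1) ∧
        ω ∈ {ω | empCorr (fun l => X l ω) (totalCount p α P n) s(q.2.2.1, q.2.2.2) ≤
          empCorr (fun l => X l ω) (totalCount p α P n) s(q.1, q.2.1)}})
    fun q => BoundedBy.const_and fun hq => ?_).mono ?_
  · refine BoundedBy.of_pow (fun n => measure_cross_le hT h0 hlaw hindep hq.1 hq.2.1
      hq.2.2.1 hq.2.2.2 _) (by linarith [crossRate_lt_half h0])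
      (exp_neg_kPassive h0 h1).ge (kPassive_pos h0 h1).le (le_totalCount hα hP hP3) ?_
    have := mul_le_mul_of_nonneg_right hc (kPassive_pos h0 h1).le
    push_cast
    linarith
  · rintro n ω ⟨u, v, ⟨huv, hadj⟩, hsep⟩
    simp only [Separated, not_forall, not_lt] at hsep
    obtain ⟨a, b, hab, hcut, hle⟩ := hsep
    exact ⟨(u, v, a, b), ⟨huv, hadj, hab, hcut⟩, hle⟩

theorem boundedBy_cross_weak (hT : T.IsTree) (hlam : ρ = Real.tanh lam) (h0 : 0 < ρ) (h1 : ρ < 1)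
    (hlaw : ∀ l, HasLaw (X l) (isingPMF T lam).toMeasure μ) (hindep : iIndepFun X μ)
    {α c : ℝ} (hα0 : 4 / 5 ≤ α) (hα : α ≤ 1) (hc : c ≤ 7 / 5) {P : ℕ} (hP : P ≠ 0) (hPp : P ≤ p)
    {i j k : Fin p} (hij : T.Adj i j) (hjk : T.Adj j k) (hik : i ≠ k) {e₀ : Sym2 (Fin p)}
    {q : Fin 8 → Fin p × Fin p × Fin p × Fin p} (h : DisjointPaths T i j k e₀ q)
    (β : Fin 8 → Bool) :
    BoundedBy μ (fun n => {ω | empCorr (fun l => X l ω) (totalCount p α P n) s(j, k) ≤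
        empCorr (fun l => X l ω) (totalCount p α P n) s(i, k) ∧
      ∀ s, (1 - 21 / 40 * (1 - ρ)) * empCorr (fun l => X l ω) ⌊α * n⌋₊ (pathEdge (q s) (β s)) ≤
        empCorr (fun l => X l ω) ⌊α * n⌋₊ s((q s).1, (q s).2.2.2)})
      (fun n => Real.exp (-(c * kPassive ρ * n))) := by
  have hK := kPassive_pos h0 h1
  have hq : 0 < ρ ^ 2 * (1 - ρ) := mul_pos (by positivity) (by linarith)
  refine ⟨Real.exp (2 * kPassive ρ + 27 / 50 * (ρ ^ 2 * (1 - ρ))), (Real.exp_pos _).le, fun n =>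
    (measure_cross_weak_le hT hlam h0 h1 hlaw hindep hij hjk hik h β
      (floor_le_totalCount α P n)).trans (ENNReal.ofReal_le_ofReal ?_)⟩
  have hM : 1 - 27 / 800 * (ρ ^ 2 * (1 - ρ)) ≤ Real.exp (-(27 / 800 * (ρ ^ 2 * (1 - ρ)))) := by
    linarith [Real.add_one_le_exp (-(27 / 800 * (ρ ^ 2 * (1 - ρ))))]
  have hM0 : 0 ≤ 1 - 27 / 800 * (ρ ^ 2 * (1 - ρ)) := by
    have : ρ ^ 2 ≤ 1 := by nlinarith
    nlinarith
  have hN := le_totalCount (p := p) hα hP (k := 1) (by omega) n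
  have hm := sub_two_le_floor (α := α) n
  rw [← exp_neg_kPassive h0 h1, ← Real.exp_add]
  refine (mul_le_mul_of_nonneg_left (pow_le_pow_left₀ (pow_nonneg hM0 8)
    (pow_le_pow_left₀ hM0 hM 8) _) (by positivity)).trans ?_
  rw [← Real.exp_nat_mul, ← Real.exp_nat_mul, ← Real.exp_nat_mul, ← Real.exp_add, Real.exp_le_exp]
  have e1 := mul_le_mul_of_nonneg_right hN hK.le
  have e2 := mul_le_mul_of_nonneg_right hm hq.le
  have hn : (0 : ℝ) ≤ n := Nat.cast_nonneg n
  -- Eight weak paths cost 8·27/800 = 27/100 per sample, and 27/100·4/5 = 2/5·27/50 exactly.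
  have e3 : (c - 1) * kPassive ρ ≤ 27 / 100 * α * (ρ ^ 2 * (1 - ρ)) := by
    have f1 : (c - 1) * kPassive ρ ≤ 2 / 5 * kPassive ρ :=
      mul_le_mul_of_nonneg_right (by linarith) hK.le
    have f2 := kPassive_le h0 h1
    have f3 := mul_le_mul_of_nonneg_right hα0 hq.le
    linarith
  have e4 := mul_le_mul_of_nonneg_right e3 hn
  push_cast at e1 ⊢
  linarith

/-- If there are many unconfident nodes, then an error of the local phase requires that many
confident events fail. -/
theorem boundedBy_many [DecidableRel T.Adj] (hT : T.IsTree) (hlam : ρ = Real.tanh lam) (h0 : 0 < ρ)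
    (h1 : ρ < 1) (hlaw : ∀ l, HasLaw (X l) (isingPMF T lam).toMeasure μ) (hindep : iIndepFun X μ)
    (hdeg : 82 * T.maxDegree ≤ p) (R : MaxTreeRule (Fin p)) {α c : ℝ} (hα0 : 4 / 5 ≤ α)
    (hα : α ≤ 1) (hc : c ≤ 7 / 5) {P : ℕ} (hPp : P ≤ p) (hP3 : p < 3 * P) :
    BoundedBy μ (fun n => {ω |
      |rhoHat R (fun l => X l ω) ⌊α * n⌋₊ - ρ| ≤ ρ * (1 - ρ) / 6 ∧
      Regular T (empCorr (fun l => X l ω) ⌊α * n⌋₊) (confFactor R (fun l => X l ω) ⌊α * n⌋₊) ∧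
      unconfidentCount R (fun l => X l ω) ⌊α * n⌋₊ = P ∧
      ∃ u v, (u ≠ v ∧ ∃ j, T.Adj u j ∧ T.Adj j v) ∧
      ¬ Separated T (empCorr (fun l => X l ω) (totalCount p α P n)) u v})
      (fun n => Real.exp (-(c * kPassive ρ * n))) := by
  have hb : ∀ n : ℕ, 0 ≤ Real.exp (-(c * kPassive ρ * n)) := fun n => (Real.exp_pos _).le
  refine (BoundedBy.exists (ι := (Fin p × Fin p × Fin p) × Sym2 (Fin p) ×
    (Fin 8 → Fin p × Fin p × Fin p × Fin p) × (Fin 8 → Bool)) hb (B := fun z n =>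
      {ω | (T.Adj z.1.1 z.1.2.1 ∧ T.Adj z.1.2.1 z.1.2.2 ∧ z.1.1 ≠ z.1.2.2 ∧
        DisjointPaths T z.1.1 z.1.2.1 z.1.2.2 z.2.1 z.2.2.1) ∧
        ω ∈ {ω | empCorr (fun l => X l ω) (totalCount p α P n) s(z.1.2.1, z.1.2.2) ≤
          empCorr (fun l => X l ω) (totalCount p α P n) s(z.1.1, z.1.2.2) ∧
          ∀ s, (1 - 21 / 40 * (1 - ρ)) *
              empCorr (fun l => X l ω) ⌊α * n⌋₊ (pathEdge (z.2.2.1 s) (z.2.2.2 s)) ≤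
            empCorr (fun l => X l ω) ⌊α * n⌋₊ s((z.2.2.1 s).1, (z.2.2.1 s).2.2.2)}})
    fun z => BoundedBy.const_and fun hz => boundedBy_cross_weak hT hlam h0 h1 hlaw hindep hα0 hα hc
      (by omega) hPp hz.1 hz.2.1 hz.2.2.1 hz.2.2.2 z.2.2.2).mono ?_
  rintro n ω ⟨hrho, hreg, hcount, u, v, ⟨huv, j, huj, hjv⟩, hsep⟩
  simp only [Separated, not_forall, not_lt] at hsep
  obtain ⟨a, b, hab, hcut, hle⟩ := hsep
  -- The path is oriented so that the overtaken edge comes last.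
  obtain ⟨i, k, hij, hjk, hik, hle'⟩ : ∃ i k, T.Adj i j ∧ T.Adj j k ∧ i ≠ k ∧
      empCorr (fun l => X l ω) (totalCount p α P n) s(j, k) ≤
        empCorr (fun l => X l ω) (totalCount p α P n) s(i, k) := by
    have hmem := hcut.mem_edges (SimpleGraph.Walk.cons huj (SimpleGraph.Walk.cons hjv .nil))
    simp only [SimpleGraph.Walk.edges_cons, SimpleGraph.Walk.edges_nil, List.mem_cons,
      List.not_mem_nil, or_false] at hmem
    rcases hmem with hmem | hmem
    · refine ⟨v, u, hjv.symm, huj.symm, huv.symm, ?_⟩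
      rw [Sym2.eq_swap, ← hmem, Sym2.eq_swap (a := v)]
      exact hle
    · refine ⟨u, v, huj, hjv, huv, ?_⟩
      rw [← hmem]
      exact hle
  rw [abs_le] at hrho
  -- For the smallest admissible estimate the gap is (9/20 + 3ρ/40)(1 - ρ), and 9/20 + 3/40 = 21/40.
  have hf : 1 - 21 / 40 * (1 - ρ) ≤ confFactor R (fun l => X l ω) ⌊α * n⌋₊ := by
    rw [confFactor]
    nlinarith [hrho.1]
  -- The count suffices since 3·(27d) = 81d < 82d ≤ p < 3P, where 27d = 3d(8 + 1).
  obtain ⟨e₀, he₀, q, hq, hqq⟩ := hreg.exists_disjoint_weakPaths (r := 8) (by linarith) hT hij hjk hik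
    (by rw [hcount]; omega)
  have hβ : ∀ s, ∃ β, confFactor R (fun l => X l ω) ⌊α * n⌋₊ *
      empCorr (fun l => X l ω) ⌊α * n⌋₊ (pathEdge (q s) β) <
        empCorr (fun l => X l ω) ⌊α * n⌋₊ s((q s).1, (q s).2.2.2) := by
    intro s
    rcases (hq s).1.2.2.2.2 with h | h
    · exact ⟨true, h⟩
    · exact ⟨false, h⟩
  choose β hβ using hβ
  have hdis : DisjointPaths T i j k e₀ q :=
    ⟨he₀, fun s => (hq s).1.1, fun s => (hq s).1.2.1, fun s => (hq s).1.2.2.1,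
      fun s => (hq s).1.2.2.2.1, fun s => (hq s).2.1, fun s => (hq s).2.2.1,
      fun s => (hq s).2.2.2, hqq⟩
  refine ⟨((i, j, k), e₀, q, β), ⟨hij, hjk, hik, hdis⟩, hle', fun s => ?_⟩
  have hpos : 0 < empCorr (fun l => X l ω) ⌊α * n⌋₊ (pathEdge (q s) (β s)) := by
    cases β s
    · exact hreg.pos (hdis.right s)
    · exact hreg.pos (hdis.left s)
  exact (mul_le_mul_of_nonneg_right hf hpos.le).trans (hβ s).le

end LocalEvents

/-! ### The exponent of the active algorithm -/

section Active

/-- The possible fractions of the global phase. -/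
noncomputable def alphaValues : Finset ℝ := {1, 0.995, 0.985, 0.95, 0.9, 0.85, 0.8}

theorem four_fifths_le_of_mem {α : ℝ} (h : α ∈ alphaValues) : 4 / 5 ≤ α := by
  simp only [alphaValues, Finset.mem_insert, Finset.mem_singleton] at h
  rcases h with rfl | rfl | rfl | rfl | rfl | rfl | rfl <;> norm_num

/-- Wherever the loop stops, its last fraction is the table value of an estimate made at one of
seven sample sizes, so concentration at these sizes suffices. -/
theorem exists_alphaHat_eq {V : Type*} [Fintype V] (R : MaxTreeRule V) (x : ℕ → V → ℤˣ) (n : ℕ) :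
    ∃ β ∈ alphaValues, alphaHat R x n = alphaTable (rhoHat R x ⌊β * n⌋₊) := by
  classical
  have hmem : (0.8 : ℝ) ∈ alphaValues := by simp [alphaValues]
  obtain ⟨h1, h2⟩ := Nat.find_spec (exists_stop R x n)
  have hdef : alphaHat R x n = alphaSeq R x n (Nat.find (exists_stop R x n)) := by
    rw [alphaHat]
  rw [hdef]
  generalize Nat.find (exists_stop R x n) = i at h1 h2
  match i, h1, h2 with
  -- The initial fraction is not a table value by definition. But 0.8 is the least table value, so
  -- stopping at once means that the next value equals it.
  | 1, _, h2 =>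
    refine ⟨0.8, hmem, ?_⟩
    have h3 := alphaTable_ge (rhoHat R x ⌊(0.8 : ℝ) * n⌋₊)
    simp only [alphaSeq] at h2 ⊢
    linarith
  | 2, _, _ => exact ⟨0.8, hmem, by simp only [alphaSeq]⟩
  | i + 3, _, _ => exact ⟨alphaSeq R x n (i + 2), alphaTable_mem _, by simp only [alphaSeq]⟩

variable {p : ℕ} {T : SimpleGraph (Fin p)} {lam ρ : ℝ} {Ω : Type*} [MeasurableSpace Ω]
  {μ : Measure Ω} [IsProbabilityMeasure μ] {X : ℕ → Ω → Fin p → ℤˣ}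

theorem le_activeExponent [DecidableRel T.Adj] (hT : T.IsTree) (hlam : ρ = Real.tanh lam)
    (h0 : 0 < ρ) (h1 : ρ < 1) (hlaw : ∀ l, HasLaw (X l) (isingPMF T lam).toMeasure μ)
    (hindep : iIndepFun X μ) (hp : 164 ≤ p) (hdeg : 82 * T.maxDegree ≤ p)
    (R : MaxTreeRule (Fin p)) :
    ((gain ρ * kPassive ρ : ℝ) : EReal) ≤ activeExponent μ X R T := by
  refine BoundedBy.le_exponent ?_
  have hb : ∀ n : ℕ, 0 ≤ Real.exp (-(gain ρ * kPassive ρ * n)) := fun n => (Real.exp_pos _).le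
  have hc : gain ρ ≤ 7 / 5 := (gain_le ρ).2.2.2.2.2.2.trans (by norm_num)
  have conc := BoundedBy.exists (ι := alphaValues) hb fun β =>
    boundedBy_rhoHat hT hlam h0 h1 hlaw hindep hp R (four_fifths_le_of_mem β.2) hc
  have reg := BoundedBy.exists (ι := alphaValues) hb fun α =>
    BoundedBy.const_and (P := gain ρ ≤ α * globalGain ρ) fun hα =>
      boundedBy_not_regular hT hlam h0 h1 hlaw hindep R hα
  have long := BoundedBy.exists (ι := alphaValues × Fin (p + 1)) hb fun z =>
    BoundedBy.const_and (P := gain ρ ≤ z.1 * globalGain ρ) fun hz =>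
      boundedBy_long hT hlam h0 h1 hlaw hindep hz z.2
  have few := BoundedBy.exists (ι := alphaValues × Fin (p + 1)) hb fun z =>
    BoundedBy.const_and (P := (z.1 : ℝ) ≤ 1 ∧ gain ρ ≤ 3 - 2 * (z.1 : ℝ) ∧ (z.2 : ℕ) ≠ 0 ∧
      3 * (z.2 : ℕ) ≤ p) fun hz =>
      boundedBy_few hT hlam h0 h1 hlaw hindep hz.1 hz.2.1 hz.2.2.1 hz.2.2.2
  have many := BoundedBy.exists (ι := alphaValues × Fin (p + 1)) hb fun z =>
    BoundedBy.const_and (P := (z.1 : ℝ) ≤ 1 ∧ p < 3 * (z.2 : ℕ)) fun hz =>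
      boundedBy_many hT hlam h0 h1 hlaw hindep hdeg R (four_fifths_le_of_mem z.1.2) hz.1 hc
        (Nat.lt_succ_iff.1 z.2.2) hz.2
  -- Outside these finitely many families of events, the realised fraction and number of unconfident
  -- nodes are one of the indices, and the tree is correct.
  refine ((conc.or hb reg).or hb (long.or hb (few.or hb many))).mono ?_
  intro n ω hω
  by_contra hno
  simp only [Set.mem_ofPred_eq, not_or] at hno
  obtain ⟨⟨n1, n2⟩, n3, n4, n5⟩ := hno
  set x : ℕ → Fin p → ℤˣ := fun l => X l ω with hx
  have hconc : ∀ β ∈ alphaValues, |rhoHat R x ⌊β * n⌋₊ - ρ| ≤ ρ * (1 - ρ) / 6 := by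
    intro β hβ
    by_contra h
    exact n1 ⟨⟨β, hβ⟩, h⟩
  obtain ⟨β, hβ, hα⟩ := exists_alphaHat_eq R x n
  have hαmem : alphaHat R x n ∈ alphaValues := by
    rw [hα]
    exact alphaTable_mem _
  obtain ⟨g1, g2⟩ := gain_le_alphaTable h0 (hconc β hβ)
  have hα1 := alphaTable_le_one (rhoHat R x ⌊β * n⌋₊)
  rw [← hα] at g1 g2 hα1
  have hreg : Regular T (empCorr x (globalCount R x n)) (confFactor R x (globalCount R x n)) := by
    by_contra h
    exact n2 ⟨⟨_, hαmem⟩, g1, hconc _ hαmem, h⟩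
  have hcard : unconfidentCount R x (globalCount R x n) < p + 1 := by
    rw [Nat.lt_succ_iff, unconfidentCount]
    refine (Set.ncard_le_ncard (Set.subset_univ _) (Set.toFinite _)).trans ?_
    rw [Set.ncard_univ, Nat.card_eq_fintype_card, Fintype.card_fin]
  have hcount : globalCount R x n + localCount R x n =
      totalCount p (alphaHat R x n) (unconfidentCount R x (globalCount R x n)) n := by
    rw [totalCount, globalCount, localCount, Fintype.card_fin, globalCount]
  refine hω (activeTree_eq hT hreg fun hP u v huv hadj => ?_)
  rw [hcount]
  by_contra hsep
  by_cases hmid : ∃ j, T.Adj u j ∧ T.Adj j v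
  · rcases le_or_gt (3 * unconfidentCount R x (globalCount R x n)) p with h3 | h3
    · exact n4 ⟨⟨⟨_, hαmem⟩, ⟨_, hcard⟩⟩, ⟨hα1, g2, hP, h3⟩, u, v, ⟨huv, hadj⟩, hsep⟩
    · exact n5 ⟨⟨⟨_, hαmem⟩, ⟨_, hcard⟩⟩, ⟨hα1, h3⟩, hconc _ hαmem, hreg, rfl, u, v, ⟨huv, hmid⟩,
        hsep⟩
  · exact n3 ⟨⟨⟨_, hαmem⟩, ⟨_, hcard⟩⟩, g1, u, v, ⟨huv, hadj, hmid⟩, hsep⟩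

/-- A tree with at least three nodes contains a path of two edges. -/
theorem exists_path_of_isTree (hT : T.IsTree) (hp : 3 ≤ p) :
    ∃ i j k, T.Adj i j ∧ T.Adj j k ∧ i ≠ k := by
  have : Nontrivial (Fin p) := Fin.nontrivial_iff_two_le.2 (by omega)
  obtain ⟨b, hab⟩ := hT.connected.preconnected.exists_adj_of_nontrivial ⟨0, by omega⟩
  generalize (⟨0, by omega⟩ : Fin p) = a at hab
  obtain ⟨c, hc⟩ : ∃ c, c ∉ ({a, b} : Finset (Fin p)) := by
    by_contra! hall
    have h1 := Finset.card_le_card (fun c _ => hall c : Finset.univ ⊆ ({a, b} : Finset (Fin p)))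
    have h2 := Finset.card_le_two (a := a) (b := b)
    rw [Finset.card_univ, Fintype.card_fin] at h1
    omega
  obtain ⟨w⟩ := hT.connected.preconnected a c
  obtain ⟨d, -, h1, h2⟩ := w.exists_boundary_dart (({a, b} : Finset (Fin p)) : Set (Fin p))
    (by simp) (by simpa using hc)
  have hd := d.adj
  simp only [Finset.coe_insert, Finset.coe_singleton, Set.mem_insert_iff,
    Set.mem_singleton_iff, not_or] at h1 h2
  rcases h1 with h1 | h1
  · rw [h1] at hd
    exact ⟨b, a, d.snd, hab.symm, hd, Ne.symm h2.2⟩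
  · rw [h1] at hd
    exact ⟨a, b, d.snd, hab, hd, Ne.symm h2.1⟩

theorem two_le_maxDegree [DecidableRel T.Adj] {i j k : Fin p} (hij : T.Adj i j) (hjk : T.Adj j k)
    (hik : i ≠ k) : 2 ≤ T.maxDegree := by
  refine le_trans ?_ (T.degree_le_maxDegree j)
  rw [← SimpleGraph.card_neighborFinset_eq_degree]
  exact Finset.one_lt_card.2 ⟨i, by simpa using hij.symm, k, by simpa using hjk, hik⟩

end Active

end ActiveLathe

theorem theorem1 {p : ℕ} (hp : 2 ≤ p)
    (T : SimpleGraph (Fin p)) [DecidableRel T.Adj] (hT : T.IsTree)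
    (hdeg : 82 * T.maxDegree ≤ p)
    (lam ρ : ℝ) (hlam : ρ = Real.tanh lam) (hρ0 : 0 < ρ) (hρ1 : ρ < 1)
    {Ω : Type*} [MeasurableSpace Ω] (μ : Measure Ω) [IsProbabilityMeasure μ]
    (X : ℕ → Ω → Fin p → ℤˣ)
    (hlaw : ∀ l, HasLaw (X l) (ActiveLathe.isingPMF T lam).toMeasure μ)
    (hindep : iIndepFun X μ)
    (R : ActiveLathe.MaxTreeRule (Fin p)) :
    ActiveLathe.passiveExponent μ X R T = ((ActiveLathe.kPassive ρ : ℝ) : EReal) ∧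
    ((ActiveLathe.gain ρ : ℝ) : EReal) * ActiveLathe.passiveExponent μ X R T ≤
      ActiveLathe.activeExponent μ X R T := by
  have : Nontrivial (Fin p) := Fin.nontrivial_iff_two_le.2 hp
  obtain ⟨b, hab⟩ := hT.connected.preconnected.exists_adj_of_nontrivial ⟨0, by omega⟩
  have hdeg1 : 1 ≤ T.maxDegree :=
    (T.degree_pos_iff_exists_adj _).2 ⟨b, hab⟩ |>.trans_le (T.degree_le_maxDegree _)
  -- Degree at least 1 gives p ≥ 82, hence a path of two edges. Its middle vertex then has degree at
  -- least 2, so p ≥ 164, as the concentration bound requires.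
  obtain ⟨i, j, k, hij, hjk, hik⟩ := ActiveLathe.exists_path_of_isTree hT (by omega)
  have hdeg2 := ActiveLathe.two_le_maxDegree hij hjk hik
  have hpassive := ActiveLathe.passiveExponent_eq hT hlam hρ0 hρ1 hlaw hindep R hij hjk hik
  refine ⟨hpassive, ?_⟩
  rw [hpassive, ← EReal.coe_mul]
  exact ActiveLathe.le_activeExponent hT hlam hρ0 hρ1 hlaw hindep (by omega) hdeg R
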